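/- Write $\dot{\mathbb R}=\mathbb R\setminus\{0\}$. For an open interval $I$ let $\mathrm{AC}(I)$ be the functions $f$ with $f(y)-f(x)=\int_x^y g$ ($x,y\in I$) for some $g\in L^1_{\rm loc}(I)$; $f\in\mathrm{AC}(\dot{\mathbb R})$ means that both restrictions to $(-\infty,0)$ and $(0,\infty)$ are in $\mathrm{AC}$. For $T\in(0,\infty]$ let $\mathrm{AC}_{1,2}$ be the functions $\Psi:(0,T)\times\dot{\mathbb R}\to\mathbb C$ with $\Psi(\cdot,x)\in\mathrm{AC}((0,T))$ for all $x\in\dot{\mathbb R}$ and $\Psi(t,\cdot),\Psi_x(t,\cdot)\in\mathrm{AC}(\dot{\mathbb R})$ for all $t\in(0,T)$. Let $V:(0,T)\times\dot{\mathbb R}\to\mathbb C$ and $M,N\in\mathbb C^{2\times2}$. For $F:\dot{\mathbb R}\to\mathbb C$, a solution of the Cauchy problem with initial condition $F$ is a $\Psi\in\mathrm{AC}_{1,2}$ such that $$i\Psi_t=-\Psi_{xx}+V\Psi\ \text{ for a.e. }(t,x)\in(0,T)\times\dot{\mathbb R},\qquad \lim_{t\to0^+}\Psi(t,x)=F(x)\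 (x\in\dot{\mathbb R}),$$ $$M\binom{\Psi(t,0^+)}{\Psi(t,0^-)}=N\binom{\Psi_x(t,0^+)}{-\Psi_x(t,0^-)}\quad (t\in(0,T)),$$ where the last (transmission) condition includes the existence of the one-sided limits of $\Psi$ if $(M,N)\ne(0,0)$ and of those of $\Psi_x$ if $N\neq0$, and is void if $M=N=0$. For $\alpha\in(0,\frac\pi2)$ let $S_\alpha=\{z\in\mathbb C\setminus\{0\}:\operatorname{Arg}z\in[0,\alpha]\cup[\pi,\pi+\alpha]\}$. Assume that $G:(0,T)\times\dot{\mathbb R}\times\dot{\mathbb R}\to\mathbb C$ has, for some such $\alpha$, a continuation to $(0,T)\times\dot{\mathbb R}\times S_\alpha$ such that each $G(t,x,\cdot)$ is continuous on $S_\alpha$ and holomorphic in its interior, and (i) for every $z\in S_\alpha$, $G(\cdot,\cdot,z)\in\mathrm{AC}_{1,2}$ satisfies $iG_t=-G_{xx}+VG$ a.e. on $(0,T)\times\dot{\mathbb R}$, and for every $y\in\dot{\mathbb R}$ and $t\in(0,T)$ the function $G(t,\cdot,y)$ satisfies the transmission condition; (ii) for every $x\in\dot{\mathbb R}$ there is $x_0>|x|$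 with $\lim_{t\to0^+}\int_{-x_0}^{x_0}G(t,x,y)\varphi(y)\,dy=\varphi(x)$ for all $\varphi\in C^\infty([-x_0,x_0])$; (iii) there are $a\in\mathrm{AC}((0,T))$ with $a>0$ and $\lim_{t\to0^+}a(t)=\infty$, $p\in(0,2)$, and continuous $A_j,B_j:(0,T)\times\dot{\mathbb R}\to[0,\infty)$, $j=0,1,2$, such that $\widetilde G(t,x,z)=e^{-ia(t)(z-x)^2}G(t,x,z)$ satisfies, for all $t\in(0,T)$, $x\in\dot{\mathbb R}$, $z\in S_\alpha$, the bounds $|\widetilde G|\le A_0e^{B_0|z|^p}$, $|\widetilde G_x|\le A_1e^{B_1|z|^p}$ and (where the derivatives exist) $|\widetilde G_{xx}|,|\widetilde G_t|\le A_2e^{B_2|z|^p}$, with $A_j=A_j(t,x)$, $B_j=B_j(t,x)$; for every $x\in\dot{\mathbb R}$, $A_0(t,x)/\sqrt{a(t)}$ and $B_0(t,x)$ are bounded as $t\to0^+$; and for every $t\in(0,T)$, if $M\ne0$ and $N=0$, then $A_0(t,\cdot),B_0(t,\cdot)$ are bounded as $x\to0^\pm$, while if $N\neq0$, then $A_0(t,\cdot),A_1(t,\cdot),B_0(t,\cdot),B_1(t,\cdot)$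 are bounded as $x\to0^\pm$. Let $q\in(0,2)$, and let $\mathcal A_q(\mathbb C)$ be the space of entire functions $F$ with $|F(z)|\le Ae^{B|z|^q}$ on $\mathbb C$ for some $A,B\ge0$, where $F_n\to F$ in $\mathcal A_q(\mathbb C)$ means that $\sup_{z\in\mathbb C}|F_n(z)-F(z)|e^{-B|z|^q}\to0$ for some $B\ge0$. For $F\in\mathcal A_q(\mathbb C)$ put $$\Psi(t,x;F)=\lim_{\varepsilon\to0^+}\int_{\mathbb R}e^{-\varepsilon y^2}G(t,x,y)F(y)\,dy,\qquad t\in(0,T),\ x\in\dot{\mathbb R}.$$ **Theorem.** Let $\mathcal U\subsetneq\mathcal O\subseteq\mathbb C$, let $\varphi_\kappa\in\mathcal A_q(\mathbb C)$ for $\kappa\in\mathcal O$, and let $F_n=\sum_{l=0}^nC_l(n)\varphi_{\kappa_l(n)}$ with $C_l(n)\in\mathbb C$ and $\kappa_l(n)\in\mathcal U$. Suppose that $F_n\to\varphi_\kappa$ in $\mathcal A_q(\mathbb C)$ for some $\kappa\in\mathcal O\setminus\mathcal U$. Then $\Psi(\cdot,\cdot;F_n)$, $n\in\mathbb N_0$,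 and $\Psi(\cdot,\cdot;\varphi_{\kappa'})$, $\kappa'\in\mathcal O$, are well defined (the integrals converge absolutely for every $\varepsilon>0$ and the limits exist) and are solutions of the Cauchy problem with initial condition $F_n$ and $\varphi_{\kappa'}$, respectively; for all $n$, $t\in(0,T)$ and $x\in\dot{\mathbb R}$ $$\Psi(t,x;F_n)=\sum_{l=0}^nC_l(n)\Psi(t,x;\varphi_{\kappa_l(n)});$$ and for every $t\in(0,T)$ $$\lim_{n\to\infty}\Psi(t,x;F_n)=\lim_{n\to\infty}\sum_{l=0}^nC_l(n)\Psi(t,x;\varphi_{\kappa_l(n)})=\Psi(t,x;\varphi_\kappa)$$ uniformly for $x$ in compact subsets of $\dot{\mathbb R}$. In particular, for every $t\in(0,T)$ the sequence $(\Psi(t,\cdot;F_n))_n$ admits a supershift on $\dot{\mathbb R}$ with respect to the functions $\Psi(t,\cdot;\varphi_{\kappa'})$, $\kappa'\in\mathcal O$: each of its members is a linear combination, with terms $l=0,\dots,n$, of such functions with parameters in $\mathcal U$, and it converges, uniformly on compact subsets of $\dot{\mathbb R}$, to one with parameter in $\mathcal O\setminus\mathcal U$. -/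

import Mathlib

open Filter Topology MeasureTheory Set
open scoped Matrix ContDiff

namespace Supershift

noncomputable section

/-- The open time interval `(0, T)`, where `T ∈ (0, ∞]`. -/
def timeInterval (T : EReal) : Set ℝ := {t : ℝ | 0 < t ∧ (t : EReal) < T}

/-- The closed double sector `{z ≠ 0 | Arg z ∈ [0, α] ∪ [π, π + α]}`; the part with
`Arg z ∈ [π, π + α]` is described as `Arg (-z) ∈ [0, α]`. -/
def doubleSector (α : ℝ) : Set ℂ :=
  {z : ℂ | z ≠ 0 ∧ (Complex.arg z ∈ Icc 0 α ∨ Complex.arg (-z) ∈ Icc 0 α)}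

/-- `f ∈ AC(I)` for an open interval `I`: `f` is the integral of a locally integrable function. -/
def IsAC {E : Type*} [NormedAddCommGroup E] [NormedSpace ℝ E] (I : Set ℝ) (f : ℝ → E) : Prop :=
  ∃ g : ℝ → E, LocallyIntegrableOn g I volume ∧
    ∀ x ∈ I, ∀ y ∈ I, f y - f x = ∫ s in x..y, g s

/-- `f ∈ AC(ℝ \ {0})`. -/
def IsACPunctured (f : ℝ → ℂ) : Prop := IsAC (Iio 0) f ∧ IsAC (Ioi 0) f

/-- `Ψ ∈ AC_{1,2}((0,T) × (ℝ \ {0}))`. That `Ψ_x(t, ·)` is absolutely continuous includes that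
it exists at every point of `ℝ \ {0}`. -/
def IsAC12 (T : EReal) (Ψ : ℝ → ℝ → ℂ) : Prop :=
  (∀ x : ℝ, x ≠ 0 → IsAC (timeInterval T) (fun t => Ψ t x)) ∧
  ∀ t ∈ timeInterval T, IsACPunctured (Ψ t) ∧
    (∀ x : ℝ, x ≠ 0 → DifferentiableAt ℝ (Ψ t) x) ∧ IsACPunctured (deriv (Ψ t))

/-- `i ∂_t Ψ = (-∂_x² + V) Ψ` for almost every `t ∈ (0,T)`, `x ∈ ℝ \ {0}`. -/
def SolvesSchroedinger (T : EReal) (V : ℝ → ℝ → ℂ) (Ψ : ℝ → ℝ → ℂ) : Prop :=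
  ∀ᵐ p : ℝ × ℝ, p.1 ∈ timeInterval T → p.2 ≠ 0 →
    Complex.I * deriv (fun t => Ψ t p.2) p.1 =
      -deriv (deriv (Ψ p.1)) p.2 + V p.1 p.2 * Ψ p.1 p.2

/-- The transmission condition `M (u(0⁺), u(0⁻))ᵀ = N (u'(0⁺), -u'(0⁻))ᵀ`. It includes the existence
of the one-sided limits that occur in it: the limits of `u'` only if `N ≠ 0`, and no limit at all
if `M = N = 0`, where the condition is void. -/
def SatisfiesTransmission (M N : Matrix (Fin 2) (Fin 2) ℂ) (u : ℝ → ℂ) : Prop :=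
  (N = 0 → M ≠ 0 → ∃ up um : ℂ,
    Tendsto u (𝓝[>] 0) (𝓝 up) ∧ Tendsto u (𝓝[<] 0) (𝓝 um) ∧ M *ᵥ ![up, um] = 0) ∧
  (N ≠ 0 → ∃ up um dp dm : ℂ,
    Tendsto u (𝓝[>] 0) (𝓝 up) ∧ Tendsto u (𝓝[<] 0) (𝓝 um) ∧
    Tendsto (deriv u) (𝓝[>] 0) (𝓝 dp) ∧ Tendsto (deriv u) (𝓝[<] 0) (𝓝 dm) ∧
    M *ᵥ ![up, um] = N *ᵥ ![dp, -dm])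

/-- `Ψ` is a solution of the Cauchy problem with potential `V`, transmission matrices `M`, `N` and
initial condition `F`. -/
def IsCauchySolution (T : EReal) (V : ℝ → ℝ → ℂ) (M N : Matrix (Fin 2) (Fin 2) ℂ)
    (F : ℝ → ℂ) (Ψ : ℝ → ℝ → ℂ) : Prop :=
  IsAC12 T Ψ ∧ SolvesSchroedinger T V Ψ ∧
  (∀ t ∈ timeInterval T, SatisfiesTransmission M N (Ψ t)) ∧
  ∀ x : ℝ, x ≠ 0 → Tendsto (fun t => Ψ t x) (𝓝[>] 0) (𝓝 (F x))

/-- The factor `G̃` in the decomposition `G(t,x,z) = exp(i a(t) (z - x)²) G̃(t,x,z)`. -/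
def reducedKernel (a : ℝ → ℝ) (G : ℝ → ℝ → ℂ → ℂ) (t x : ℝ) (z : ℂ) : ℂ :=
  Complex.exp (-(Complex.I * (a t : ℂ) * (z - (x : ℂ)) ^ 2)) * G t x z

/-- The growth condition on `G` (third part of the assumptions on a Green's function). The second
order estimates are required at the points where the respective derivative exists (`deriv` is zero
elsewhere). -/
def HasGrowthBounds (T : EReal) (M N : Matrix (Fin 2) (Fin 2) ℂ) (α : ℝ)
    (G : ℝ → ℝ → ℂ → ℂ) : Prop :=
  ∃ a : ℝ → ℝ, IsAC (timeInterval T) a ∧ (∀ t ∈ timeInterval T, 0 < a t) ∧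
    Tendsto a (𝓝[>] 0) atTop ∧
  ∃ p : ℝ, 0 < p ∧ p < 2 ∧
  ∃ A B : Fin 3 → ℝ → ℝ → ℝ,
    (∀ j, ContinuousOn (Function.uncurry (A j)) (timeInterval T ×ˢ {0}ᶜ)) ∧
    (∀ j, ContinuousOn (Function.uncurry (B j)) (timeInterval T ×ˢ {0}ᶜ)) ∧
    (∀ j, ∀ t ∈ timeInterval T, ∀ x : ℝ, x ≠ 0 → 0 ≤ A j t x ∧ 0 ≤ B j t x) ∧
    (∀ t ∈ timeInterval T, ∀ x : ℝ, x ≠ 0 → ∀ z ∈ doubleSector α,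
      ‖reducedKernel a G t x z‖ ≤ A 0 t x * Real.exp (B 0 t x * ‖z‖ ^ p) ∧
      ‖deriv (fun x' => reducedKernel a G t x' z) x‖
        ≤ A 1 t x * Real.exp (B 1 t x * ‖z‖ ^ p) ∧
      ‖deriv (deriv (fun x' => reducedKernel a G t x' z)) x‖
        ≤ A 2 t x * Real.exp (B 2 t x * ‖z‖ ^ p) ∧
      ‖deriv (fun t' => reducedKernel a G t' x z) t‖
        ≤ A 2 t x * Real.exp (B 2 t x * ‖z‖ ^ p)) ∧
    (∀ x : ℝ, x ≠ 0 → ∃ K : ℝ, ∀ᶠ t in 𝓝[>] (0 : ℝ), A 0 t x / √(a t) ≤ K ∧ B 0 t x ≤ K) ∧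
    (∀ t ∈ timeInterval T,
      (M ≠ 0 → N = 0 → ∃ K : ℝ, ∀ᶠ x in 𝓝[≠] (0 : ℝ), A 0 t x ≤ K ∧ B 0 t x ≤ K) ∧
      (N ≠ 0 → ∃ K : ℝ, ∀ᶠ x in 𝓝[≠] (0 : ℝ),
        A 0 t x ≤ K ∧ A 1 t x ≤ K ∧ B 0 t x ≤ K ∧ B 1 t x ≤ K))

/-- The assumptions on the Green's function `G : (0,T) × (ℝ \ {0}) × (ℝ \ {0}) → ℂ` for the
potential `V` and the transmission matrices `M`, `N`: it has a continuation `Gc` in the last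
variable to a double sector with the listed properties. -/
def IsGreensFunction (T : EReal) (V : ℝ → ℝ → ℂ) (M N : Matrix (Fin 2) (Fin 2) ℂ)
    (G : ℝ → ℝ → ℝ → ℂ) : Prop :=
  ∃ α : ℝ, 0 < α ∧ α < Real.pi / 2 ∧ ∃ Gc : ℝ → ℝ → ℂ → ℂ,
    (∀ t ∈ timeInterval T, ∀ x : ℝ, x ≠ 0 →
      (∀ y : ℝ, y ≠ 0 → Gc t x (y : ℂ) = G t x y) ∧
      ContinuousOn (Gc t x) (doubleSector α) ∧
      DifferentiableOn ℂ (Gc t x) (interior (doubleSector α))) ∧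
    (∀ z ∈ doubleSector α,
      IsAC12 T (fun t x => Gc t x z) ∧ SolvesSchroedinger T V (fun t x => Gc t x z)) ∧
    (∀ y : ℝ, y ≠ 0 → ∀ t ∈ timeInterval T, SatisfiesTransmission M N (fun x => G t x y)) ∧
    (∀ x : ℝ, x ≠ 0 → ∃ x₀ : ℝ, |x| < x₀ ∧
      ∀ f : ℝ → ℂ, ContDiffOn ℝ ∞ f (Icc (-x₀) x₀) →
        Tendsto (fun t => ∫ y in (-x₀)..x₀, G t x y * f y) (𝓝[>] 0) (𝓝 (f x))) ∧
    HasGrowthBounds T M N α Gc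

/-- The space `𝒜_q(ℂ)` of entire functions with exponential growth of order `q`. -/
def expGrowth (q : ℝ) : Set (ℂ → ℂ) :=
  {F | Differentiable ℂ F ∧
    ∃ A B : ℝ, 0 ≤ A ∧ 0 ≤ B ∧ ∀ z : ℂ, ‖F z‖ ≤ A * Real.exp (B * ‖z‖ ^ q)}

/-- Convergence `F n → F₀` in `𝒜_q(ℂ)`. The supremum is taken in `[0, ∞]`. -/
def TendstoExpGrowth (q : ℝ) (F : ℕ → ℂ → ℂ) (F₀ : ℂ → ℂ) : Prop :=
  (∀ n, F n ∈ expGrowth q) ∧ F₀ ∈ expGrowth q ∧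
  ∃ B : ℝ, 0 ≤ B ∧
    Tendsto (fun n => ⨆ z : ℂ, ENNReal.ofReal (‖F n z - F₀ z‖ * Real.exp (-(B * ‖z‖ ^ q))))
      atTop (𝓝 0)

/-- The integrand `exp(-ε y²) G(t,x,y) F(y)`. -/
def regularizedIntegrand (G : ℝ → ℝ → ℝ → ℂ) (F : ℂ → ℂ) (t x ε y : ℝ) : ℂ :=
  Complex.exp (-((ε * y ^ 2 : ℝ) : ℂ)) * G t x y * F (y : ℂ)

/-- The wave function `Ψ(t,x;F) = lim_{ε → 0⁺} ∫ exp(-ε y²) G(t,x,y) F(y) dy`. -/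
def waveFunction (G : ℝ → ℝ → ℝ → ℂ) (F : ℂ → ℂ) (t x : ℝ) : ℂ :=
  limUnder (𝓝[>] (0 : ℝ)) (fun ε => ∫ y : ℝ, regularizedIntegrand G F t x ε y)

/-- The integrals and the limit that define `Ψ(t,x;F)` exist, and `Ψ(·,·;F)` is a solution of the
Cauchy problem with initial condition `F`. -/
def WaveFunctionSolves (T : EReal) (V : ℝ → ℝ → ℂ) (M N : Matrix (Fin 2) (Fin 2) ℂ)
    (G : ℝ → ℝ → ℝ → ℂ) (F : ℂ → ℂ) : Prop :=
  (∀ t ∈ timeInterval T, ∀ x : ℝ, x ≠ 0 →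
    (∀ ε : ℝ, 0 < ε → Integrable (regularizedIntegrand G F t x ε)) ∧
    Tendsto (fun ε => ∫ y : ℝ, regularizedIntegrand G F t x ε y) (𝓝[>] 0)
      (𝓝 (waveFunction G F t x))) ∧
  IsCauchySolution T V M N (fun x => F (x : ℂ)) (waveFunction G F)

/-- The sequence `Φ` admits a supershift with respect to the family `φ κ`, `κ ∈ O`, and `U ⊊ O`. -/
def AdmitsSupershift {X : Type*} [MetricSpace X] (O U : Set ℂ) (φ : ℂ → X → ℂ)
    (Φ : ℕ → X → ℂ) : Prop :=
  U ⊂ O ∧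
  (∃ (C : ℕ → ℕ → ℂ) (k : ℕ → ℕ → ℂ), (∀ n, ∀ l ≤ n, k n l ∈ U) ∧
    ∀ n s, Φ n s = ∑ l ∈ Finset.range (n + 1), C n l * φ (k n l) s) ∧
  ∃ κ ∈ O \ U, ∀ K : Set X, IsCompact K → TendstoUniformlyOn Φ (φ κ) atTop K

end

end Supershift

/-! The kernel is `exp(i a (z - x)²)` times a factor of exponential order `p < 2`. On the real line
the phase has modulus one and gives no decay. On the line `z = e^{iβ} y` its modulus is `exp(-a
sin(2β) y² + 2 a x y sin β)`, a Gaussian that absorbs both the order `p` growth of the kernel and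
the order `q` growth of `F`. If `β ≤ π/4`, then `Re z² ≥ 0` on the double sector, so the damping
`exp(-ε z²)` never exceeds one there. For `ε > 0` Cauchy's theorem
(`integral_Ioi_eq_integral_rotated`) moves the damped integral to the rotated line, where `ε → 0` is
harmless. Hence `Ψ(t,x;F)` is an absolutely convergent integral, linear in `F`, over the rotated
line (`IsSectorKernel.waveFunction_eq`), and all claims are proved for this integral.

Regularity and equation: the phase also dominates the derivatives in `x` and `t`, so one may
differentiate under the integral, in the absolutely continuous sense, by Fubini. For each `z` the
equation holds off a null set that depends on `z`, and `V` need not be measurable; eliminating `V`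
first (`ae_ae_eq_mul`) allows the quantifiers to be exchanged, which gives
`IsDominatedFamily.solvesSchroedinger_integral`.

Transmission condition: the limits of `G` at `x = 0±` are available only for real `y`, where decay
needs `ε > 0`. The condition is integrated over the real line for `ε > 0`; the rotated line shows
that `ε → 0` is uniform in `x` near `0`, so the two limits commute
(`IsSectorKernel.satisfiesTransmission_rayWave`).

Initial condition: only the parts beyond `±x₀`, with `x₀ > |x|`, are rotated. Assumption (ii) treats
the segment, and the tails are `O(A₀ / a) = O(1 / √a)` (`IsSectorKernel.tendsto_rayWave_time`).

Supershift: on the rotated line `F ↦ Ψ(t,·;F)` is continuous from `𝒜_q(ℂ)` to uniform convergence on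
compact sets (`IsGreensFunction.tendstoUniformlyOn_waveFunction`). With linearity this carries the
convergence of the initial values over to the solutions. -/

namespace Supershift

/-! ### Joint measurability of parameter-dependent functions and their derivatives -/

section Measurability

variable {X : Type*} [MeasurableSpace X]

/-- Carathéodory functions are jointly measurable; the indicator confines the claim to the set `U`
where continuity in the second variable is known. -/
theorem measurable_indicator_of_continuousOn_of_measurable {U : Set ℝ} (hU : MeasurableSet U)
    {f : X → ℝ → ℂ} (hc : ∀ x, ContinuousOn (f x) U) (hm : ∀ s ∈ U, Measurable fun x => f x s) :
    Measurable fun p : X × ℝ => U.indicator (f p.1) p.2 := by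
  have h1 : Measurable (Function.uncurry fun (s : U) (x : X) => f x s) :=
    measurable_uncurry_of_continuous_of_measurable
      (fun x => continuousOn_iff_continuous_domRestrict.1 (hc x)) (fun s => hm s s.2)
  have hS : MeasurableSet {p : X × ℝ | p.2 ∈ U} := measurable_snd hU
  refine measurable_of_restrict_of_restrict_compl hS ?_ ?_
  · have h2 : Measurable fun p : {p : X × ℝ | p.2 ∈ U} => ((⟨p.1.2, p.2⟩ : U), p.1.1) :=
      ((measurable_snd.comp measurable_subtype_coe).subtype_mk).prodMk
        (measurable_fst.comp measurable_subtype_coe)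
    convert h1.comp h2 using 1
    funext p
    exact Set.indicator_of_mem (s := U) p.2 (f p.1.1)
  · convert measurable_const (a := (0 : ℂ)) using 1
    funext p
    exact Set.indicator_of_notMem (s := U) p.2 (f p.1.1)

/-- A function that is continuous near `s` is differentiable at `s` as soon as its difference
quotients converge along rational increments. -/
theorem hasDerivAt_of_tendsto_rat {U : Set ℝ} (hU : IsOpen U) {f : ℝ → ℂ} (hc : ContinuousOn f U)
    {s : ℝ} (hs : s ∈ U) {c : ℂ}
    (h : Tendsto (fun r : ℚ => ((r : ℝ)⁻¹ : ℝ) • (f (s + r) - f s))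
      (comap (fun r : ℚ => (r : ℝ)) (𝓝[≠] 0)) (𝓝 c)) : HasDerivAt f c s := by
  rw [hasDerivAt_iff_tendsto_slope_zero]
  obtain ⟨δ, hδ, hball⟩ := Metric.isOpen_iff.1 hU s hs
  rw [Metric.tendsto_nhdsWithin_nhds]
  intro ε hε
  rw [Metric.tendsto_nhds] at h
  have h2 := h (ε / 2) (by positivity)
  rw [eventually_comap, eventually_nhdsWithin_iff, Metric.eventually_nhds_iff] at h2
  obtain ⟨δ', hδ', h3⟩ := h2
  refine ⟨min δ δ', lt_min hδ hδ', fun {x} hx hxd => ?_⟩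
  have hx0 : x ≠ 0 := hx
  rw [Real.dist_eq, sub_zero] at hxd
  have hcont : ContinuousAt (fun t : ℝ => dist ((t⁻¹ : ℝ) • (f (s + t) - f s)) c) x := by
    have hfc : ContinuousAt f (s + x) := hc.continuousAt (hU.mem_nhds (hball (by
      rw [Metric.mem_ball, Real.dist_eq]; simpa using lt_of_lt_of_le hxd (min_le_left _ _))))
    have hfc' : ContinuousAt (fun t => f (s + t)) x :=
      ContinuousAt.comp (f := fun t => s + t) hfc (by fun_prop)
    exact (((continuousAt_id.inv₀ hx0).smul (hfc'.sub continuousAt_const))).dist continuousAt_const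
  -- A real increment `x` with a bad quotient has rational neighbours whose quotients are still at
  -- distance more than `ε / 2` from `c`, because the quotient is continuous in the increment away
  -- from `0`.
  by_contra! hcon
  have hev : ∀ᶠ t in 𝓝 x, ε / 2 < dist ((t⁻¹ : ℝ) • (f (s + t) - f s)) c :=
    hcont.eventually (lt_mem_nhds (by linarith))
  have hev2 : ∀ᶠ t in 𝓝 x, t ≠ 0 ∧ |t| < δ' :=
    (isOpen_ne.eventually_mem hx0).and ((isOpen_lt continuous_abs continuous_const).eventually_mem
      (lt_of_lt_of_le hxd (min_le_right _ _)))
  obtain ⟨r, hr1, hr2, hr3⟩ :=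
    Rat.denseRange_cast (𝕜 := ℝ) |>.exists_mem_open (isOpen_interior (s := {t : ℝ | ε / 2 < dist ((t⁻¹ : ℝ) • (f (s + t) - f s)) c ∧ t ≠ 0 ∧ |t| < δ'}))
      ⟨x, mem_interior_iff_mem_nhds.2 (hev.and hev2)⟩ |>.imp fun r hr => interior_subset hr
  have := h3 (y := (r : ℝ)) (by rwa [Real.dist_eq, sub_zero]) hr2 r rfl
  linarith

/-- By continuity, rational increments decide differentiability. There are countably many of them,
so the set `S` of convergence is measurable and the derivative is a measurable limit on it;
elsewhere `deriv` takes its default value `0`. Differentiability need hold only at some points. -/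
theorem measurable_indicator_deriv {U : Set ℝ} (hU : IsOpen U)
    {f : X → ℝ → ℂ} (hc : ∀ x, ContinuousOn (f x) U) (hm : ∀ s ∈ U, Measurable fun x => f x s) :
    Measurable fun p : X × ℝ => U.indicator (deriv (f p.1)) p.2 := by
  set g : X × ℝ → ℂ := fun p => U.indicator (f p.1) p.2 with hg
  have hgm : Measurable g := measurable_indicator_of_continuousOn_of_measurable hU.measurableSet hc hm
  set l : Filter ℚ := comap (fun r : ℚ => (r : ℝ)) (𝓝[≠] 0) with hl
  have : l.NeBot := by
    rw [hl, comap_neBot_iff]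
    intro t ht
    rw [mem_nhdsWithin] at ht
    obtain ⟨u, hu, h0, hut⟩ := ht
    obtain ⟨δ, hδ, hb⟩ := Metric.isOpen_iff.1 hu 0 h0
    obtain ⟨r, hr1, hr2⟩ := exists_rat_btwn hδ
    refine ⟨r, hut ⟨hb ?_, ?_⟩⟩
    · rw [Metric.mem_ball, Real.dist_eq, sub_zero, abs_of_pos hr1]; exact hr2
    · exact hr1.ne'
  set Q : ℚ → X × ℝ → ℂ := fun r p => ((r : ℝ)⁻¹ : ℝ) • (g (p.1, p.2 + r) - g p) with hQ
  have hQm : ∀ r, Measurable (Q r) := fun r =>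
    ((hgm.comp (measurable_fst.prodMk (measurable_snd.add_const (r : ℝ)))).sub hgm).const_smul
      ((r : ℝ)⁻¹ : ℝ)
  set S : Set (X × ℝ) := {p | p.2 ∈ U ∧ ∃ c, Tendsto (fun r => Q r p) l (𝓝 c)} with hS
  have hSm : MeasurableSet S :=
    (measurable_snd hU.measurableSet).inter (measurableSet_exists_tendsto hQm)
  have key : ∀ x, ∀ s ∈ U, ∀ c, Tendsto (fun r => Q r (x, s)) l (𝓝 c) ↔ HasDerivAt (f x) c s := by
    intro x s hs c
    have hev : ∀ᶠ t : ℝ in 𝓝[≠] 0, s + t ∈ U := by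
      have : Tendsto (fun t : ℝ => s + t) (𝓝[≠] 0) (𝓝 s) := by
        have : Tendsto (fun t : ℝ => s + t) (𝓝 0) (𝓝 (s + 0)) :=
          (continuous_const.add continuous_id).tendsto 0
        rw [add_zero] at this
        exact this.mono_left nhdsWithin_le_nhds
      exact this.eventually (hU.mem_nhds hs)
    have hev2 : (fun r => Q r (x, s)) =ᶠ[l] fun r : ℚ => ((r : ℝ)⁻¹ : ℝ) • (f x (s + r) - f x s) := by
      have := tendsto_comap (f := fun r : ℚ => (r : ℝ)) (x := 𝓝[≠] (0 : ℝ)) |>.eventually hev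
      filter_upwards [this] with r hr
      simp [hQ, hg, Set.indicator_of_mem hr, Set.indicator_of_mem hs]
    rw [tendsto_congr' hev2]
    refine ⟨fun h => hasDerivAt_of_tendsto_rat hU (hc x) hs h, fun h => ?_⟩
    exact (hasDerivAt_iff_tendsto_slope_zero.1 h).comp tendsto_comap
  have hlim : Measurable fun p : X × ℝ => S.indicator (fun p => U.indicator (deriv (f p.1)) p.2) p := by
    refine measurable_of_tendsto_metrizable' (f := fun r p => S.indicator (Q r) p) l
      (fun r => (hQm r).indicator hSm) ?_
    rw [tendsto_pi_nhds]
    intro p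
    by_cases hp : p ∈ S
    · simp only [Set.indicator_of_mem hp, Set.indicator_of_mem hp.1]
      obtain ⟨c, hc'⟩ := hp.2
      have := (key p.1 p.2 hp.1 c).1 hc'
      rwa [this.deriv]
    · simp [Set.indicator_of_notMem hp]
  convert hlim using 1
  funext p
  by_cases hp : p ∈ S
  · rw [Set.indicator_of_mem hp]
  · rw [Set.indicator_of_notMem hp]
    by_cases hpU : p.2 ∈ U
    · rw [Set.indicator_of_mem hpU]
      -- A nonzero value of `deriv` forces differentiability, which would put the point into `S`.
      by_contra hne
      have hd : DifferentiableAt ℝ (f p.1) p.2 := by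
        by_contra hnd
        exact hne (deriv_zero_of_not_differentiableAt hnd)
      exact hp ⟨hpU, _, (key p.1 p.2 hpU _).2 hd.hasDerivAt⟩
    · rw [Set.indicator_of_notMem hpU]

end Measurability

/-! ### Absolutely continuous functions on open intervals -/

section AbsolutelyContinuous

variable {E : Type*} [NormedAddCommGroup E] [NormedSpace ℝ E] {I : Set ℝ} {f : ℝ → E}

theorem intervalIntegrable_of_locallyIntegrableOn {E : Type*} [NormedAddCommGroup E]
    (hI : I.OrdConnected) {g : ℝ → E}
    (hg : LocallyIntegrableOn g I volume) {c d : ℝ} (hc : c ∈ I) (hd : d ∈ I) :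
    IntervalIntegrable g volume c d := by
  rw [intervalIntegrable_iff']
  exact hg.integrableOn_compact_subset (hI.uIcc_subset hc hd) isCompact_uIcc

theorem exists_mem_lt_mem_gt_of_isOpen (hI : IsOpen I) {s : ℝ} (hs : s ∈ I) :
    ∃ c d : ℚ, (c : ℝ) ∈ I ∧ (d : ℝ) ∈ I ∧ (c : ℝ) < s ∧ s < d := by
  obtain ⟨l, u, ⟨hl, hu⟩, hlu⟩ := mem_nhds_iff_exists_Ioo_subset.1 (hI.mem_nhds hs)
  obtain ⟨c, hc1, hc2⟩ := exists_rat_btwn hl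
  obtain ⟨d, hd1, hd2⟩ := exists_rat_btwn hu
  exact ⟨c, d, hlu ⟨hc1, hc2.trans hu⟩, hlu ⟨hl.trans hd1, hd2⟩, hc2, hd1⟩

theorem continuousOn_of_sub_eq_integral (hI : IsOpen I) (hIc : I.OrdConnected) {g : ℝ → E}
    (hg : LocallyIntegrableOn g I volume)
    (h : ∀ x ∈ I, ∀ y ∈ I, f y - f x = ∫ s in x..y, g s) : ContinuousOn f I := by
  intro s hs
  obtain ⟨c, d, hc, hd, hcs, hsd⟩ := exists_mem_lt_mem_gt_of_isOpen hI hs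
  have hintg : IntegrableOn g (uIcc (c : ℝ) d) :=
    hg.integrableOn_compact_subset (hIc.uIcc_subset hc hd) isCompact_uIcc
  have h1 := intervalIntegral.continuousOn_primitive_interval hintg
  have h2 : ContinuousAt (fun x => ∫ s in (c : ℝ)..x, g s) s :=
    h1.continuousAt (by rw [uIcc_of_le (hcs.trans hsd).le]; exact Icc_mem_nhds hcs hsd)
  refine ContinuousAt.continuousWithinAt ?_
  refine (continuousAt_const.add h2).congr (f := fun x => f c + ∫ s in (c : ℝ)..x, g s) ?_
  filter_upwards [hI.mem_nhds hs] with x hx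
  rw [← h c hc x hx]; abel

theorem IsAC.continuousOn (hI : IsOpen I) (hIc : I.OrdConnected) (h : IsAC I f) :
    ContinuousOn f I := by
  obtain ⟨g, hg, hfg⟩ := h
  exact continuousOn_of_sub_eq_integral hI hIc hg hfg

theorem ae_hasDerivAt_of_sub_eq_integral [CompleteSpace E] (hI : IsOpen I) (hIc : I.OrdConnected)
    {g : ℝ → E} (hg : LocallyIntegrableOn g I volume)
    (h : ∀ x ∈ I, ∀ y ∈ I, f y - f x = ∫ s in x..y, g s) :
    ∀ᵐ s, s ∈ I → HasDerivAt f (g s) s := by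
  -- Lebesgue's differentiation theorem is applied on compact intervals with rational end points:
  -- there are countably many, so their exceptional sets unite to a null set.
  have h1 : ∀ c d : ℚ, ∀ᵐ s, (c : ℝ) ∈ I → (d : ℝ) ∈ I → s ∈ uIcc (c : ℝ) d →
      HasDerivAt (fun x => ∫ t in (c : ℝ)..x, g t) (g s) s := by
    intro c d
    by_cases hc : (c : ℝ) ∈ I
    · by_cases hd : (d : ℝ) ∈ I
      · filter_upwards [(intervalIntegrable_of_locallyIntegrableOn hIc hg hc hd).ae_hasDerivAt_integral]
          with s hs _ _ hm using hs hm c left_mem_uIcc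
      · exact Eventually.of_forall fun s _ h' => absurd h' hd
    · exact Eventually.of_forall fun s h' => absurd h' hc
  filter_upwards [ae_all_iff.2 fun c => ae_all_iff.2 (h1 c)] with s hs hsI
  obtain ⟨c, d, hc, hd, hcs, hsd⟩ := exists_mem_lt_mem_gt_of_isOpen hI hsI
  have h2 := hs c d hc hd (by rw [uIcc_of_le (hcs.trans hsd).le]; exact ⟨hcs.le, hsd.le⟩)
  refine (h2.const_add (f c)).congr_of_eventuallyEq ?_
  filter_upwards [hI.mem_nhds hsI] with x hx
  rw [← h c hc x hx]; abel

theorem IsAC.ae_differentiableAt [CompleteSpace E] (hI : IsOpen I) (hIc : I.OrdConnected)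
    (h : IsAC I f) : ∀ᵐ s, s ∈ I → DifferentiableAt ℝ f s := by
  obtain ⟨g, hg, hfg⟩ := h
  filter_upwards [ae_hasDerivAt_of_sub_eq_integral hI hIc hg hfg] with s hs hsI
    using (hs hsI).differentiableAt

theorem IsAC.locallyIntegrableOn_deriv [CompleteSpace E] (hI : IsOpen I) (hIc : I.OrdConnected)
    (h : IsAC I f) : LocallyIntegrableOn (deriv f) I volume := by
  obtain ⟨g, hg, hfg⟩ := h
  have hae := ae_hasDerivAt_of_sub_eq_integral hI hIc hg hfg
  rw [locallyIntegrableOn_iff hI.isLocallyClosed] at hg ⊢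
  intro k hk hkc
  refine (hg k hk hkc).congr_fun_ae ?_
  rw [EventuallyEq, ae_restrict_iff' hkc.measurableSet]
  filter_upwards [hae] with s hs hsk using (hs (hk hsk)).deriv.symm

theorem IsAC.sub_eq_integral_deriv [CompleteSpace E] (hI : IsOpen I) (hIc : I.OrdConnected)
    (h : IsAC I f) {x y : ℝ} (hx : x ∈ I) (hy : y ∈ I) : f y - f x = ∫ s in x..y, deriv f s := by
  obtain ⟨g, hg, hfg⟩ := h
  rw [hfg x hx y hy]
  refine intervalIntegral.integral_congr_ae ?_
  filter_upwards [ae_hasDerivAt_of_sub_eq_integral hI hIc hg hfg] with s hs hsk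
  exact (hs (hIc.uIcc_subset hx hy (uIoc_subset_uIcc hsk))).deriv.symm

theorem IsAC.congr {f₁ f₂ : ℝ → E} (h : IsAC I f₁) (heq : EqOn f₁ f₂ I) : IsAC I f₂ := by
  obtain ⟨g, hg, hfg⟩ := h
  exact ⟨g, hg, fun x hx y hy => by rw [← heq hx, ← heq hy, hfg x hx y hy]⟩

theorem IsAC.mul_const {f : ℝ → ℂ} (h : IsAC I f) (c : ℂ) : IsAC I fun s => f s * c := by
  obtain ⟨g, hg, hfg⟩ := h
  refine ⟨fun s => g s * c, ?_, fun x hx y hy => ?_⟩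
  · intro x hx
    obtain ⟨t, ht, hgt⟩ := hg x hx
    exact ⟨t, ht, hgt.mul_const c⟩
  · rw [intervalIntegral.integral_mul_const, ← hfg x hx y hy]; ring

end AbsolutelyContinuous

/-! ### Differentiation under the integral sign -/

section ParametricIntegral

variable {U : Set ℝ} {f : ℝ → ℝ → ℂ}

theorem integrable_deriv_prod (hU : IsOpen U) (hUc : U.OrdConnected)
    (hac : ∀ y, IsAC U fun s => f s y) (hm : ∀ s ∈ U, Measurable (f s))
    {c d : ℝ} (hc : c ∈ U) (hd : d ∈ U) {h k : ℝ → ℝ}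
    (hh : IntegrableOn h (Icc c d)) (hk : Integrable k)
    (hb : ∀ᵐ s, s ∈ Icc c d → ∀ y, ‖deriv (fun s' => f s' y) s‖ ≤ h s * k y) :
    Integrable (Function.uncurry fun s y => deriv (fun s' => f s' y) s)
      ((volume.restrict (Icc c d)).prod volume) := by
  have hsub : Icc c d ⊆ U := hUc.out hc hd
  have hmeas : Measurable fun p : ℝ × ℝ => U.indicator (deriv fun s' => f s' p.1) p.2 :=
    measurable_indicator_deriv hU (f := fun y s => f s y) (fun y => (hac y).continuousOn hU hUc) hm
  have hmem : ∀ᵐ p : ℝ × ℝ ∂((volume.restrict (Icc c d)).prod volume), p.1 ∈ Icc c d := by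
    have := Measure.quasiMeasurePreserving_fst (μ := volume.restrict (Icc c d)) (ν := (volume : Measure ℝ))
    exact this.ae (ae_restrict_mem measurableSet_Icc)
  have hbd : ∀ᵐ p : ℝ × ℝ ∂((volume.restrict (Icc c d)).prod volume),
      ∀ y, ‖deriv (fun s' => f s' y) p.1‖ ≤ h p.1 * k y := by
    have := Measure.quasiMeasurePreserving_fst (μ := volume.restrict (Icc c d)) (ν := (volume : Measure ℝ))
    exact this.ae ((ae_restrict_iff' measurableSet_Icc).2 hb)
  have hprod : Integrable (fun p : ℝ × ℝ => h p.1 * k p.2)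
      ((volume.restrict (Icc c d)).prod volume) := Integrable.mul_prod hh hk
  refine hprod.mono' ?_ ?_
  · refine ((hmeas.comp measurable_swap).aestronglyMeasurable).congr ?_
    filter_upwards [hmem] with p hp
    exact Set.indicator_of_mem (hsub hp) (deriv fun s' => f s' p.2)
  · filter_upwards [hbd] with p hp using hp p.2

/-- Each increment in `s` is the integral of its derivative, and the majorant `h(s) k(y)` permits
Fubini. The bound is asked for almost every `s` with `h` merely integrable because the time
derivative of the phase contains `a'`, which is only locally integrable. -/
theorem integral_sub_eq_integral_deriv (hU : IsOpen U) (hUc : U.OrdConnected)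
    (hac : ∀ y, IsAC U fun s => f s y) (hm : ∀ s ∈ U, Measurable (f s))
    (hintg : ∀ s ∈ U, Integrable (f s))
    (hb : ∀ c ∈ U, ∀ d ∈ U, c ≤ d → ∃ h k : ℝ → ℝ, IntegrableOn h (Icc c d) ∧ Integrable k ∧
      ∀ᵐ s, s ∈ Icc c d → ∀ y, ‖deriv (fun s' => f s' y) s‖ ≤ h s * k y) :
    LocallyIntegrableOn (fun s => ∫ y, deriv (fun s' => f s' y) s) U volume ∧
    ∀ c ∈ U, ∀ d ∈ U, (∫ y, f d y) - ∫ y, f c y = ∫ s in c..d, ∫ y, deriv (fun s' => f s' y) s := by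
  constructor
  · intro x hx
    obtain ⟨c, d, hc, hd, hcs, hsd⟩ := exists_mem_lt_mem_gt_of_isOpen hU hx
    obtain ⟨h, k, hh, hk, hbd⟩ := hb c hc d hd (hcs.trans hsd).le
    refine ⟨Icc (c : ℝ) d, mem_nhdsWithin_of_mem_nhds (Icc_mem_nhds hcs hsd), ?_⟩
    exact (integrable_deriv_prod hU hUc hac hm hc hd hh hk hbd).integral_prod_left
  · have key : ∀ c ∈ U, ∀ d ∈ U, c ≤ d → (∫ y, f d y) - ∫ y, f c y =
        ∫ s in c..d, ∫ y, deriv (fun s' => f s' y) s := by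
      intro c hc d hd hcd
      obtain ⟨h, k, hh, hk, hbd⟩ := hb c hc d hd hcd
      have hi := integrable_deriv_prod hU hUc hac hm hc hd hh hk hbd
      rw [← integral_sub (hintg d hd) (hintg c hc)]
      simp_rw [fun y => (hac y).sub_eq_integral_deriv hU hUc hc hd,
        intervalIntegral.integral_of_le hcd, ← integral_Icc_eq_integral_Ioc]
      rw [integral_integral_swap hi]
    intro c hc d hd
    rcases le_total c d with h | h
    · exact key c hc d hd h
    · rw [intervalIntegral.integral_symm, ← key d hd c hc h]; ring

/-- Differentiation under the integral sign, once continuously and a second time in the absolutely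
continuous sense. -/
theorem hasDerivAt_integral_of_isAC (hU : IsOpen U) (hUc : U.OrdConnected)
    (hac : ∀ y, IsAC U fun s => f s y)
    (hac' : ∀ y, IsAC U (deriv fun s => f s y))
    (hm : ∀ s ∈ U, Measurable (f s)) (hintg : ∀ s ∈ U, Integrable (f s))
    (hb : ∀ c ∈ U, ∀ d ∈ U, c ≤ d → ∃ k : ℝ → ℝ, Integrable k ∧ ∀ s ∈ Icc c d, ∀ y,
      ‖deriv (fun s' => f s' y) s‖ ≤ k y ∧ ‖deriv (deriv fun s' => f s' y) s‖ ≤ k y) :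
    (∀ s ∈ U, HasDerivAt (fun s => ∫ y, f s y) (∫ y, deriv (fun s' => f s' y) s) s) ∧
    IsAC U (fun s => ∫ y, f s y) ∧ IsAC U (deriv fun s => ∫ y, f s y) ∧
    ∀ᵐ s, s ∈ U → deriv (deriv fun s => ∫ y, f s y) s =
      ∫ y, deriv (deriv fun s' => f s' y) s := by
  have hmeas : Measurable fun p : ℝ × ℝ => U.indicator (deriv fun s' => f s' p.1) p.2 :=
    measurable_indicator_deriv hU (f := fun y s => f s y) (fun y => (hac y).continuousOn hU hUc) hm
  have hm' : ∀ s ∈ U, Measurable fun y => deriv (fun s' => f s' y) s := by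
    intro s hs
    convert hmeas.comp (measurable_id.prodMk (measurable_const (a := s))) using 1
    funext y
    exact (Set.indicator_of_mem hs _).symm
  have hintg' : ∀ s ∈ U, Integrable fun y => deriv (fun s' => f s' y) s := by
    intro s hs
    obtain ⟨k, hk, hbk⟩ := hb s hs s hs le_rfl
    exact hk.mono' (hm' s hs).aestronglyMeasurable
      (Eventually.of_forall fun y => (hbk s ⟨le_rfl, le_rfl⟩ y).1)
  obtain ⟨h1, h2⟩ := integral_sub_eq_integral_deriv hU hUc hac hm hintg (fun c hc d hd hcd => by
    obtain ⟨k, hk, hbk⟩ := hb c hc d hd hcd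
    exact ⟨fun _ => 1, k, integrableOn_const (by simp), hk,
      Eventually.of_forall fun s hs y => by simpa using (hbk s hs y).1⟩)
  obtain ⟨h3, h4⟩ := integral_sub_eq_integral_deriv (f := fun s y => deriv (fun s' => f s' y) s)
    hU hUc hac' hm' hintg' (fun c hc d hd hcd => by
    obtain ⟨k, hk, hbk⟩ := hb c hc d hd hcd
    exact ⟨fun _ => 1, k, integrableOn_const (by simp), hk,
      Eventually.of_forall fun s hs y => by simpa using (hbk s hs y).2⟩)
  -- The integral of the first derivatives is itself absolutely continuous, hence continuous, so the
  -- fundamental theorem yields a derivative at every point and not only almost everywhere.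
  have hcont := continuousOn_of_sub_eq_integral hU hUc h3 h4
  have hder : ∀ s ∈ U, HasDerivAt (fun s => ∫ y, f s y) (∫ y, deriv (fun s' => f s' y) s) s := by
    intro s hs
    obtain ⟨c, d, hc, hd, hcs, hsd⟩ := exists_mem_lt_mem_gt_of_isOpen hU hs
    have h5 := intervalIntegral.integral_hasDerivAt_right
      (intervalIntegrable_of_locallyIntegrableOn hUc h1 hc hs)
      (hcont.stronglyMeasurableAtFilter hU s hs) (hcont.continuousAt (hU.mem_nhds hs))
    refine (h5.const_add (∫ y, f c y)).congr_of_eventuallyEq ?_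
    filter_upwards [hU.mem_nhds hs] with x hx
    rw [← h2 c hc x hx]; abel
  have heq : EqOn (fun s => ∫ y, deriv (fun s' => f s' y) s) (deriv fun s => ∫ y, f s y) U :=
    fun s hs => (hder s hs).deriv.symm
  refine ⟨hder, ⟨_, h1, h2⟩, IsAC.congr ⟨_, h3, h4⟩ heq, ?_⟩
  filter_upwards [ae_hasDerivAt_of_sub_eq_integral hU hUc h3 h4] with s hs hsU
  rw [← (hs hsU).deriv]
  refine EventuallyEq.deriv_eq ?_
  filter_upwards [hU.mem_nhds hsU] with x hx using (heq hx).symm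

end ParametricIntegral

/-! ### Integrals of dominated families in `AC_{1,2}` -/

theorem isOpen_timeInterval (T : EReal) : IsOpen (timeInterval T) :=
  (isOpen_lt continuous_const continuous_id).inter
    (isOpen_lt continuous_coe_real_ereal continuous_const)

theorem ordConnected_timeInterval (T : EReal) : (timeInterval T).OrdConnected :=
  ⟨fun _ hx _ hy _ hz => ⟨hx.1.trans_le hz.1, (EReal.coe_le_coe_iff.2 hz.2).trans_lt hy.2⟩⟩

theorem IsACPunctured.continuousOn {f : ℝ → ℂ} (h : IsACPunctured f) : ContinuousOn f {0}ᶜ := by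
  intro x hx
  refine ContinuousAt.continuousWithinAt ?_
  rcases lt_or_gt_of_ne hx with h0 | h0
  · exact (h.1.continuousOn isOpen_Iio ordConnected_Iio).continuousAt (isOpen_Iio.mem_nhds h0)
  · exact (h.2.continuousOn isOpen_Ioi ordConnected_Ioi).continuousAt (isOpen_Ioi.mem_nhds h0)

/-- A family `k(·,·,y)` of functions in `AC_{1,2}`, extended by zero, whose members and their
derivatives are dominated, locally in one variable, by integrable functions of the parameter. -/
structure IsDominatedFamily (T : EReal) (k : ℝ → ℝ → ℝ → ℂ) : Prop where
  zero : ∀ t x y, (t ∉ timeInterval T ∨ x = 0 ∨ y = 0) → k t x y = 0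
  ac12 : ∀ y, IsAC12 T fun t x => k t x y
  cont : ∀ t ∈ timeInterval T, ∀ x, x ≠ 0 → ContinuousOn (k t x) {0}ᶜ
  integrable : ∀ t ∈ timeInterval T, ∀ x, x ≠ 0 → Integrable (k t x)
  bound_time : ∀ x, x ≠ 0 → ∀ c ∈ timeInterval T, ∀ d ∈ timeInterval T, c ≤ d →
    ∃ h g : ℝ → ℝ, IntegrableOn h (Icc c d) ∧ Integrable g ∧
      ∀ᵐ s, s ∈ Icc c d → ∀ y, ‖deriv (fun s' => k s' x y) s‖ ≤ h s * g y
  bound_space : ∀ t ∈ timeInterval T, ∀ c d, c ≤ d → (0 : ℝ) ∉ Icc c d →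
    ∃ g : ℝ → ℝ, Integrable g ∧ ∀ s ∈ Icc c d, ∀ y,
      ‖deriv (fun s' => k t s' y) s‖ ≤ g y ∧ ‖deriv (deriv fun s' => k t s' y) s‖ ≤ g y

namespace IsDominatedFamily

variable {T : EReal} {k : ℝ → ℝ → ℝ → ℂ}

theorem measurable_param (hk : IsDominatedFamily T k) (t x : ℝ) : Measurable (k t x) := by
  by_cases h : t ∉ timeInterval T ∨ x = 0
  · have : k t x = fun _ => 0 := by
      funext y; exact hk.zero t x y (h.imp id Or.inl)
    rw [this]; exact measurable_const
  · push Not at h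
    exact measurable_of_continuousOn_compl_singleton 0 (hk.cont t h.1 x h.2)

theorem continuousOn_time (hk : IsDominatedFamily T k) (x y : ℝ) :
    ContinuousOn (fun t => k t x y) (timeInterval T) := by
  by_cases hx : x = 0
  · have : (fun t => k t x y) = fun _ => 0 := by
      funext t; exact hk.zero t x y (Or.inr (Or.inl hx))
    rw [this]; exact continuousOn_const
  · exact ((hk.ac12 y).1 x hx).continuousOn (isOpen_timeInterval T) (ordConnected_timeInterval T)

theorem eq_zero_of_notMem (hk : IsDominatedFamily T k) {t : ℝ} (ht : t ∉ timeInterval T) (y : ℝ) :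
    (fun x => k t x y) = fun _ => 0 := by
  funext x; exact hk.zero t x y (Or.inl ht)

theorem continuousOn_space (hk : IsDominatedFamily T k) (t y : ℝ) :
    ContinuousOn (fun x => k t x y) {0}ᶜ := by
  by_cases ht : t ∈ timeInterval T
  · exact ((hk.ac12 y).2 t ht).1.continuousOn
  · rw [hk.eq_zero_of_notMem ht y]; exact continuousOn_const

theorem continuousOn_deriv_space (hk : IsDominatedFamily T k) (t y : ℝ) :
    ContinuousOn (deriv fun x => k t x y) {0}ᶜ := by
  by_cases ht : t ∈ timeInterval T
  · exact ((hk.ac12 y).2 t ht).2.2.continuousOn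
  · rw [hk.eq_zero_of_notMem ht y]; simpa using continuousOn_const

theorem measurable_space_param (hk : IsDominatedFamily T k) (t : ℝ) :
    Measurable fun p : ℝ × ℝ => k t p.2 p.1 := by
  have := measurable_indicator_of_continuousOn_of_measurable (X := ℝ)
      (measurableSet_singleton (0 : ℝ)).compl (f := fun y x => k t x y)
      (fun y => hk.continuousOn_space t y) (fun x _ => hk.measurable_param t x)
  convert this using 1
  funext p
  by_cases hy : p.2 = 0
  · simp [hy, hk.zero t 0 p.1 (Or.inr (Or.inl rfl))]
  · simp [hy]

/-- The variables enter one at a time: measurability in `y`, then continuity in `x ≠ 0`, then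
continuity in `t` on the time interval. Extension by zero removes the indicators. -/
theorem measurable_joint (hk : IsDominatedFamily T k) :
    Measurable fun p : (ℝ × ℝ) × ℝ => k p.1.1 p.1.2 p.2 := by
  have := measurable_indicator_of_continuousOn_of_measurable (X := ℝ × ℝ)
      (isOpen_timeInterval T).measurableSet (f := fun q t => k t q.2 q.1)
      (fun q => hk.continuousOn_time q.2 q.1) (fun t _ => hk.measurable_space_param t)
  convert this.comp (((measurable_snd).prodMk (measurable_snd.comp measurable_fst)).prodMk
    (measurable_fst.comp measurable_fst) : Measurable fun p : (ℝ × ℝ) × ℝ => ((p.2, p.1.2), p.1.1))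
    using 1
  funext p
  by_cases ht : p.1.1 ∈ timeInterval T
  · simp [ht]
  · simp [ht, hk.zero p.1.1 p.1.2 p.2 (Or.inl ht)]

theorem measurable_deriv_time (hk : IsDominatedFamily T k) :
    Measurable fun p : (ℝ × ℝ) × ℝ =>
      (timeInterval T).indicator (deriv fun t => k t p.1.2 p.2) p.1.1 := by
  have := measurable_indicator_deriv (X := ℝ × ℝ)
      (isOpen_timeInterval T) (f := fun q t => k t q.2 q.1)
      (fun q => hk.continuousOn_time q.2 q.1) (fun t _ => hk.measurable_space_param t)
  exact this.comp (((measurable_snd).prodMk (measurable_snd.comp measurable_fst)).prodMk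
    (measurable_fst.comp measurable_fst) : Measurable fun p : (ℝ × ℝ) × ℝ => ((p.2, p.1.2), p.1.1))

theorem measurable_deriv_space (hk : IsDominatedFamily T k) {x : ℝ} (hx : x ≠ 0) :
    Measurable fun q : ℝ × ℝ => deriv (fun x => k q.2 x q.1) x := by
  have h1 : ∀ x, Measurable fun q : ℝ × ℝ => k q.2 x q.1 := fun x =>
    hk.measurable_joint.comp (((measurable_snd).prodMk measurable_const).prodMk measurable_fst :
      Measurable fun q : ℝ × ℝ => ((q.2, x), q.1))
  have h2 := measurable_indicator_deriv (X := ℝ × ℝ)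
      isOpen_compl_singleton (f := fun q x => k q.2 x q.1)
      (fun q => hk.continuousOn_space q.2 q.1) (fun x _ => h1 x)
  convert h2.comp (measurable_id.prodMk (measurable_const (a := x))) using 1
  funext q
  exact (Set.indicator_of_mem (s := {0}ᶜ) hx _).symm

theorem measurable_deriv_deriv_space (hk : IsDominatedFamily T k) :
    Measurable fun p : (ℝ × ℝ) × ℝ =>
      ({0}ᶜ : Set ℝ).indicator (deriv (deriv fun x => k p.1.1 x p.2)) p.1.2 := by
  have := measurable_indicator_deriv (X := ℝ × ℝ)
      isOpen_compl_singleton (f := fun q => deriv fun x => k q.2 x q.1)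
      (fun q => hk.continuousOn_deriv_space q.2 q.1) fun _ hx => hk.measurable_deriv_space hx
  exact this.comp (((measurable_snd).prodMk (measurable_fst.comp measurable_fst)).prodMk
    (measurable_snd.comp measurable_fst) : Measurable fun p : (ℝ × ℝ) × ℝ => ((p.2, p.1.1), p.1.2))

theorem time_regularity (hk : IsDominatedFamily T k) {x : ℝ} (hx : x ≠ 0) :
    IsAC (timeInterval T) (fun t => ∫ y, k t x y) ∧
    ∀ᵐ t, t ∈ timeInterval T →
      deriv (fun t => ∫ y, k t x y) t = ∫ y, deriv (fun t => k t x y) t := by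
  have h := integral_sub_eq_integral_deriv (f := fun t y => k t x y) (isOpen_timeInterval T)
    (ordConnected_timeInterval T) (fun y => (hk.ac12 y).1 x hx)
    (fun t _ => hk.measurable_param t x) (fun t ht => hk.integrable t ht x hx)
    (hk.bound_time x hx)
  refine ⟨⟨_, h⟩, ?_⟩
  filter_upwards [ae_hasDerivAt_of_sub_eq_integral (isOpen_timeInterval T)
    (ordConnected_timeInterval T) h.1 h.2] with t ht htI using (ht htI).deriv

theorem space_regularity (hk : IsDominatedFamily T k) {t : ℝ} (ht : t ∈ timeInterval T) :
    (∀ x, x ≠ 0 → HasDerivAt (fun x => ∫ y, k t x y) (∫ y, deriv (fun x => k t x y) x) x) ∧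
    IsACPunctured (fun x => ∫ y, k t x y) ∧ IsACPunctured (deriv fun x => ∫ y, k t x y) ∧
    ∀ᵐ x, x ≠ 0 → deriv (deriv fun x => ∫ y, k t x y) x = ∫ y, deriv (deriv fun x => k t x y) x := by
  have hn := hasDerivAt_integral_of_isAC (f := fun x y => k t x y) isOpen_Iio ordConnected_Iio
    (U := Iio 0) (fun y => ((hk.ac12 y).2 t ht).1.1) (fun y => ((hk.ac12 y).2 t ht).2.2.1)
    (fun x _ => hk.measurable_param t x) (fun x hx => hk.integrable t ht x (ne_of_lt hx))
    (fun c _ d hd hcd => hk.bound_space t ht c d hcd (fun h => absurd h.2 (not_le.2 hd)))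
  have hp := hasDerivAt_integral_of_isAC (f := fun x y => k t x y) isOpen_Ioi ordConnected_Ioi
    (U := Ioi 0) (fun y => ((hk.ac12 y).2 t ht).1.2) (fun y => ((hk.ac12 y).2 t ht).2.2.2)
    (fun x _ => hk.measurable_param t x) (fun x hx => hk.integrable t ht x (ne_of_gt hx))
    (fun c hc d _ hcd => hk.bound_space t ht c d hcd (fun h => absurd h.1 (not_le.2 hc)))
  refine ⟨fun x hx => ?_, ⟨hn.2.1, hp.2.1⟩, ⟨hn.2.2.1, hp.2.2.1⟩, ?_⟩
  · rcases lt_or_gt_of_ne hx with h | h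
    · exact hn.1 x h
    · exact hp.1 x h
  · filter_upwards [hn.2.2.2, hp.2.2.2] with x h1 h2 hx
    rcases lt_or_gt_of_ne hx with h | h
    · exact h1 h
    · exact h2 h

theorem isAC12_integral (hk : IsDominatedFamily T k) : IsAC12 T fun t x => ∫ y, k t x y :=
  ⟨fun _ hx => (hk.time_regularity hx).1, fun _ ht =>
    ⟨(hk.space_regularity ht).2.1, fun x hx => ((hk.space_regularity ht).1 x hx).differentiableAt,
      (hk.space_regularity ht).2.2.1⟩⟩

theorem measurable_integral (hk : IsDominatedFamily T k) :
    Measurable fun p : ℝ × ℝ => ∫ y, k p.1 p.2 y :=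
  (hk.measurable_joint.stronglyMeasurable.integral_prod_right' (ν := volume)).measurable

theorem integral_eq_zero (hk : IsDominatedFamily T k) {t x : ℝ} (h : t ∉ timeInterval T ∨ x = 0) :
    ∫ y, k t x y = 0 := by
  simp [fun y => hk.zero t x y (h.imp id Or.inl)]

/-- For fixed `x` the identity holds for almost every `t`. Since both sides are jointly measurable,
the set where it holds is measurable, and slicing turns this into a statement about almost every
`(t, x)`. -/
theorem ae_deriv_time (hk : IsDominatedFamily T k) :
    ∀ᵐ p : ℝ × ℝ, p.1 ∈ timeInterval T → p.2 ≠ 0 →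
      deriv (fun t => ∫ y, k t p.2 y) p.1 = ∫ y, deriv (fun t => k t p.2 y) p.1 := by
  have hI := isOpen_timeInterval T
  have h1 : Measurable fun q : ℝ × ℝ =>
      (timeInterval T).indicator (deriv fun t => ∫ y, k t q.1 y) q.2 := by
    refine measurable_indicator_deriv hI (f := fun x t => ∫ y, k t x y) (fun x => ?_) (fun t _ => ?_)
    · by_cases hx : x = 0
      · simp only [fun t => hk.integral_eq_zero (t := t) (Or.inr hx)]; exact continuousOn_const
      · exact (hk.time_regularity hx).1.continuousOn hI (ordConnected_timeInterval T)
    · exact hk.measurable_integral.comp (measurable_const.prodMk measurable_id)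
  have h2 : Measurable fun p : ℝ × ℝ =>
      ∫ y, (timeInterval T).indicator (deriv fun t => k t p.2 y) p.1 :=
    (hk.measurable_deriv_time.stronglyMeasurable.integral_prod_right' (ν := volume)).measurable
  have hset : MeasurableSet {q : ℝ × ℝ | q.1 ≠ 0 →
      (timeInterval T).indicator (deriv fun t => ∫ y, k t q.1 y) q.2 =
      ∫ y, (timeInterval T).indicator (deriv fun t => k t q.1 y) q.2} :=
    ((measurableSet_singleton (0 : ℝ)).compl.preimage measurable_fst).imp
      (measurableSet_eq_fun h1 (h2.comp measurable_swap))
  have hae : ∀ᵐ q : ℝ × ℝ, q.1 ≠ 0 →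
      (timeInterval T).indicator (deriv fun t => ∫ y, k t q.1 y) q.2 =
      ∫ y, (timeInterval T).indicator (deriv fun t => k t q.1 y) q.2 := by
    rw [Measure.volume_eq_prod]
    refine (Measure.ae_prod_mem_iff_ae_ae_mem hset).2 (Eventually.of_forall fun x => ?_)
    by_cases hx : x = 0
    · exact Eventually.of_forall fun t h => absurd hx h
    · filter_upwards [(hk.time_regularity hx).2] with t ht _
      by_cases htI : t ∈ timeInterval T
      · simpa [htI] using ht htI
      · simp [htI]
  have hswap := (Measure.measurePreserving_swap (μ := (volume : Measure ℝ))
    (ν := (volume : Measure ℝ))).quasiMeasurePreserving.ae hae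
  filter_upwards [hswap] with p hp hpI hx
  simpa [hpI] using hp hx

theorem ae_deriv_deriv_space (hk : IsDominatedFamily T k) :
    ∀ᵐ p : ℝ × ℝ, p.1 ∈ timeInterval T → p.2 ≠ 0 →
      deriv (deriv fun x => ∫ y, k p.1 x y) p.2 = ∫ y, deriv (deriv fun x => k p.1 x y) p.2 := by
  have hzero : ∀ t, t ∉ timeInterval T → (fun x => ∫ y, k t x y) = fun _ => 0 := fun t ht => by
    funext x; exact hk.integral_eq_zero (Or.inl ht)
  have h1 : Measurable fun q : ℝ × ℝ =>
      ({0}ᶜ : Set ℝ).indicator (deriv fun x => ∫ y, k q.1 x y) q.2 := by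
    refine measurable_indicator_deriv isOpen_compl_singleton (f := fun t x => ∫ y, k t x y)
      (fun t => ?_) (fun x _ => ?_)
    · by_cases ht : t ∈ timeInterval T
      · exact (hk.space_regularity ht).2.1.continuousOn
      · rw [hzero t ht]; exact continuousOn_const
    · exact hk.measurable_integral.comp (measurable_id.prodMk measurable_const)
  have h2 : Measurable fun q : ℝ × ℝ =>
      ({0}ᶜ : Set ℝ).indicator (deriv (deriv fun x => ∫ y, k q.1 x y)) q.2 := by
    refine measurable_indicator_deriv isOpen_compl_singleton
      (f := fun t => deriv fun x => ∫ y, k t x y) (fun t => ?_) (fun x hx => ?_)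
    · by_cases ht : t ∈ timeInterval T
      · exact (hk.space_regularity ht).2.2.1.continuousOn
      · rw [hzero t ht]; simpa using continuousOn_const
    · convert h1.comp (measurable_id.prodMk (measurable_const (a := x))) using 1
      funext q
      exact (Set.indicator_of_mem hx _).symm
  have h3 : Measurable fun p : ℝ × ℝ =>
      ∫ y, ({0}ᶜ : Set ℝ).indicator (deriv (deriv fun x => k p.1 x y)) p.2 :=
    (hk.measurable_deriv_deriv_space.stronglyMeasurable.integral_prod_right' (ν := volume)).measurable
  have hset : MeasurableSet {q : ℝ × ℝ | q.1 ∈ timeInterval T →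
      ({0}ᶜ : Set ℝ).indicator (deriv (deriv fun x => ∫ y, k q.1 x y)) q.2 =
      ∫ y, ({0}ᶜ : Set ℝ).indicator (deriv (deriv fun x => k q.1 x y)) q.2} :=
    ((isOpen_timeInterval T).measurableSet.preimage measurable_fst).imp
      (measurableSet_eq_fun h2 h3)
  have hae : ∀ᵐ q : ℝ × ℝ, q.1 ∈ timeInterval T →
      ({0}ᶜ : Set ℝ).indicator (deriv (deriv fun x => ∫ y, k q.1 x y)) q.2 =
      ∫ y, ({0}ᶜ : Set ℝ).indicator (deriv (deriv fun x => k q.1 x y)) q.2 := by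
    rw [Measure.volume_eq_prod]
    refine (Measure.ae_prod_mem_iff_ae_ae_mem hset).2 (Eventually.of_forall fun t => ?_)
    by_cases ht : t ∈ timeInterval T
    · filter_upwards [(hk.space_regularity ht).2.2.2] with x hx _
      by_cases hx0 : x = 0
      · simp [hx0]
      · simpa [hx0] using hx hx0
    · exact Eventually.of_forall fun x h => absurd h ht
  filter_upwards [hae] with p hp hpI hx
  have := hp hpI
  simpa [hx] using this

/-- If almost every point `p` satisfies the linear relation `H(p,y) = V(p) k(p,y)` for every fixed
`y`, then almost every `p` satisfies it for almost every `y`; the factor `V` need not be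
measurable. -/
theorem ae_ae_eq_mul {k H : ℝ × ℝ → ℝ → ℂ} {V : ℝ × ℝ → ℂ} {Ω : Set (ℝ × ℝ)}
    (hΩ : MeasurableSet Ω) (hk : Measurable (Function.uncurry k)) (hH : Measurable (Function.uncurry H))
    (hzero : ∀ p ∈ Ω, (∀ r : ℚ, k p r = 0) → ∀ y, k p y = 0)
    (heq : ∀ y, ∀ᵐ p : ℝ × ℝ, p ∈ Ω → H p y = V p * k p y) :
    ∀ᵐ p : ℝ × ℝ, p ∈ Ω → ∀ᵐ y : ℝ, H p y = V p * k p y := by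
  have hsec : ∀ {u : ℝ × ℝ → ℝ → ℂ}, Measurable (Function.uncurry u) → ∀ r : ℝ,
      Measurable fun x : (ℝ × ℝ) × ℝ => u x.1 r := fun hu r =>
    hu.comp (measurable_fst.prodMk measurable_const)
  have hΩ' : MeasurableSet {x : (ℝ × ℝ) × ℝ | x.1 ∈ Ω} := measurable_fst hΩ
  have ha : ∀ᵐ p : ℝ × ℝ, ∀ r : ℚ, p ∈ Ω → H p r = V p * k p r := ae_all_iff.2 fun r => heq r
  -- Cross-multiplying with the value at a rational `r` eliminates `V`. The resulting relation is
  -- measurable in `(p, y)`, so "for every `y`, almost every `p`" becomes "for almost every `p`,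
  -- almost every `y`".
  have hb : ∀ᵐ p : ℝ × ℝ, ∀ r : ℚ, ∀ᵐ y : ℝ, p ∈ Ω → H p y * k p r = H p r * k p y := by
    rw [ae_all_iff]
    intro r
    have hset : MeasurableSet {x : (ℝ × ℝ) × ℝ | x.1 ∈ Ω → H x.1 x.2 * k x.1 r = H x.1 r * k x.1 x.2} :=
      hΩ'.imp (measurableSet_eq_fun (hH.mul (hsec hk r)) ((hsec hH r).mul hk))
    refine (Measure.ae_ae_comm hset).2 (Eventually.of_forall fun y => ?_)
    filter_upwards [heq y, heq r] with p h1 h2 hp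
    rw [h1 hp, h2 hp]; ring
  -- The remaining case, in which no rational `r` gives a nonzero divisor: then `k p` vanishes
  -- identically and so does `H p` almost everywhere.
  have hc : ∀ᵐ p : ℝ × ℝ, ∀ᵐ y : ℝ, p ∈ Ω → (∀ r : ℚ, k p r = 0) → H p y = 0 := by
    have hset : MeasurableSet {x : (ℝ × ℝ) × ℝ | x.1 ∈ Ω → (∀ r : ℚ, k x.1 r = 0) → H x.1 x.2 = 0} := by
      refine hΩ'.imp (MeasurableSet.imp ?_ (measurableSet_eq_fun hH measurable_const))
      rw [Set.ofPred_forall]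
      exact MeasurableSet.iInter fun r => measurableSet_eq_fun (hsec hk r) measurable_const
    refine (Measure.ae_ae_comm hset).2 (Eventually.of_forall fun y => ?_)
    filter_upwards [heq y] with p h1 hp hr
    rw [h1 hp, hzero p hp hr y, mul_zero]
  filter_upwards [ha, hb, hc] with p ha hb hc hp
  by_cases h : ∀ r : ℚ, k p r = 0
  · filter_upwards [hc] with y hy
    rw [hy hp h, hzero p hp h y, mul_zero]
  · push Not at h
    obtain ⟨r, hr⟩ := h
    filter_upwards [hb r] with y hy
    have h1 := hy hp
    rw [ha r hp] at h1
    refine mul_right_cancel₀ hr ?_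
    rw [h1]; ring

/-- The null set where the equation fails may depend on `y`. Once almost every `(t, x)` satisfies
the equation for almost every `y`, it can be integrated over `y`, and the derivatives are taken out
of the integral. Here `H` is `i ∂_t + ∂_x²` applied to the kernel. -/
theorem solvesSchroedinger_integral (hk : IsDominatedFamily T k) {V : ℝ → ℝ → ℂ}
    (hV : ∀ y, SolvesSchroedinger T V fun t x => k t x y) :
    SolvesSchroedinger T V fun t x => ∫ y, k t x y := by
  set H : ℝ × ℝ → ℝ → ℂ := fun p y =>
    Complex.I * (timeInterval T).indicator (deriv fun t => k t p.2 y) p.1 +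
      ({0}ᶜ : Set ℝ).indicator (deriv (deriv fun x => k p.1 x y)) p.2 with hH
  have hHm : Measurable (Function.uncurry H) :=
    (measurable_const.mul hk.measurable_deriv_time).add hk.measurable_deriv_deriv_space
  set Ω : Set (ℝ × ℝ) := timeInterval T ×ˢ {0}ᶜ with hΩ
  have hΩm : MeasurableSet Ω :=
    (isOpen_timeInterval T).measurableSet.prod (measurableSet_singleton _).compl
  have key := ae_ae_eq_mul (k := fun p y => k p.1 p.2 y) (H := H) (V := fun p => V p.1 p.2) hΩm
    hk.measurable_joint hHm (fun p hp hr y => by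
      by_cases hy : y = 0
      · exact hk.zero _ _ _ (Or.inr (Or.inr hy))
      · by_contra hne
        -- Continuity off `0` makes the rational points sufficient to detect a nonzero value.
        have hca : ContinuousAt (k p.1 p.2) y :=
          (hk.cont p.1 hp.1 p.2 hp.2).continuousAt (isOpen_compl_singleton.mem_nhds hy)
        have hev := hca.eventually_ne hne
        obtain ⟨r, hr'⟩ := Rat.denseRange_cast (𝕜 := ℝ) |>.exists_mem_open
          (isOpen_interior (s := {y' : ℝ | k p.1 p.2 y' ≠ 0})) ⟨y, mem_interior_iff_mem_nhds.2 hev⟩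
        exact interior_subset hr' (hr r))
    (fun y => by
      filter_upwards [hV y] with p hp hpΩ
      have h1 : p.1 ∈ timeInterval T := hpΩ.1
      have h2 : p.2 ∈ ({0}ᶜ : Set ℝ) := hpΩ.2
      have := hp h1 h2
      simp only [hH, Set.indicator_of_mem h1, Set.indicator_of_mem h2]
      rw [this]; ring)
  unfold SolvesSchroedinger
  filter_upwards [key, hk.ae_deriv_time, hk.ae_deriv_deriv_space] with p hp h1 h2 ht hx
  rw [h1 ht hx, h2 ht hx]
  have hx' : p.2 ∈ ({0}ᶜ : Set ℝ) := hx
  have hae : ∀ᵐ y, Complex.I * deriv (fun t => k t p.2 y) p.1 =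
      V p.1 p.2 * k p.1 p.2 y - deriv (deriv fun x => k p.1 x y) p.2 := by
    filter_upwards [hp ⟨ht, hx⟩] with y hy
    simp only [hH, Set.indicator_of_mem ht, Set.indicator_of_mem hx'] at hy
    rw [← hy]; ring
  have hintg2 : Integrable fun y => deriv (deriv fun x => k p.1 x y) p.2 := by
    obtain ⟨g, hg, hbg⟩ := hk.bound_space p.1 ht p.2 p.2 le_rfl
      (fun h => hx (le_antisymm h.1 h.2))
    refine hg.mono' ?_ (Eventually.of_forall fun y => (hbg p.2 ⟨le_rfl, le_rfl⟩ y).2)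
    have := hk.measurable_deriv_deriv_space.comp ((measurable_const (a := p)).prodMk measurable_id)
    refine this.aestronglyMeasurable.congr (Eventually.of_forall fun y => ?_)
    exact Set.indicator_of_mem hx' _
  rw [← integral_const_mul, integral_congr_ae hae,
    integral_sub ((hk.integrable p.1 ht p.2 hx).const_mul _) hintg2, integral_const_mul]
  ring

end IsDominatedFamily

/-! ### Rotation of the path of integration -/

section Rotation

theorem image_exp_univ : Real.exp '' univ = Ioi 0 := by
  rw [image_univ, Real.range_exp]

/-- The substitution `y = e^s` maps horizontal lines to rays and a strip to a sector, so rotating a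
ray becomes shifting a line. The vertex of the sector, where nothing is known about the integrand,
moves to `-∞`. -/
theorem integral_Ioi_eq_integral_comp_exp (g : ℝ → ℂ) :
    ∫ y in Ioi (0 : ℝ), g y = ∫ s : ℝ, (Real.exp s : ℂ) * g (Real.exp s) := by
  rw [← image_exp_univ, integral_image_eq_integral_abs_deriv_smul MeasurableSet.univ
    (fun s _ => (Real.hasDerivAt_exp s).hasDerivWithinAt) Real.exp_injective.injOn]
  simp [abs_of_pos (Real.exp_pos _)]

theorem integrable_exp_mul_exp_neg_exp :
    Integrable fun s : ℝ => Real.exp s * Real.exp (-Real.exp s) := by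
  have h := (integrableOn_image_iff_integrableOn_abs_deriv_smul MeasurableSet.univ
    (fun s _ => (Real.hasDerivAt_exp s).hasDerivWithinAt) Real.exp_injective.injOn
    (fun y : ℝ => Real.exp (-y))).1 (by
      rw [image_exp_univ]; exact integrableOn_exp_neg_Ioi 0)
  rw [integrableOn_univ] at h
  simpa [abs_of_pos (Real.exp_pos _)] using h

theorem tendsto_exp_mul_exp_neg_exp_atTop :
    Tendsto (fun s : ℝ => Real.exp s * Real.exp (-Real.exp s)) atTop (𝓝 0) := by
  have h := (Real.tendsto_pow_mul_exp_neg_atTop_nhds_zero 1).comp Real.tendsto_exp_atTop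
  simpa [Function.comp_def] using h

theorem tendsto_exp_mul_exp_neg_exp_atBot :
    Tendsto (fun s : ℝ => Real.exp s * Real.exp (-Real.exp s)) atBot (𝓝 0) := by
  refine squeeze_zero (fun s => by positivity) (fun s => ?_) Real.tendsto_exp_atBot
  exact mul_le_of_le_one_right (Real.exp_pos s).le (Real.exp_le_one_iff.2 (by
    have := Real.exp_pos s; linarith))

/-- Rotation of the path of integration in a sector in which the integrand decays exponentially. -/
theorem integral_Ioi_eq_integral_rotated {β : ℝ} (hβ : 0 < β) {f : ℂ → ℂ} {K : ℝ}
    (hc : ContinuousOn (fun w => f (Complex.exp w)) {w | w.im ∈ Icc 0 β})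
    (hd : DifferentiableOn ℂ (fun w => f (Complex.exp w)) {w | w.im ∈ Ioo 0 β})
    (hb : ∀ w : ℂ, w.im ∈ Icc 0 β → ‖f (Complex.exp w)‖ ≤ K * Real.exp (-Real.exp w.re)) :
    ∫ y in Ioi (0 : ℝ), f y =
      Complex.exp (β * Complex.I) * ∫ y in Ioi (0 : ℝ), f (Complex.exp (β * Complex.I) * y) := by
  set h : ℂ → ℂ := fun w => Complex.exp w * f (Complex.exp w) with hh
  set b : ℝ → ℝ := fun s => K * (Real.exp s * Real.exp (-Real.exp s)) with hbdef
  -- The factor `exp w` in `h` is the Jacobian of the substitution. It makes the majorant `b`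
  -- integrable and small at both ends of the strip.
  have hhc : ContinuousOn h {w | w.im ∈ Icc 0 β} := Complex.continuous_exp.continuousOn.mul hc
  have hhd : DifferentiableOn ℂ h {w | w.im ∈ Ioo 0 β} :=
    Complex.differentiable_exp.differentiableOn.mul hd
  have hhb : ∀ w : ℂ, w.im ∈ Icc 0 β → ‖h w‖ ≤ b w.re := by
    intro w hw
    rw [hh, norm_mul, Complex.norm_exp, hbdef]
    calc Real.exp w.re * ‖f (Complex.exp w)‖
        ≤ Real.exp w.re * (K * Real.exp (-Real.exp w.re)) :=
          mul_le_mul_of_nonneg_left (hb w hw) (Real.exp_pos _).le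
      _ = _ := by ring
  have hbint : Integrable b := integrable_exp_mul_exp_neg_exp.const_mul K
  have hbT : Tendsto b atTop (𝓝 0) := by
    simpa using tendsto_exp_mul_exp_neg_exp_atTop.const_mul K
  have hbB : Tendsto b atBot (𝓝 0) := by
    simpa using tendsto_exp_mul_exp_neg_exp_atBot.const_mul K
  have hline : ∀ θ ∈ Icc 0 β, Integrable fun s : ℝ => h (s + θ * Complex.I) := by
    intro θ hθ
    have him : ∀ s : ℝ, ((s : ℂ) + θ * Complex.I).im = θ := by intro s; simp
    have hre : ∀ s : ℝ, ((s : ℂ) + θ * Complex.I).re = s := by intro s; simp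
    refine hbint.mono' ?_ (Eventually.of_forall fun s => ?_)
    · refine Continuous.aestronglyMeasurable ?_
      exact hhc.comp_continuous (by fun_prop) (fun s => by
        change ((s : ℂ) + θ * Complex.I).im ∈ Icc 0 β; rw [him]; exact hθ)
    · have := hhb (s + θ * Complex.I) (by rw [him]; exact hθ)
      rwa [hre] at this
  have hvert : ∀ s : ℝ, ‖∫ θ in (0 : ℝ)..β, h (s + θ * Complex.I)‖ ≤ b s * β := by
    intro s
    have := intervalIntegral.norm_integral_le_of_norm_le_const (a := 0) (b := β) (C := b s)
      (f := fun θ : ℝ => h (s + θ * Complex.I)) (fun θ hθ => by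
        rw [uIoc_of_le hβ.le] at hθ
        have := hhb (s + θ * Complex.I) (by simpa using ⟨hθ.1.le, hθ.2⟩)
        simpa using this)
    rwa [sub_zero, abs_of_pos hβ] at this
  -- Cauchy's theorem on the rectangle `[-R, R] × [0, β]`; the vertical sides contribute at most
  -- `b(±R) β`, which tends to zero.
  have hrect : ∀ R : ℝ, 0 < R → (∫ s in (-R)..R, h (s + (0 : ℝ) * Complex.I)) -
      (∫ s in (-R)..R, h (s + β * Complex.I)) =
      Complex.I * (∫ θ in (0 : ℝ)..β, h ((-R : ℝ) + θ * Complex.I)) -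
      Complex.I * (∫ θ in (0 : ℝ)..β, h (R + θ * Complex.I)) := by
    intro R hR
    have h1 := Complex.integral_boundary_rect_eq_zero_of_continuousOn_of_differentiableOn h
      (-R : ℝ) (R + β * Complex.I)
      (hhc.mono fun w hw => by
        have := (Complex.mem_reProdIm.1 hw).2
        simpa [uIcc_of_le hβ.le] using this)
      (hhd.mono fun w hw => by
        have := (Complex.mem_reProdIm.1 hw).2
        simpa [hβ.le] using this)
    simp only [Complex.ofReal_re, Complex.ofReal_im, Complex.add_re, Complex.mul_re, Complex.I_re,
      mul_zero, Complex.I_im, mul_one, sub_self, add_zero, Complex.add_im, Complex.mul_im,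
      zero_add, smul_eq_mul] at h1
    linear_combination h1
  have hlim1 : Tendsto (fun R : ℝ => (∫ s in (-R)..R, h (s + (0 : ℝ) * Complex.I)) -
      (∫ s in (-R)..R, h (s + β * Complex.I))) atTop
      (𝓝 ((∫ s : ℝ, h (s + (0 : ℝ) * Complex.I)) - ∫ s : ℝ, h (s + β * Complex.I))) :=
    (intervalIntegral_tendsto_integral (hline 0 ⟨le_rfl, hβ.le⟩) tendsto_neg_atTop_atBot
      tendsto_id).sub (intervalIntegral_tendsto_integral (hline β ⟨hβ.le, le_rfl⟩)
        tendsto_neg_atTop_atBot tendsto_id)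
  have hv1 : Tendsto (fun R : ℝ => ∫ θ in (0 : ℝ)..β, h (R + θ * Complex.I)) atTop (𝓝 0) :=
    squeeze_zero_norm (fun R => hvert R) (by simpa using hbT.mul_const β)
  have hv2 : Tendsto (fun R : ℝ => ∫ θ in (0 : ℝ)..β, h ((-R : ℝ) + θ * Complex.I)) atTop (𝓝 0) :=
    squeeze_zero_norm (fun R => hvert (-R))
      (by simpa using (hbB.comp tendsto_neg_atTop_atBot).mul_const β)
  have hlim2 := (hv2.const_mul Complex.I).sub (hv1.const_mul Complex.I)
  have heq := tendsto_nhds_unique (hlim1.congr' (by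
    filter_upwards [eventually_gt_atTop (0 : ℝ)] with R hR using hrect R hR)) hlim2
  simp only [mul_zero, sub_zero] at heq
  have heq' := sub_eq_zero.1 heq
  rw [integral_Ioi_eq_integral_comp_exp (fun y => f y),
    integral_Ioi_eq_integral_comp_exp (fun y => f (Complex.exp (β * Complex.I) * y)),
    ← integral_const_mul]
  calc ∫ s : ℝ, (Real.exp s : ℂ) * f (Real.exp s : ℝ)
      = ∫ s : ℝ, h (s + (0 : ℝ) * Complex.I) := by
        refine integral_congr_ae (Eventually.of_forall fun s => ?_)
        simp [hh]
    _ = ∫ s : ℝ, h (s + β * Complex.I) := heq'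
    _ = _ := by
        refine integral_congr_ae (Eventually.of_forall fun s => ?_)
        simp only [hh, Complex.exp_add, Complex.ofReal_exp]
        rw [mul_comm (Complex.exp s) (Complex.exp (β * Complex.I))]
        ring

end Rotation

/-! ### Geometry of the double sector -/

section SectorGeometry

variable {β : ℝ}

theorem arg_mem_Icc_of_im_le (hβ : β < Real.pi / 2) (hβ0 : 0 ≤ β) {z : ℂ} (h0 : 0 < z.re)
    (h1 : 0 ≤ z.im) (h2 : z.im ≤ Real.tan β * z.re) : z.arg ∈ Icc 0 β := by
  refine ⟨Complex.arg_nonneg_iff.2 h1, ?_⟩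
  have harg : |z.arg| < Real.pi / 2 := Complex.abs_arg_lt_pi_div_two_iff.2 (Or.inl h0)
  by_contra! hlt
  have := Real.tan_lt_tan_of_lt_of_lt_pi_div_two (by linarith [Real.pi_pos]) (abs_lt.1 harg).2 hlt
  rw [Complex.tan_arg, lt_div_iff₀ h0] at this
  linarith

theorem mem_doubleSector_of_im_le (hβ : β < Real.pi / 2) (hβ0 : 0 ≤ β) {z : ℂ} (h0 : 0 < z.re)
    (h1 : 0 ≤ z.im) (h2 : z.im ≤ Real.tan β * z.re) :
    z ∈ doubleSector β ∧ -z ∈ doubleSector β := by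
  have hz : z ≠ 0 := by rintro rfl; simp at h0
  have h := arg_mem_Icc_of_im_le hβ hβ0 h0 h1 h2
  exact ⟨⟨hz, Or.inl h⟩, ⟨neg_ne_zero.2 hz, Or.inr (by rwa [neg_neg])⟩⟩

theorem mem_interior_doubleSector_of_im_lt (hβ : β < Real.pi / 2) (hβ0 : 0 ≤ β) {z : ℂ}
    (h0 : 0 < z.re) (h1 : 0 < z.im) (h2 : z.im < Real.tan β * z.re) :
    z ∈ interior (doubleSector β) ∧ -z ∈ interior (doubleSector β) := by
  set O : Set ℂ := {z | 0 < z.re ∧ 0 < z.im ∧ z.im < Real.tan β * z.re} with hO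
  have hOo : IsOpen O :=
    (isOpen_lt continuous_const Complex.continuous_re).inter
      ((isOpen_lt continuous_const Complex.continuous_im).inter
        (isOpen_lt Complex.continuous_im (continuous_const.mul Complex.continuous_re)))
  have hzO : z ∈ O := ⟨h0, h1, h2⟩
  refine ⟨mem_interior.2 ⟨O, fun u hu => ?_, hOo, hzO⟩,
    mem_interior.2 ⟨Neg.neg ⁻¹' O, fun u hu => ?_, hOo.preimage continuous_neg, by simpa using hzO⟩⟩
  · exact (mem_doubleSector_of_im_le hβ hβ0 hu.1 hu.2.1.le hu.2.2.le).1
  · have := (mem_doubleSector_of_im_le (z := -u) hβ hβ0 hu.1 hu.2.1.le hu.2.2.le).2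
    rwa [neg_neg] at this

theorem exp_re_im (w : ℂ) : (Complex.exp w).re = Real.exp w.re * Real.cos w.im ∧
    (Complex.exp w).im = Real.exp w.re * Real.sin w.im :=
  ⟨Complex.exp_re w, Complex.exp_im w⟩

theorem sin_le_tan_mul_cos (hβ : β < Real.pi / 2) {θ : ℝ} (h0 : 0 ≤ θ) (h1 : θ ≤ β) :
    Real.sin θ ≤ Real.tan β * Real.cos θ := by
  have hc : 0 < Real.cos θ := Real.cos_pos_of_mem_Ioo ⟨by linarith [Real.pi_pos], by linarith⟩
  rw [← Real.tan_mul_cos hc.ne']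
  refine mul_le_mul_of_nonneg_right ?_ hc.le
  rcases h1.eq_or_lt with rfl | h
  · exact le_rfl
  · exact (Real.tan_lt_tan_of_lt_of_lt_pi_div_two (by linarith [Real.pi_pos]) hβ h).le

theorem sin_lt_tan_mul_cos (hβ : β < Real.pi / 2) {θ : ℝ} (h0 : 0 ≤ θ) (h1 : θ < β) :
    Real.sin θ < Real.tan β * Real.cos θ := by
  have hc : 0 < Real.cos θ := Real.cos_pos_of_mem_Ioo ⟨by linarith [Real.pi_pos], by linarith⟩
  rw [← Real.tan_mul_cos hc.ne']
  exact mul_lt_mul_of_pos_right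
    (Real.tan_lt_tan_of_lt_of_lt_pi_div_two (by linarith [Real.pi_pos]) hβ h1) hc

/-- Translation by `x₀ ≥ 0` increases the real part and keeps the imaginary part, so `im ≤ tan β ·
re` survives: the sector with vertex `x₀` lies in the one with vertex `0`. This admits contours that
turn off the real axis at `±x₀`. -/
theorem add_exp_mem_doubleSector (hβ : β < Real.pi / 2) {x₀ : ℝ} (hx₀ : 0 ≤ x₀)
    {w : ℂ} (hw : w.im ∈ Icc 0 β) :
    x₀ + Complex.exp w ∈ doubleSector β ∧ -(x₀ + Complex.exp w) ∈ doubleSector β := by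
  have hβ0 : 0 ≤ β := hw.1.trans hw.2
  have hc : 0 < Real.cos w.im :=
    Real.cos_pos_of_mem_Ioo ⟨by linarith [Real.pi_pos, hw.1], by linarith [hw.2]⟩
  have hs : 0 ≤ Real.sin w.im :=
    Real.sin_nonneg_of_nonneg_of_le_pi hw.1 (by linarith [hw.2, Real.pi_pos])
  have ht : 0 ≤ Real.tan β := Real.tan_nonneg_of_nonneg_of_le_pi_div_two hβ0 hβ.le
  have he := Real.exp_pos w.re
  refine mem_doubleSector_of_im_le hβ hβ0 ?_ ?_ ?_
  · rw [Complex.add_re, Complex.ofReal_re, (exp_re_im w).1]; positivity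
  · rw [Complex.add_im, Complex.ofReal_im, (exp_re_im w).2]; positivity
  · rw [Complex.add_re, Complex.ofReal_re, (exp_re_im w).1, Complex.add_im, Complex.ofReal_im,
      (exp_re_im w).2]
    nlinarith [mul_nonneg ht hx₀, mul_le_mul_of_nonneg_left (sin_le_tan_mul_cos hβ hw.1 hw.2) he.le]

theorem add_exp_mem_interior_doubleSector (hβ : β < Real.pi / 2) {x₀ : ℝ} (hx₀ : 0 ≤ x₀)
    {w : ℂ} (hw : w.im ∈ Ioo 0 β) :
    x₀ + Complex.exp w ∈ interior (doubleSector β) ∧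
      -(x₀ + Complex.exp w) ∈ interior (doubleSector β) := by
  have hβ0 : 0 ≤ β := (hw.1.trans hw.2).le
  have hc : 0 < Real.cos w.im :=
    Real.cos_pos_of_mem_Ioo ⟨by linarith [Real.pi_pos, hw.1], by linarith [hw.2]⟩
  have hs : 0 < Real.sin w.im :=
    Real.sin_pos_of_pos_of_lt_pi hw.1 (by linarith [hw.2, Real.pi_pos])
  have ht : 0 ≤ Real.tan β := Real.tan_nonneg_of_nonneg_of_le_pi_div_two hβ0 hβ.le
  have he := Real.exp_pos w.re
  refine mem_interior_doubleSector_of_im_lt hβ hβ0 ?_ ?_ ?_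
  · rw [Complex.add_re, Complex.ofReal_re, (exp_re_im w).1]; positivity
  · rw [Complex.add_im, Complex.ofReal_im, (exp_re_im w).2]; positivity
  · rw [Complex.add_re, Complex.ofReal_re, (exp_re_im w).1, Complex.add_im, Complex.ofReal_im,
      (exp_re_im w).2]
    nlinarith [mul_nonneg ht hx₀, mul_lt_mul_of_pos_left (sin_lt_tan_mul_cos hβ hw.1.le hw.2) he]

theorem exp_mul_real_mem_doubleSector (hβ : β < Real.pi / 2) {θ : ℝ} (hθ : θ ∈ Icc 0 β)
    {y : ℝ} (hy : y ≠ 0) : Complex.exp (θ * Complex.I) * y ∈ doubleSector β := by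
  have key : ∀ r : ℝ, 0 < r → Complex.exp (θ * Complex.I) * r ∈ doubleSector β ∧
      -(Complex.exp (θ * Complex.I) * r) ∈ doubleSector β := by
    intro r hr
    have h := add_exp_mem_doubleSector hβ le_rfl (w := Real.log r + θ * Complex.I) (by simpa using hθ)
    rw [Complex.exp_add, ← Complex.ofReal_exp, Real.exp_log hr] at h
    simpa [mul_comm] using h
  rcases lt_or_gt_of_ne hy with h | h
  · have := (key (-y) (by linarith)).2
    simpa using this
  · exact (key y h).1

theorem real_mem_doubleSector (hβ0 : 0 ≤ β) (hβ : β < Real.pi / 2) {y : ℝ} (hy : y ≠ 0) :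
    (y : ℂ) ∈ doubleSector β := by
  simpa using exp_mul_real_mem_doubleSector hβ (θ := 0) ⟨le_rfl, hβ0⟩ hy

theorem doubleSector_mono {α : ℝ} (h : β ≤ α) : doubleSector β ⊆ doubleSector α :=
  fun _ hz => ⟨hz.1, hz.2.imp (fun h' => ⟨h'.1, h'.2.trans h⟩) (fun h' => ⟨h'.1, h'.2.trans h⟩)⟩

/-- In a double sector of opening at most `π / 4` the square has nonnegative real part. -/
theorem re_sq_nonneg_of_mem_doubleSector (hβ : β ≤ Real.pi / 4) {z : ℂ} (hz : z ∈ doubleSector β) :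
    0 ≤ (z ^ 2).re := by
  have key : ∀ u : ℂ, u ≠ 0 → u.arg ∈ Icc 0 β → 0 ≤ (u ^ 2).re := by
    intro u hu hu2
    have h1 : 0 ≤ Real.cos (2 * u.arg) :=
      Real.cos_nonneg_of_mem_Icc ⟨by linarith [hu2.1, Real.pi_pos], by linarith [hu2.2]⟩
    have h2 := Complex.norm_mul_cos_arg u
    have h3 := Complex.norm_mul_sin_arg u
    rw [pow_two, Complex.mul_re, ← h2, ← h3]
    have h4 : Real.cos (2 * u.arg) = Real.cos u.arg ^ 2 - Real.sin u.arg ^ 2 := Real.cos_two_mul' _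
    have : ‖u‖ * Real.cos u.arg * (‖u‖ * Real.cos u.arg) - ‖u‖ * Real.sin u.arg * (‖u‖ * Real.sin u.arg)
      = ‖u‖ ^ 2 * Real.cos (2 * u.arg) := by rw [h4]; ring
    rw [this]; positivity
  rcases hz.2 with h | h
  · exact key z hz.1 h
  · simpa using key (-z) (neg_ne_zero.2 hz.1) h

end SectorGeometry

/-! ### Gaussians against exponentials of order below two -/

section Majorants

theorem exists_rpow_le_mul_sq_add {p : ℝ} (hp0 : 0 < p) (hp2 : p < 2) {δ : ℝ} (hδ : 0 < δ) :
    ∃ C : ℝ, 0 ≤ C ∧ ∀ s : ℝ, 0 ≤ s → s ^ p ≤ δ * s ^ 2 + C := by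
  -- The crossover point: `s^(p-2) = δ` at `s₀`. Beyond it `s^p ≤ δ s²`; before it the constant
  -- `s₀^p` suffices.
  set s₀ : ℝ := δ ^ (1 / (p - 2)) with hs₀
  have hs₀pos : 0 < s₀ := Real.rpow_pos_of_pos hδ _
  have hs₀p : s₀ ^ (p - 2) = δ := by
    rw [hs₀, ← Real.rpow_mul hδ.le, one_div, inv_mul_cancel₀ (by linarith : p - 2 ≠ 0), Real.rpow_one]
  refine ⟨s₀ ^ p, by positivity, fun s hs => ?_⟩
  rcases le_total s s₀ with h | h
  · have := Real.rpow_le_rpow hs h hp0.le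
    have : 0 ≤ δ * s ^ 2 := by positivity
    linarith
  · have hspos : 0 < s := hs₀pos.trans_le h
    have h1 : s ^ p = s ^ (p - 2) * s ^ 2 := by
      rw [← Real.rpow_natCast s 2, ← Real.rpow_add hspos]; norm_num
    have h2 : s ^ (p - 2) ≤ δ := by
      rw [← hs₀p]; exact Real.rpow_le_rpow_of_nonpos hs₀pos h (by linarith)
    have h3 : 0 ≤ s₀ ^ p := by positivity
    rw [h1]
    nlinarith [sq_nonneg s, mul_le_mul_of_nonneg_right h2 (sq_nonneg s)]

/-- A Gaussian absorbs exponentials of order less than two. -/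
theorem exists_exponent_le {p q : ℝ} (hp0 : 0 < p) (hp2 : p < 2) (hq0 : 0 < q) (hq2 : q < 2)
    {B₁ B₂ X m : ℝ} (D : ℝ) (hB₁ : 0 ≤ B₁) (hB₂ : 0 ≤ B₂) (hm : 0 < m) :
    ∃ K : ℝ, ∀ r ρ : ℝ, 0 ≤ r → 0 ≤ ρ → ρ ≤ X + r →
      B₁ * ρ ^ p + B₂ * ρ ^ q + D * r - m * r ^ 2 ≤ K - r := by
  -- These choices make each quadratic coefficient `Bᵢ δᵢ` at most `m / 8`. With `ρ² ≤ 2 X² + 2 r²`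
  -- the two powers cost `m/2 · (X² + r²)` and constants; the other half of `m r²` absorbs `(D + 1)
  -- r` by completing the square.
  obtain ⟨C₁, hC₁, h₁⟩ := exists_rpow_le_mul_sq_add hp0 hp2 (δ := m / (8 * (B₁ + 1))) (by positivity)
  obtain ⟨C₂, hC₂, h₂⟩ := exists_rpow_le_mul_sq_add hq0 hq2 (δ := m / (8 * (B₂ + 1))) (by positivity)
  have aux : ∀ B : ℝ, 0 ≤ B → B * (m / (8 * (B + 1))) ≤ m / 8 := by
    intro B hB
    rw [mul_div_assoc', div_le_div_iff₀ (by positivity) (by positivity)]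
    nlinarith
  refine ⟨B₁ * C₁ + B₂ * C₂ + m / 2 * X ^ 2 + (D + 1) ^ 2 / (2 * m), fun r ρ hr hρ hρX => ?_⟩
  have e1 := mul_le_mul_of_nonneg_left (h₁ ρ hρ) hB₁
  have e2 := mul_le_mul_of_nonneg_left (h₂ ρ hρ) hB₂
  have e3 := mul_le_mul_of_nonneg_right (aux B₁ hB₁) (sq_nonneg ρ)
  have e4 := mul_le_mul_of_nonneg_right (aux B₂ hB₂) (sq_nonneg ρ)
  have e5 : ρ ^ 2 ≤ 2 * X ^ 2 + 2 * r ^ 2 := by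
    have : ρ ^ 2 ≤ (X + r) ^ 2 := pow_le_pow_left₀ hρ hρX 2
    nlinarith [sq_nonneg (X - r)]
  have e6 : (D + 1) * r ≤ m / 2 * r ^ 2 + (D + 1) ^ 2 / (2 * m) := by
    have : 0 ≤ (m * r - (D + 1)) ^ 2 / (2 * m) := by positivity
    have h' : (m * r - (D + 1)) ^ 2 / (2 * m) = m / 2 * r ^ 2 - (D + 1) * r + (D + 1) ^ 2 / (2 * m) := by
      field_simp; ring
    linarith
  have e7 := mul_le_mul_of_nonneg_left e5 hm.le
  nlinarith

theorem integrable_exp_neg_abs : Integrable fun y : ℝ => Real.exp (-|y|) := by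
  rw [← integrableOn_univ, ← Iic_union_Ioi (a := (0 : ℝ)), integrableOn_union]
  constructor
  · refine (integrableOn_exp_Iic 0).congr_fun (fun y hy => ?_) measurableSet_Iic
    simp only [abs_of_nonpos (show y ≤ 0 from hy), neg_neg]
  · refine (integrableOn_exp_neg_Ioi 0).congr_fun (fun y hy => ?_) measurableSet_Ioi
    simp only [abs_of_pos (show (0 : ℝ) < y from hy)]

end Majorants

/-! ### The phase factor and pointwise bounds for the kernel -/

noncomputable section

/-- The factor `exp(i a (z - x)²)`. -/
def phase (a x : ℝ) (z : ℂ) : ℂ := Complex.exp (Complex.I * (a : ℂ) * (z - (x : ℂ)) ^ 2)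

theorem norm_phase (a x : ℝ) (z : ℂ) : ‖phase a x z‖ = Real.exp (-(a * (2 * (z.re - x) * z.im))) := by
  rw [phase, Complex.norm_exp]
  congr 1
  simp only [pow_two, Complex.mul_re, Complex.mul_im, Complex.I_re, Complex.I_im, Complex.ofReal_re,
    Complex.ofReal_im, Complex.sub_re, Complex.sub_im]
  ring

theorem phase_ne_zero (a x : ℝ) (z : ℂ) : phase a x z ≠ 0 := Complex.exp_ne_zero _

theorem phase_mul_reducedKernel (a : ℝ → ℝ) (G : ℝ → ℝ → ℂ → ℂ) (t x : ℝ) (z : ℂ) :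
    phase (a t) x z * reducedKernel a G t x z = G t x z := by
  rw [phase, reducedKernel, ← mul_assoc, ← Complex.exp_add, add_neg_cancel, Complex.exp_zero, one_mul]

theorem hasDerivAt_phase_space (a x : ℝ) (z : ℂ) :
    HasDerivAt (fun x : ℝ => phase a x z)
      (phase a x z * (-(2 * Complex.I * a * (z - x)))) x := by
  have h1 : HasDerivAt (fun x : ℝ => (x : ℂ)) 1 x := Complex.ofRealCLM.hasDerivAt
  have h2 := (((h1.const_sub z).pow 2).const_mul (Complex.I * (a : ℂ))).cexp
  refine h2.congr_deriv ?_
  simp only [phase, Pi.pow_apply]; push_cast; ring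

theorem hasDerivAt_phase_time {a : ℝ → ℝ} {a' t : ℝ} (ha : HasDerivAt a a' t) (x : ℝ) (z : ℂ) :
    HasDerivAt (fun t : ℝ => phase (a t) x z)
      (phase (a t) x z * (Complex.I * a' * (z - x) ^ 2)) t := by
  have h1 : HasDerivAt (fun t : ℝ => (a t : ℂ)) (a' : ℂ) t := ha.ofReal_comp
  exact ((h1.const_mul Complex.I).mul_const ((z - (x : ℂ)) ^ 2)).cexp

section PointwiseDerivatives

variable {a : ℝ → ℝ} {G : ℝ → ℝ → ℂ → ℂ} {t x : ℝ} {z : ℂ}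

theorem reducedKernel_eq (a : ℝ → ℝ) (G : ℝ → ℝ → ℂ → ℂ) (t x : ℝ) (z : ℂ) :
    reducedKernel a G t x z = (phase (a t) x z)⁻¹ * G t x z := by
  rw [reducedKernel, phase, Complex.exp_neg]

theorem differentiableAt_reducedKernel_space (h : DifferentiableAt ℝ (fun x => G t x z) x) :
    DifferentiableAt ℝ (fun x => reducedKernel a G t x z) x := by
  simp_rw [reducedKernel_eq]
  exact ((hasDerivAt_phase_space (a t) x z).differentiableAt.inv (phase_ne_zero _ _ _)).mul h

/-- The growth assumptions concern `G̃`, whereas the equation and the integrals concern `G`. The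
product rule transfers bounds from one to the other; each differentiation in `x` of the phase costs
a factor of degree one in `z - x`, one in `t` a factor of degree two. -/
theorem deriv_space_eq (h : DifferentiableAt ℝ (fun x => G t x z) x) :
    deriv (fun x => G t x z) x = phase (a t) x z *
      (-(2 * Complex.I * a t * (z - x)) * reducedKernel a G t x z +
        deriv (fun x => reducedKernel a G t x z) x) := by
  have h1 := (hasDerivAt_phase_space (a t) x z).mul
    (differentiableAt_reducedKernel_space (a := a) h).hasDerivAt
  have h2 : (fun x => G t x z) = (fun x => phase (a t) x z) * fun x => reducedKernel a G t x z := by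
    funext x; exact (phase_mul_reducedKernel a G t x z).symm
  rw [h2, h1.deriv]; ring

theorem deriv_deriv_space_eq (h : ∀ᶠ x' in 𝓝 x, DifferentiableAt ℝ (fun x => G t x z) x')
    (h' : DifferentiableAt ℝ (deriv fun x => G t x z) x) :
    deriv (deriv fun x => G t x z) x = phase (a t) x z *
      (-(2 * Complex.I * a t * (z - x)) * (-(2 * Complex.I * a t * (z - x)) * reducedKernel a G t x z +
        deriv (fun x => reducedKernel a G t x z) x) +
       (2 * Complex.I * a t * reducedKernel a G t x z -
        2 * Complex.I * a t * (z - x) * deriv (fun x => reducedKernel a G t x z) x +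
        deriv (deriv fun x => reducedKernel a G t x z) x)) := by
  have hG := differentiableAt_reducedKernel_space (a := a) h.self_of_nhds
  have hlin : HasDerivAt (fun x : ℝ => -(2 * Complex.I * a t * (z - x))) (2 * Complex.I * a t) x := by
    have h1 : HasDerivAt (fun x : ℝ => (x : ℂ)) 1 x := Complex.ofRealCLM.hasDerivAt
    refine (((h1.const_sub z).const_mul (2 * Complex.I * a t)).neg).congr_deriv ?_
    ring
  -- Existence of the second derivative of `G̃` is not a hypothesis; it follows from that of `G` by
  -- solving the first-order formula for the derivative of `G̃`.
  have hr : DifferentiableAt ℝ (deriv fun x => reducedKernel a G t x z) x := by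
    have heq : (deriv fun x => reducedKernel a G t x z) =ᶠ[𝓝 x] fun x' : ℝ =>
        (phase (a t) x' z)⁻¹ * deriv (fun x => G t x z) x' -
          -(2 * Complex.I * a t * (z - x')) * reducedKernel a G t x' z := by
      filter_upwards [h] with x' hx'
      rw [deriv_space_eq (a := a) hx', inv_mul_cancel_left₀ (phase_ne_zero _ _ _)]
      ring
    refine DifferentiableAt.congr_of_eventuallyEq ?_ heq
    exact (((hasDerivAt_phase_space (a t) x z).differentiableAt.inv (phase_ne_zero _ _ _)).mul h').sub
      (hlin.differentiableAt.mul hG)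
  have heq : (deriv fun x => G t x z) =ᶠ[𝓝 x] fun x' : ℝ => phase (a t) x' z *
      (-(2 * Complex.I * a t * (z - x')) * reducedKernel a G t x' z +
        deriv (fun x => reducedKernel a G t x z) x') := by
    filter_upwards [h] with x' hx' using deriv_space_eq hx'
  have h1 := (hasDerivAt_phase_space (a t) x z).mul ((hlin.mul hG.hasDerivAt).add hr.hasDerivAt)
  rw [heq.deriv_eq]
  refine Eq.trans h1.deriv ?_
  simp only [Pi.add_apply, Pi.mul_apply]
  ring

theorem deriv_time_eq (ha : DifferentiableAt ℝ a t) (h : DifferentiableAt ℝ (fun t => G t x z) t) :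
    deriv (fun t => G t x z) t = phase (a t) x z *
      (Complex.I * deriv a t * (z - x) ^ 2 * reducedKernel a G t x z +
        deriv (fun t => reducedKernel a G t x z) t) := by
  have hp := hasDerivAt_phase_time ha.hasDerivAt x z
  have hr : DifferentiableAt ℝ (fun t => reducedKernel a G t x z) t := by
    simp_rw [reducedKernel_eq]
    exact (hp.differentiableAt.inv (phase_ne_zero _ _ _)).mul h
  have h2 : (fun t => G t x z) = (fun t => phase (a t) x z) * fun t => reducedKernel a G t x z := by
    funext t; exact (phase_mul_reducedKernel a G t x z).symm
  rw [h2, (hp.mul hr.hasDerivAt).deriv]; ring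

end PointwiseDerivatives

/-- The regularity and growth properties, on a double sector of opening `β ≤ π / 4`, of the
continuation of a Green's function. -/
structure IsSectorKernel (T : EReal) (β : ℝ) (G : ℝ → ℝ → ℂ → ℂ) (a : ℝ → ℝ) (p : ℝ)
    (A B : Fin 3 → ℝ → ℝ → ℝ) : Prop where
  angle_pos : 0 < β
  angle_le : β ≤ Real.pi / 4
  cont : ∀ t ∈ timeInterval T, ∀ x : ℝ, x ≠ 0 → ContinuousOn (G t x) (doubleSector β)
  holo : ∀ t ∈ timeInterval T, ∀ x : ℝ, x ≠ 0 →
    DifferentiableOn ℂ (G t x) (interior (doubleSector β))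
  ac12 : ∀ z ∈ doubleSector β, IsAC12 T fun t x => G t x z
  a_ac : IsAC (timeInterval T) a
  a_pos : ∀ t ∈ timeInterval T, 0 < a t
  p_pos : 0 < p
  p_lt : p < 2
  A_cont : ∀ j, ContinuousOn (Function.uncurry (A j)) (timeInterval T ×ˢ {0}ᶜ)
  B_cont : ∀ j, ContinuousOn (Function.uncurry (B j)) (timeInterval T ×ˢ {0}ᶜ)
  nonneg : ∀ j, ∀ t ∈ timeInterval T, ∀ x : ℝ, x ≠ 0 → 0 ≤ A j t x ∧ 0 ≤ B j t x
  bound : ∀ t ∈ timeInterval T, ∀ x : ℝ, x ≠ 0 → ∀ z ∈ doubleSector β,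
    ‖reducedKernel a G t x z‖ ≤ A 0 t x * Real.exp (B 0 t x * ‖z‖ ^ p) ∧
    ‖deriv (fun x' => reducedKernel a G t x' z) x‖ ≤ A 1 t x * Real.exp (B 1 t x * ‖z‖ ^ p) ∧
    ‖deriv (deriv (fun x' => reducedKernel a G t x' z)) x‖
      ≤ A 2 t x * Real.exp (B 2 t x * ‖z‖ ^ p) ∧
    ‖deriv (fun t' => reducedKernel a G t' x z) t‖ ≤ A 2 t x * Real.exp (B 2 t x * ‖z‖ ^ p)

theorem mul_exp_le_mul_exp {A B A' B' s : ℝ} (hA : 0 ≤ A) (hAA : A ≤ A') (hBB : B ≤ B')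
    (hs : 0 ≤ s) : A * Real.exp (B * s) ≤ A' * Real.exp (B' * s) :=
  mul_le_mul hAA (Real.exp_le_exp.2 (mul_le_mul_of_nonneg_right hBB hs)) (Real.exp_pos _).le
    (hA.trans hAA)

/-- Polynomial factors are traded for exponentials. At most two powers of `z - x` occur, so one
factor `exp(2 ‖z‖)` serves for all derivatives, and the Gaussian absorbs it. -/
theorem norm_sub_le_exp {X x : ℝ} (hx : |x| ≤ X) (z : ℂ) :
    ‖z - x‖ ≤ Real.exp X * Real.exp ‖z‖ := by
  rw [← Real.exp_add]
  have h1 : ‖z - x‖ ≤ ‖z‖ + |x| := by simpa using norm_sub_le z (x : ℂ)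
  have h2 := Real.add_one_le_exp (X + ‖z‖)
  linarith

namespace IsSectorKernel

variable {T : EReal} {β : ℝ} {G : ℝ → ℝ → ℂ → ℂ} {a : ℝ → ℝ} {p : ℝ} {A B : Fin 3 → ℝ → ℝ → ℝ}
  {t x A' B' X a₁ : ℝ} {z : ℂ}

theorem angle_lt (hG : IsSectorKernel T β G a p A B) : β < Real.pi / 2 := by
  linarith [hG.angle_le, Real.pi_pos]

theorem norm_le (hG : IsSectorKernel T β G a p A B) (ht : t ∈ timeInterval T) (hx : x ≠ 0)
    (hz : z ∈ doubleSector β) (hA : A 0 t x ≤ A') (hB : B 0 t x ≤ B') :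
    ‖G t x z‖ ≤ A' * (Real.exp (B' * ‖z‖ ^ p) * ‖phase (a t) x z‖) := by
  rw [← phase_mul_reducedKernel a G t x z, norm_mul]
  have h1 := (hG.bound t ht x hx z hz).1.trans (mul_exp_le_mul_exp (hG.nonneg 0 t ht x hx).1 hA hB
    (Real.rpow_nonneg (norm_nonneg z) p))
  calc _ ≤ ‖phase (a t) x z‖ * (A' * Real.exp (B' * ‖z‖ ^ p)) :=
        mul_le_mul_of_nonneg_left h1 (norm_nonneg _)
    _ = _ := by ring

theorem norm_deriv_space_le (hG : IsSectorKernel T β G a p A B) (ht : t ∈ timeInterval T)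
    (hx : x ≠ 0) (hz : z ∈ doubleSector β) (hA : A 0 t x ≤ A') (hB : B 0 t x ≤ B')
    (hA1 : A 1 t x ≤ A') (hB1 : B 1 t x ≤ B') (hX : |x| ≤ X) (ha : a t ≤ a₁) :
    ‖deriv (fun x => G t x z) x‖ ≤ A' * (2 * a₁ * Real.exp X + 1) *
      (Real.exp (B' * ‖z‖ ^ p) * Real.exp (2 * ‖z‖) * ‖phase (a t) x z‖) := by
  rw [deriv_space_eq (a := a) (((hG.ac12 z hz).2 t ht).2.1 x hx), norm_mul]
  have hs := Real.rpow_nonneg (norm_nonneg z) p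
  have h0 := (hG.bound t ht x hx z hz).1.trans (mul_exp_le_mul_exp (hG.nonneg 0 t ht x hx).1 hA hB hs)
  have h1 := (hG.bound t ht x hx z hz).2.1.trans
    (mul_exp_le_mul_exp (hG.nonneg 1 t ht x hx).1 hA1 hB1 hs)
  have hA' : 0 ≤ A' := (hG.nonneg 0 t ht x hx).1.trans hA
  have hat := hG.a_pos t ht
  have ha₁ : 0 ≤ a₁ := hat.le.trans ha
  have hn := norm_sub_le_exp hX z
  have he : 1 ≤ Real.exp ‖z‖ := Real.one_le_exp (norm_nonneg z)
  have he2 : Real.exp (2 * ‖z‖) = Real.exp ‖z‖ * Real.exp ‖z‖ := by rw [← Real.exp_add]; ring_nf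
  set M := Real.exp (B' * ‖z‖ ^ p) with hM
  have hMp : 0 < M := Real.exp_pos _
  have hc : ‖-(2 * Complex.I * (a t : ℂ) * (z - x))‖ ≤ 2 * a₁ * Real.exp X * Real.exp ‖z‖ := by
    rw [norm_neg, norm_mul, norm_mul, norm_mul, Complex.norm_I, Complex.norm_real, Complex.norm_two,
      Real.norm_of_nonneg hat.le, mul_one]
    calc 2 * a t * ‖z - x‖ ≤ 2 * a₁ * (Real.exp X * Real.exp ‖z‖) := by gcongr
      _ = _ := by ring
  have hc0 : 0 ≤ 2 * a₁ * Real.exp X := by positivity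
  have hee : Real.exp ‖z‖ ≤ Real.exp (2 * ‖z‖) := by rw [he2]; nlinarith
  have hin : ‖-(2 * Complex.I * (a t : ℂ) * (z - x)) * reducedKernel a G t x z +
      deriv (fun x => reducedKernel a G t x z) x‖ ≤
      A' * (2 * a₁ * Real.exp X + 1) * (M * Real.exp (2 * ‖z‖)) := by
    refine (norm_add_le _ _).trans ?_
    rw [norm_mul]
    calc _ ≤ 2 * a₁ * Real.exp X * Real.exp ‖z‖ * (A' * M) + A' * M := by gcongr
      _ ≤ 2 * a₁ * Real.exp X * Real.exp (2 * ‖z‖) * (A' * M) + A' * M * Real.exp (2 * ‖z‖) := by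
          refine add_le_add (by gcongr) (le_mul_of_one_le_right (by positivity) (he.trans hee))
      _ = _ := by ring
  calc _ ≤ ‖phase (a t) x z‖ * (A' * (2 * a₁ * Real.exp X + 1) * (M * Real.exp (2 * ‖z‖))) :=
        mul_le_mul_of_nonneg_left hin (norm_nonneg _)
    _ = _ := by ring

theorem norm_deriv_deriv_space_le (hG : IsSectorKernel T β G a p A B) (ht : t ∈ timeInterval T)
    (hx : x ≠ 0) (hz : z ∈ doubleSector β) (hA : ∀ j, A j t x ≤ A') (hB : ∀ j, B j t x ≤ B')
    (hX : |x| ≤ X) (ha : a t ≤ a₁) :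
    ‖deriv (deriv fun x => G t x z) x‖ ≤
      A' * ((2 * a₁ * Real.exp X + 1) ^ 2 + 2 * a₁) *
      (Real.exp (B' * ‖z‖ ^ p) * Real.exp (2 * ‖z‖) * ‖phase (a t) x z‖) := by
  have hA' : 0 ≤ A' := (hG.nonneg 0 t ht x hx).1.trans (hA 0)
  have hat := hG.a_pos t ht
  have ha₁ : 0 ≤ a₁ := hat.le.trans ha
  -- Where the second derivative does not exist, `deriv` is zero and the bound is trivial.
  by_cases hd : DifferentiableAt ℝ (deriv fun x => G t x z) x
  swap
  · rw [deriv_zero_of_not_differentiableAt hd, norm_zero]; positivity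
  have hev : ∀ᶠ x' in 𝓝 x, DifferentiableAt ℝ (fun x => G t x z) x' := by
    filter_upwards [isOpen_ne.mem_nhds hx] with x' hx' using ((hG.ac12 z hz).2 t ht).2.1 x' hx'
  rw [deriv_deriv_space_eq (a := a) hev hd, norm_mul]
  have hs := Real.rpow_nonneg (norm_nonneg z) p
  have h0 := (hG.bound t ht x hx z hz).1.trans
    (mul_exp_le_mul_exp (hG.nonneg 0 t ht x hx).1 (hA 0) (hB 0) hs)
  have h1 := (hG.bound t ht x hx z hz).2.1.trans
    (mul_exp_le_mul_exp (hG.nonneg 1 t ht x hx).1 (hA 1) (hB 1) hs)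
  have h2 := (hG.bound t ht x hx z hz).2.2.1.trans
    (mul_exp_le_mul_exp (hG.nonneg 2 t ht x hx).1 (hA 2) (hB 2) hs)
  have hn := norm_sub_le_exp hX z
  have he : 1 ≤ Real.exp ‖z‖ := Real.one_le_exp (norm_nonneg z)
  have he2 : Real.exp (2 * ‖z‖) = Real.exp ‖z‖ * Real.exp ‖z‖ := by rw [← Real.exp_add]; ring_nf
  set M := Real.exp (B' * ‖z‖ ^ p) with hM
  have hMp : 0 < M := Real.exp_pos _
  set L := 2 * a₁ * Real.exp X with hL
  set e := Real.exp ‖z‖ with hedef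
  have hL0 : 0 ≤ L := by positivity
  have hc' : ‖2 * Complex.I * (a t : ℂ) * (z - x)‖ ≤ L * e := by
    rw [norm_mul, norm_mul, norm_mul, Complex.norm_I, Complex.norm_real, Complex.norm_two,
      Real.norm_of_nonneg hat.le, mul_one]
    calc 2 * a t * ‖z - x‖ ≤ 2 * a₁ * (Real.exp X * e) := by gcongr
      _ = _ := by ring
  have hc : ‖-(2 * Complex.I * (a t : ℂ) * (z - x))‖ ≤ L * e := by rwa [norm_neg]
  have hc2 : ‖2 * Complex.I * (a t : ℂ)‖ ≤ 2 * a₁ := by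
    rw [norm_mul, norm_mul, Complex.norm_I, Complex.norm_real, Complex.norm_two,
      Real.norm_of_nonneg hat.le, mul_one]
    linarith
  have hin : ‖-(2 * Complex.I * (a t : ℂ) * (z - x)) *
      (-(2 * Complex.I * (a t : ℂ) * (z - x)) * reducedKernel a G t x z +
        deriv (fun x => reducedKernel a G t x z) x) +
       (2 * Complex.I * (a t : ℂ) * reducedKernel a G t x z -
        2 * Complex.I * (a t : ℂ) * (z - x) * deriv (fun x => reducedKernel a G t x z) x +
        deriv (deriv fun x => reducedKernel a G t x z) x)‖ ≤
      L * e * (L * e * (A' * M) + A' * M) + (2 * a₁ * (A' * M) + L * e * (A' * M) + A' * M) := by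
    refine (norm_add_le _ _).trans (add_le_add ?_ ?_)
    · rw [norm_mul]
      refine mul_le_mul hc ((norm_add_le _ _).trans (add_le_add ?_ h1)) (norm_nonneg _) (by positivity)
      rw [norm_mul]; gcongr
    · refine (norm_add_le _ _).trans (add_le_add ((norm_sub_le _ _).trans (add_le_add ?_ ?_)) h2)
      · rw [norm_mul]; gcongr
      · rw [norm_mul]; gcongr
  have hfin : L * e * (L * e * (A' * M) + A' * M) + (2 * a₁ * (A' * M) + L * e * (A' * M) + A' * M) ≤
      A' * ((L + 1) ^ 2 + 2 * a₁) * (M * (e * e)) := by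
    have hee : e ≤ e * e := by nlinarith
    have h1e : 1 ≤ e * e := he.trans hee
    have hAM : 0 ≤ A' * M := by positivity
    have k1 : L * e ≤ L * (e * e) := mul_le_mul_of_nonneg_left hee hL0
    have k2 : 2 * a₁ ≤ 2 * a₁ * (e * e) := le_mul_of_one_le_right (by positivity) h1e
    have : L * e * (L * e) + L * e + 2 * a₁ + L * e + 1 ≤ ((L + 1) ^ 2 + 2 * a₁) * (e * e) := by
      nlinarith
    calc _ = (A' * M) * (L * e * (L * e) + L * e + 2 * a₁ + L * e + 1) := by ring
      _ ≤ (A' * M) * (((L + 1) ^ 2 + 2 * a₁) * (e * e)) := mul_le_mul_of_nonneg_left this hAM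
      _ = _ := by ring
  calc _ ≤ ‖phase (a t) x z‖ * (A' * ((L + 1) ^ 2 + 2 * a₁) * (M * (e * e))) :=
        mul_le_mul_of_nonneg_left (hin.trans hfin) (norm_nonneg _)
    _ = _ := by rw [he2]; ring

/-- The factor `|a'| + 1` is kept apart because `a'` need not be locally bounded; it becomes the
integrable time majorant in `IsDominatedFamily`. -/
theorem norm_deriv_time_le (hG : IsSectorKernel T β G a p A B) (ht : t ∈ timeInterval T)
    (hx : x ≠ 0) (hz : z ∈ doubleSector β) (hA : ∀ j, A j t x ≤ A') (hB : ∀ j, B j t x ≤ B')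
    (hX : |x| ≤ X) (had : DifferentiableAt ℝ a t) :
    ‖deriv (fun t => G t x z) t‖ ≤ (|deriv a t| + 1) * (A' * Real.exp X ^ 2 *
      (Real.exp (B' * ‖z‖ ^ p) * Real.exp (2 * ‖z‖) * ‖phase (a t) x z‖)) := by
  have hA' : 0 ≤ A' := (hG.nonneg 0 t ht x hx).1.trans (hA 0)
  by_cases hd : DifferentiableAt ℝ (fun t => G t x z) t
  swap
  · rw [deriv_zero_of_not_differentiableAt hd, norm_zero]; positivity
  rw [deriv_time_eq (a := a) had hd, norm_mul]
  have hs := Real.rpow_nonneg (norm_nonneg z) p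
  have h0 := (hG.bound t ht x hx z hz).1.trans
    (mul_exp_le_mul_exp (hG.nonneg 0 t ht x hx).1 (hA 0) (hB 0) hs)
  have h2 := (hG.bound t ht x hx z hz).2.2.2.trans
    (mul_exp_le_mul_exp (hG.nonneg 2 t ht x hx).1 (hA 2) (hB 2) hs)
  have hn := norm_sub_le_exp hX z
  have he : 1 ≤ Real.exp ‖z‖ := Real.one_le_exp (norm_nonneg z)
  have he2 : Real.exp (2 * ‖z‖) = Real.exp ‖z‖ * Real.exp ‖z‖ := by rw [← Real.exp_add]; ring_nf
  have hX1 : 1 ≤ Real.exp X := Real.one_le_exp ((abs_nonneg x).trans hX)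
  set M := Real.exp (B' * ‖z‖ ^ p) with hM
  have hMp : 0 < M := Real.exp_pos _
  have hin : ‖Complex.I * ((deriv a t : ℝ) : ℂ) * (z - x) ^ 2 * reducedKernel a G t x z +
        deriv (fun t => reducedKernel a G t x z) t‖ ≤
      (|deriv a t| + 1) * (A' * M * (Real.exp X * Real.exp ‖z‖) ^ 2) := by
    refine (norm_add_le _ _).trans ?_
    rw [norm_mul, norm_mul, norm_mul, norm_pow, Complex.norm_I, Complex.norm_real, Real.norm_eq_abs,
      one_mul]
    have h3 : 1 ≤ (Real.exp X * Real.exp ‖z‖) ^ 2 := one_le_pow₀ (one_le_mul_of_one_le_of_one_le hX1 he)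
    calc _ ≤ |deriv a t| * (Real.exp X * Real.exp ‖z‖) ^ 2 * (A' * M) + A' * M := by gcongr
      _ ≤ |deriv a t| * (Real.exp X * Real.exp ‖z‖) ^ 2 * (A' * M) +
          A' * M * (Real.exp X * Real.exp ‖z‖) ^ 2 :=
          add_le_add le_rfl (le_mul_of_one_le_right (by positivity) h3)
      _ = _ := by ring
  calc _ ≤ ‖phase (a t) x z‖ * ((|deriv a t| + 1) * (A' * M * (Real.exp X * Real.exp ‖z‖) ^ 2)) :=
        mul_le_mul_of_nonneg_left hin (norm_nonneg _)
    _ = _ := by rw [he2]; ring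

end IsSectorKernel

end

/-! ### Domination of the weighted kernel along lines through the origin -/

noncomputable section

/-- A continuous weight on the line bounded by `C exp(D |y|^q - ε y²)`. -/
structure IsWeight (q C D ε : ℝ) (w : ℝ → ℂ) : Prop where
  continuous : Continuous w
  const_nonneg : 0 ≤ C
  rate_nonneg : 0 ≤ D
  gauss_nonneg : 0 ≤ ε
  bound : ∀ y, ‖w y‖ ≤ C * Real.exp (D * |y| ^ q - ε * y ^ 2)

theorem norm_exp_mul_I_mul (θ y : ℝ) : ‖Complex.exp (θ * Complex.I) * y‖ = |y| := by
  rw [norm_mul, Complex.norm_exp_ofReal_mul_I, one_mul, Complex.norm_real, Real.norm_eq_abs]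

/-- At `z = e^{iθ} y` the exponent equals `-a sin(2θ) y² + 2 a x y sin θ`. The quadratic term uses
the lower bound on `a`, the linear term the upper bounds on `a` and `|x|`. -/
theorem norm_phase_ray_le {θ a₀ a₁ X a x : ℝ} (hθ0 : 0 ≤ θ) (hθ : θ ≤ Real.pi / 2) (ha0 : 0 ≤ a₀)
    (h0 : a₀ ≤ a) (h1 : a ≤ a₁) (hx : |x| ≤ X) (y : ℝ) :
    ‖phase a x (Complex.exp (θ * Complex.I) * y)‖ ≤
      Real.exp (2 * a₁ * X * |y| - a₀ * Real.sin (2 * θ) * y ^ 2) := by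
  rw [norm_phase]
  refine Real.exp_le_exp.2 ?_
  have hre : (Complex.exp (θ * Complex.I) * y).re = Real.cos θ * y := by
    simp [Complex.exp_ofReal_mul_I_re]
  have him : (Complex.exp (θ * Complex.I) * y).im = Real.sin θ * y := by
    simp [Complex.exp_ofReal_mul_I_im]
  rw [hre, him, Real.sin_two_mul]
  have hs0 : 0 ≤ Real.sin θ := Real.sin_nonneg_of_nonneg_of_le_pi hθ0 (by linarith [Real.pi_pos])
  have hs1 : Real.sin θ ≤ 1 := Real.sin_le_one θ
  have hc0 : 0 ≤ Real.cos θ := Real.cos_nonneg_of_mem_Icc ⟨by linarith [Real.pi_pos], hθ⟩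
  have hsc : 0 ≤ Real.sin θ * Real.cos θ * y ^ 2 := by positivity
  have e1 : a₀ * (Real.sin θ * Real.cos θ * y ^ 2) ≤ a * (Real.sin θ * Real.cos θ * y ^ 2) :=
    mul_le_mul_of_nonneg_right h0 hsc
  have e2 : a * (x * y * Real.sin θ) ≤ a₁ * X * |y| := by
    have ha : 0 ≤ a := ha0.trans h0
    calc a * (x * y * Real.sin θ) ≤ a * (|x| * |y| * 1) := by
          refine mul_le_mul_of_nonneg_left ?_ ha
          calc x * y * Real.sin θ ≤ |x * y| * Real.sin θ :=
                mul_le_mul_of_nonneg_right (le_abs_self _) hs0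
            _ ≤ |x * y| * 1 := mul_le_mul_of_nonneg_left hs1 (abs_nonneg _)
            _ = _ := by rw [abs_mul]
      _ ≤ a₁ * (X * |y| * 1) := by
          have : 0 ≤ X := (abs_nonneg x).trans hx
          have : 0 ≤ a₁ := ha.trans h1
          gcongr
      _ = _ := by ring
  nlinarith

/-- The Gaussian rate is at least `a₀ sin(2θ) + ε`, the first part from the phase and the second
from the weight. Positivity of `ε + sin(2θ)` covers both uses: the rotated line with `ε = 0` and the
damped real line with `θ = 0`. -/
theorem exists_majorant {p q C D ε θ a₀ B₁ : ℝ} {w : ℝ → ℂ} (hp0 : 0 < p) (hp2 : p < 2)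
    (hq0 : 0 < q) (hq2 : q < 2) (hw : IsWeight q C D ε w) (hθ0 : 0 ≤ θ) (hθ : θ ≤ Real.pi / 4)
    (hε : 0 < ε + Real.sin (2 * θ)) (ha₀ : 0 < a₀) (a₁ X : ℝ) (hB₁ : 0 ≤ B₁) :
    ∃ K : ℝ, 0 ≤ K ∧ ∀ a x y : ℝ, a₀ ≤ a → a ≤ a₁ → |x| ≤ X →
      Real.exp (B₁ * |y| ^ p) * Real.exp (2 * |y|) * ‖phase a x (Complex.exp (θ * Complex.I) * y)‖ *
        ‖w y‖ ≤ K * Real.exp (-|y|) := by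
  have hs : 0 ≤ Real.sin (2 * θ) :=
    Real.sin_nonneg_of_nonneg_of_le_pi (by linarith) (by linarith [Real.pi_pos])
  have hm : 0 < a₀ * Real.sin (2 * θ) + ε := by
    rcases hs.eq_or_lt with h | h
    · rw [← h] at hε ⊢; linarith
    · have := mul_pos ha₀ h; linarith [hw.gauss_nonneg]
  obtain ⟨K, hK⟩ := exists_exponent_le (X := 0) hp0 hp2 hq0 hq2 (2 + 2 * a₁ * X) hB₁ hw.rate_nonneg hm
  refine ⟨C * Real.exp K, mul_nonneg hw.const_nonneg (Real.exp_pos _).le, fun a x y h0 h1 hx => ?_⟩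
  have hph := norm_phase_ray_le hθ0 (by linarith [Real.pi_pos]) ha₀.le h0 h1 hx y
  have hk := hK |y| |y| (abs_nonneg y) (abs_nonneg y) (by simp)
  rw [sq_abs] at hk
  calc _ ≤ Real.exp (B₁ * |y| ^ p) * Real.exp (2 * |y|) *
        Real.exp (2 * a₁ * X * |y| - a₀ * Real.sin (2 * θ) * y ^ 2) *
        (C * Real.exp (D * |y| ^ q - ε * y ^ 2)) := by
        refine mul_le_mul (mul_le_mul_of_nonneg_left hph (by positivity)) (hw.bound y)
          (norm_nonneg _) (by positivity)
    _ = C * Real.exp (B₁ * |y| ^ p + D * |y| ^ q + (2 + 2 * a₁ * X) * |y| -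
        (a₀ * Real.sin (2 * θ) + ε) * y ^ 2) := by
        rw [mul_left_comm, ← Real.exp_add, ← Real.exp_add, ← Real.exp_add]; congr 2; ring
    _ ≤ C * Real.exp (K - |y|) :=
        mul_le_mul_of_nonneg_left (Real.exp_le_exp.2 hk) hw.const_nonneg
    _ = _ := by rw [sub_eq_add_neg, Real.exp_add]; ring

namespace IsSectorKernel

variable {T : EReal} {β : ℝ} {G : ℝ → ℝ → ℂ → ℂ} {a : ℝ → ℝ} {p : ℝ} {A B : Fin 3 → ℝ → ℝ → ℝ}
  {q C D ε θ : ℝ} {w : ℝ → ℂ}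

/-- One constant serves all derivatives, but the hypotheses on `A j`, `B j` are demanded only for
the derivative concerned, since near `x = 0` only the indices `0` and possibly `1` are controlled.
-/
theorem exists_weighted_bounds (hG : IsSectorKernel T β G a p A B) (hq0 : 0 < q) (hq2 : q < 2)
    (hw : IsWeight q C D ε w) (hθ : θ ∈ Icc 0 β) (hε : 0 < ε + Real.sin (2 * θ))
    {A' B' a₀ : ℝ} (a₁ X : ℝ) (hA' : 0 ≤ A') (hB' : 0 ≤ B') (ha₀ : 0 < a₀) (ha₁ : 0 ≤ a₁) :
    ∃ K : ℝ, 0 ≤ K ∧ ∀ t ∈ timeInterval T, ∀ x : ℝ, x ≠ 0 → a₀ ≤ a t → a t ≤ a₁ → |x| ≤ X →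
      A 0 t x ≤ A' → B 0 t x ≤ B' → ∀ y : ℝ, y ≠ 0 →
      ‖G t x (Complex.exp (θ * Complex.I) * y) * w y‖ ≤ K * Real.exp (-|y|) ∧
      (A 1 t x ≤ A' → B 1 t x ≤ B' →
        ‖deriv (fun x => G t x (Complex.exp (θ * Complex.I) * y)) x * w y‖ ≤ K * Real.exp (-|y|)) ∧
      ((∀ j, A j t x ≤ A' ∧ B j t x ≤ B') →
        ‖deriv (deriv fun x => G t x (Complex.exp (θ * Complex.I) * y)) x * w y‖
          ≤ K * Real.exp (-|y|) ∧
        (DifferentiableAt ℝ a t →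
          ‖deriv (fun t => G t x (Complex.exp (θ * Complex.I) * y)) t * w y‖
            ≤ (|deriv a t| + 1) * (K * Real.exp (-|y|)))) := by
  obtain ⟨K, hK0, hK⟩ := exists_majorant hG.p_pos hG.p_lt hq0 hq2 hw hθ.1 (hθ.2.trans hG.angle_le)
    hε ha₀ a₁ X hB'
  set c₁ := A' * (2 * a₁ * Real.exp X + 1) with hc₁
  set c₂ := A' * ((2 * a₁ * Real.exp X + 1) ^ 2 + 2 * a₁) with hc₂
  set c₃ := A' * Real.exp X ^ 2 with hc₃
  have p₁ : 0 ≤ c₁ := by positivity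
  have p₂ : 0 ≤ c₂ := by positivity
  have p₃ : 0 ≤ c₃ := by positivity
  refine ⟨(A' + c₁ + c₂ + c₃) * K, by positivity, fun t ht x hx h0 h1 hxX hA0 hB0 y hy => ?_⟩
  have hz := exp_mul_real_mem_doubleSector hG.angle_lt hθ hy
  have hn := norm_exp_mul_I_mul θ y
  have hmaj := hK (a t) x y h0 h1 hxX
  set z := Complex.exp (θ * Complex.I) * y with hzdef
  set P := Real.exp (B' * |y| ^ p) * Real.exp (2 * |y|) * ‖phase (a t) x z‖ with hP
  have hPn : 0 ≤ P := by positivity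
  have fin : ∀ {u : ℂ} {c : ℝ}, 0 ≤ c → c ≤ A' + c₁ + c₂ + c₃ → ‖u‖ ≤ c * P →
      ‖u * w y‖ ≤ (A' + c₁ + c₂ + c₃) * K * Real.exp (-|y|) := by
    intro u c hc hcc hu
    rw [norm_mul]
    calc ‖u‖ * ‖w y‖ ≤ c * P * ‖w y‖ := mul_le_mul_of_nonneg_right hu (norm_nonneg _)
      _ = c * (P * ‖w y‖) := by ring
      _ ≤ (A' + c₁ + c₂ + c₃) * (K * Real.exp (-|y|)) :=
          mul_le_mul hcc hmaj (by positivity) (by positivity)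
      _ = _ := by ring
  refine ⟨?_, fun hA1 hB1 => ?_, fun hAB => ⟨?_, fun had => ?_⟩⟩
  · refine fin hA' (by linarith) ((hG.norm_le ht hx hz hA0 hB0).trans ?_)
    rw [hn, hP]
    refine mul_le_mul_of_nonneg_left (mul_le_mul_of_nonneg_right ?_ (norm_nonneg _)) hA'
    exact le_mul_of_one_le_right (Real.exp_pos _).le (Real.one_le_exp (by positivity))
  · have := hG.norm_deriv_space_le ht hx hz hA0 hB0 hA1 hB1 hxX h1
    rw [hn] at this
    exact fin p₁ (by linarith) this
  · have := hG.norm_deriv_deriv_space_le ht hx hz (fun j => (hAB j).1) (fun j => (hAB j).2) hxX h1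
    rw [hn] at this
    exact fin p₂ (by linarith) this
  · have := hG.norm_deriv_time_le ht hx hz (fun j => (hAB j).1) (fun j => (hAB j).2) hxX had
    rw [hn] at this
    rw [norm_mul]
    calc _ ≤ (|deriv a t| + 1) * (c₃ * P) * ‖w y‖ := mul_le_mul_of_nonneg_right this (norm_nonneg _)
      _ = (|deriv a t| + 1) * (c₃ * (P * ‖w y‖)) := by ring
      _ ≤ (|deriv a t| + 1) * ((A' + c₁ + c₂ + c₃) * (K * Real.exp (-|y|))) := by
          refine mul_le_mul_of_nonneg_left ?_ (by positivity)
          exact mul_le_mul (by linarith) hmaj (by positivity) (by positivity)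
      _ = _ := by ring

theorem continuousOn_a (hG : IsSectorKernel T β G a p A B) : ContinuousOn a (timeInterval T) :=
  hG.a_ac.continuousOn (isOpen_timeInterval T) (ordConnected_timeInterval T)

/-- Continuity of `A j`, `B j`, `a` and `1 / a` on a compact set; the bound on `1 / a` keeps the
Gaussian rate uniform. -/
theorem exists_bounds_on_compact (hG : IsSectorKernel T β G a p A B) {Q : Set (ℝ × ℝ)}
    (hQ : IsCompact Q) (hQs : Q ⊆ timeInterval T ×ˢ {0}ᶜ) :
    ∃ A' a₀ : ℝ, 0 ≤ A' ∧ 0 < a₀ ∧ ∀ t x : ℝ, (t, x) ∈ Q →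
      (∀ j, A j t x ≤ A' ∧ B j t x ≤ A') ∧ |x| ≤ A' ∧ a₀ ≤ a t ∧ a t ≤ A' := by
  choose cA hA using fun j => hQ.exists_bound_of_continuousOn ((hG.A_cont j).mono hQs)
  choose cB hB using fun j => hQ.exists_bound_of_continuousOn ((hG.B_cont j).mono hQs)
  obtain ⟨cx, hx⟩ := hQ.exists_bound_of_continuousOn (continuous_snd (X := ℝ) (Y := ℝ)).continuousOn
  have hac : ContinuousOn (fun r : ℝ × ℝ => a r.1) Q :=
    hG.continuousOn_a.comp continuous_fst.continuousOn fun r hr => (hQs hr).1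
  obtain ⟨ca, ha⟩ := hQ.exists_bound_of_continuousOn hac
  obtain ⟨ci, hi⟩ := hQ.exists_bound_of_continuousOn
    (hac.inv₀ fun r hr => (hG.a_pos r.1 (hQs hr).1).ne')
  set M := (∑ j, |cA j|) + (∑ j, |cB j|) + |cx| + |ca| with hM
  have nA : 0 ≤ ∑ j, |cA j| := Finset.sum_nonneg fun j _ => abs_nonneg _
  have nB : 0 ≤ ∑ j, |cB j| := Finset.sum_nonneg fun j _ => abs_nonneg _
  have nx := abs_nonneg cx
  have na := abs_nonneg ca
  refine ⟨M, (|ci| + 1)⁻¹, by positivity, by positivity, fun t x hr => ⟨fun j => ⟨?_, ?_⟩, ?_, ?_, ?_⟩⟩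
  · have h1 := (le_abs_self _).trans (hA j _ hr)
    have h2 := Finset.single_le_sum (f := fun j => |cA j|) (fun j _ => abs_nonneg _) (Finset.mem_univ j)
    have h3 := le_abs_self (cA j)
    simp only [Function.uncurry] at h1 h2
    linarith
  · have h1 := (le_abs_self _).trans (hB j _ hr)
    have h2 := Finset.single_le_sum (f := fun j => |cB j|) (fun j _ => abs_nonneg _) (Finset.mem_univ j)
    have h3 := le_abs_self (cB j)
    simp only [Function.uncurry] at h1 h2
    linarith
  · have h1 := hx _ hr
    have h3 := le_abs_self cx
    simp only [Real.norm_eq_abs] at h1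
    linarith
  · have h1 := (le_abs_self _).trans (hi _ hr)
    have hpos := hG.a_pos t (hQs hr).1
    have h3 := le_abs_self ci
    change (a t)⁻¹ ≤ ci at h1
    rw [inv_le_comm₀ (by positivity) hpos]
    linarith
  · have h1 := (le_abs_self _).trans (ha _ hr)
    have h3 := le_abs_self ca
    simp only at h1
    linarith

end IsSectorKernel

open Classical in
/-- The kernel `G(t,x,e^{iθ} y) w(y)`, extended by zero. -/
def weightedKernel (T : EReal) (θ : ℝ) (G : ℝ → ℝ → ℂ → ℂ) (w : ℝ → ℂ) (t x y : ℝ) : ℂ :=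
  if t ∈ timeInterval T ∧ x ≠ 0 ∧ y ≠ 0 then G t x (Complex.exp (θ * Complex.I) * y) * w y else 0

section WeightedKernel

variable {T : EReal} {θ : ℝ} {G : ℝ → ℝ → ℂ → ℂ} {w : ℝ → ℂ} {t x y : ℝ}

theorem weightedKernel_apply (ht : t ∈ timeInterval T) (hx : x ≠ 0) (hy : y ≠ 0) :
    weightedKernel T θ G w t x y = G t x (Complex.exp (θ * Complex.I) * y) * w y :=
  if_pos ⟨ht, hx, hy⟩

theorem weightedKernel_eq_zero (h : t ∉ timeInterval T ∨ x = 0 ∨ y = 0) :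
    weightedKernel T θ G w t x y = 0 :=
  if_neg (by tauto)

theorem deriv_weightedKernel_time (ht : t ∈ timeInterval T) (hx : x ≠ 0) (hy : y ≠ 0) :
    deriv (fun t => weightedKernel T θ G w t x y) t =
      deriv (fun t => G t x (Complex.exp (θ * Complex.I) * y)) t * w y := by
  rw [← deriv_mul_const_field]
  refine EventuallyEq.deriv_eq ?_
  filter_upwards [(isOpen_timeInterval T).mem_nhds ht] with s hs using weightedKernel_apply hs hx hy

theorem deriv_weightedKernel_space (ht : t ∈ timeInterval T) (hx : x ≠ 0) (hy : y ≠ 0) :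
    deriv (fun x => weightedKernel T θ G w t x y) x =
      deriv (fun x => G t x (Complex.exp (θ * Complex.I) * y)) x * w y := by
  rw [← deriv_mul_const_field]
  refine EventuallyEq.deriv_eq ?_
  filter_upwards [isOpen_ne.mem_nhds hx] with s hs using weightedKernel_apply ht hs hy

theorem deriv_deriv_weightedKernel_space (ht : t ∈ timeInterval T) (hx : x ≠ 0) (hy : y ≠ 0) :
    deriv (deriv fun x => weightedKernel T θ G w t x y) x =
      deriv (deriv fun x => G t x (Complex.exp (θ * Complex.I) * y)) x * w y := by
  rw [← deriv_mul_const_field]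
  refine EventuallyEq.deriv_eq ?_
  filter_upwards [isOpen_ne.mem_nhds hx] with s hs using deriv_weightedKernel_space ht hs hy

end WeightedKernel

theorem isAC_zero (I : Set ℝ) : IsAC I fun _ => (0 : ℂ) :=
  ⟨fun _ => 0, (locallyIntegrable_const 0).locallyIntegrableOn I, by simp⟩

theorem isAC12_zero (T : EReal) : IsAC12 T fun _ _ => 0 :=
  ⟨fun _ _ => isAC_zero _, fun _ _ => ⟨⟨isAC_zero _, isAC_zero _⟩,
    fun _ _ => differentiableAt_const _, by simp [IsACPunctured, isAC_zero]⟩⟩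

theorem subset_compl_zero {U : Set ℝ} (hU : (0 : ℝ) ∉ U) : U ⊆ {0}ᶜ :=
  fun x hx h => hU (by rwa [mem_singleton_iff.1 h] at hx)

theorem IsACPunctured.congr_mul {f g : ℝ → ℂ} (hf : IsACPunctured f) (c : ℂ)
    (h : ∀ x, x ≠ 0 → f x * c = g x) : IsACPunctured g :=
  ⟨(hf.1.mul_const c).congr fun x hx => h x (ne_of_lt hx),
    (hf.2.mul_const c).congr fun x hx => h x (ne_of_gt hx)⟩

namespace IsSectorKernel

variable {T : EReal} {β : ℝ} {G : ℝ → ℝ → ℂ → ℂ} {a : ℝ → ℝ} {p : ℝ} {A B : Fin 3 → ℝ → ℝ → ℝ}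
  {q C D ε θ : ℝ} {w : ℝ → ℂ}

theorem isAC12_weightedKernel (hG : IsSectorKernel T β G a p A B) (hθ : θ ∈ Icc 0 β) (y : ℝ) :
    IsAC12 T fun t x => weightedKernel T θ G w t x y := by
  by_cases hy : y = 0
  · simp_rw [fun t x => weightedKernel_eq_zero (T := T) (θ := θ) (G := G) (w := w) (t := t) (x := x)
      (Or.inr (Or.inr hy))]
    exact isAC12_zero T
  have h := hG.ac12 _ (exp_mul_real_mem_doubleSector hG.angle_lt hθ hy)
  refine ⟨fun x hx => ((h.1 x hx).mul_const (w y)).congr fun t ht => (weightedKernel_apply ht hx hy).symm,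
    fun t ht => ⟨(h.2 t ht).1.congr_mul (w y) fun x hx => (weightedKernel_apply ht hx hy).symm,
      fun x hx => ?_, (h.2 t ht).2.2.congr_mul (w y) fun x hx =>
        (deriv_weightedKernel_space ht hx hy).symm⟩⟩
  refine (((h.2 t ht).2.1 x hx).mul_const (w y)).congr_of_eventuallyEq ?_
  filter_upwards [isOpen_ne.mem_nhds hx] with s hs using weightedKernel_apply ht hs hy

theorem continuousOn_weightedKernel (hG : IsSectorKernel T β G a p A B) (hθ : θ ∈ Icc 0 β)
    (hw : Continuous w) {t x : ℝ} (ht : t ∈ timeInterval T) (hx : x ≠ 0) :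
    ContinuousOn (weightedKernel T θ G w t x) {0}ᶜ := by
  have h1 : ContinuousOn (fun y : ℝ => G t x (Complex.exp (θ * Complex.I) * y) * w y) {0}ᶜ :=
    ((hG.cont t ht x hx).comp (by fun_prop) fun y hy =>
      exp_mul_real_mem_doubleSector hG.angle_lt hθ hy).mul hw.continuousOn
  exact h1.congr fun y hy => weightedKernel_apply ht hx hy

theorem isDominatedFamily (hG : IsSectorKernel T β G a p A B) (hq0 : 0 < q) (hq2 : q < 2)
    (hw : IsWeight q C D ε w) (hθ : θ ∈ Icc 0 β) (hε : 0 < ε + Real.sin (2 * θ)) :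
    IsDominatedFamily T (weightedKernel T θ G w) where
  zero t x y h := weightedKernel_eq_zero h
  ac12 := hG.isAC12_weightedKernel hθ
  cont t ht x hx := hG.continuousOn_weightedKernel hθ hw.continuous ht hx
  integrable t ht x hx := by
    obtain ⟨A', a₀, hA', ha₀, hb⟩ := hG.exists_bounds_on_compact (Q := {(t, x)}) isCompact_singleton
      (by simpa using ⟨ht, hx⟩)
    obtain ⟨K, hK0, hK⟩ := hG.exists_weighted_bounds hq0 hq2 hw hθ hε A' A' hA' hA' ha₀ hA'
    have hm := measurable_of_continuousOn_compl_singleton 0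
      (hG.continuousOn_weightedKernel hθ hw.continuous ht hx)
    refine (integrable_exp_neg_abs.const_mul K).mono' hm.aestronglyMeasurable
      (Eventually.of_forall fun y => ?_)
    by_cases hy : y = 0
    · rw [weightedKernel_eq_zero (Or.inr (Or.inr hy)), norm_zero]; positivity
    · obtain ⟨h1, h2, h3, h4⟩ := hb t x rfl
      rw [weightedKernel_apply ht hx hy]
      exact (hK t ht x hx h3 h4 h2 (h1 0).1 (h1 0).2 y hy).1
  bound_time x hx c hc d hd hcd := by
    have hsub : Icc c d ⊆ timeInterval T := (ordConnected_timeInterval T).out hc hd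
    obtain ⟨A', a₀, hA', ha₀, hb⟩ := hG.exists_bounds_on_compact (Q := Icc c d ×ˢ {x})
      (isCompact_Icc.prod isCompact_singleton)
      (prod_mono hsub (by simpa using hx.symm))
    obtain ⟨K, hK0, hK⟩ := hG.exists_weighted_bounds hq0 hq2 hw hθ hε A' A' hA' hA' ha₀ hA'
    -- The time majorant is integrable on `[c, d]` because `a` is absolutely continuous.
    refine ⟨fun s => |deriv a s| + 1, fun y => K * Real.exp (-|y|), ?_,
      integrable_exp_neg_abs.const_mul K, ?_⟩
    · have h1 := (hG.a_ac.locallyIntegrableOn_deriv (isOpen_timeInterval T)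
        (ordConnected_timeInterval T)).integrableOn_compact_subset hsub isCompact_Icc
      exact h1.abs.add (integrableOn_const (by simp))
    · filter_upwards [hG.a_ac.ae_differentiableAt (isOpen_timeInterval T)
        (ordConnected_timeInterval T)] with s hs hsI y
      by_cases hy : y = 0
      · simp_rw [fun s => weightedKernel_eq_zero (T := T) (θ := θ) (G := G) (w := w) (t := s) (x := x)
          (Or.inr (Or.inr hy))]
        rw [deriv_const, norm_zero]; positivity
      · obtain ⟨h1, h2, h3, h4⟩ := hb s x ⟨hsI, rfl⟩
        rw [deriv_weightedKernel_time (hsub hsI) hx hy]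
        exact ((hK s (hsub hsI) x hx h3 h4 h2 (h1 0).1 (h1 0).2 y hy).2.2 h1).2 (hs (hsub hsI))
  bound_space t ht c d hcd h0 := by
    obtain ⟨A', a₀, hA', ha₀, hb⟩ := hG.exists_bounds_on_compact (Q := {t} ×ˢ Icc c d)
      (isCompact_singleton.prod isCompact_Icc)
      (prod_mono (by simpa using ht) (subset_compl_zero h0))
    obtain ⟨K, hK0, hK⟩ := hG.exists_weighted_bounds hq0 hq2 hw hθ hε A' A' hA' hA' ha₀ hA'
    refine ⟨fun y => K * Real.exp (-|y|), integrable_exp_neg_abs.const_mul K, fun x hxI y => ?_⟩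
    have hx : x ≠ 0 := subset_compl_zero h0 hxI
    by_cases hy : y = 0
    · simp_rw [fun x => weightedKernel_eq_zero (T := T) (θ := θ) (G := G) (w := w) (t := t) (x := x)
        (Or.inr (Or.inr hy))]
      simp only [deriv_const', norm_zero]
      constructor <;> positivity
    · obtain ⟨h1, h2, h3, h4⟩ := hb t x ⟨rfl, hxI⟩
      rw [deriv_weightedKernel_space ht hx hy, deriv_deriv_weightedKernel_space ht hx hy]
      have := (hK t ht x hx h3 h4 h2 (h1 0).1 (h1 0).2 y hy).2
      exact ⟨this.1 (h1 1).1 (h1 1).2, (this.2 h1).1⟩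

theorem solvesSchroedinger_weightedKernel (hG : IsSectorKernel T β G a p A B) (hθ : θ ∈ Icc 0 β)
    {V : ℝ → ℝ → ℂ} (hV : ∀ z ∈ doubleSector β, SolvesSchroedinger T V fun t x => G t x z) (y : ℝ) :
    SolvesSchroedinger T V fun t x => weightedKernel T θ G w t x y := by
  by_cases hy : y = 0
  · simp_rw [fun t x => weightedKernel_eq_zero (T := T) (θ := θ) (G := G) (w := w) (t := t) (x := x)
      (Or.inr (Or.inr hy))]
    exact Eventually.of_forall fun p _ _ => by simp
  unfold SolvesSchroedinger
  filter_upwards [hV _ (exp_mul_real_mem_doubleSector hG.angle_lt hθ hy)] with r hr ht hx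
  rw [deriv_weightedKernel_time ht hx hy, deriv_deriv_weightedKernel_space ht hx hy,
    weightedKernel_apply ht hx hy, ← mul_assoc, hr ht hx]
  ring

end IsSectorKernel

end

/-! ### Damped integrands and the shift of the contour -/

noncomputable section

/-- The damped function `exp(-ε z²) F(z)`. -/
def damped (ε : ℝ) (F : ℂ → ℂ) (z : ℂ) : ℂ := Complex.exp (-(ε * z ^ 2)) * F z

theorem damped_zero (F : ℂ → ℂ) : damped 0 F = F := by
  funext z; simp [damped]

theorem norm_damped (ε : ℝ) (F : ℂ → ℂ) (z : ℂ) :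
    ‖damped ε F z‖ = Real.exp (-(ε * (z ^ 2).re)) * ‖F z‖ := by
  rw [damped, norm_mul, Complex.norm_exp]
  congr 2
  rw [Complex.neg_re, Complex.re_ofReal_mul]

theorem differentiable_damped {F : ℂ → ℂ} (hF : Differentiable ℂ F) (ε : ℝ) :
    Differentiable ℂ (damped ε F) :=
  (((differentiable_id.pow 2).const_mul (ε : ℂ)).neg.cexp).mul hF

theorem norm_damped_le {ε : ℝ} (hε : 0 ≤ ε) (F : ℂ → ℂ) {z : ℂ} (hz : 0 ≤ (z ^ 2).re) :
    ‖damped ε F z‖ ≤ ‖F z‖ := by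
  rw [norm_damped]
  refine mul_le_of_le_one_left (norm_nonneg _) (Real.exp_le_one_iff.2 ?_)
  have := mul_nonneg hε hz; linarith

theorem tendsto_damped (F : ℂ → ℂ) (z : ℂ) :
    Tendsto (fun ε : ℝ => damped ε F z) (𝓝[>] 0) (𝓝 (F z)) := by
  have h : Continuous fun ε : ℝ => damped ε F z := by unfold damped; fun_prop
  have := h.tendsto 0
  rw [damped_zero] at this
  exact this.mono_left nhdsWithin_le_nhds

/-- An entire function with `‖F z‖ ≤ C exp(D ‖z‖^q)`. -/
structure HasExpGrowth (q C D : ℝ) (F : ℂ → ℂ) : Prop where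
  differentiable : Differentiable ℂ F
  const_nonneg : 0 ≤ C
  rate_nonneg : 0 ≤ D
  bound : ∀ z, ‖F z‖ ≤ C * Real.exp (D * ‖z‖ ^ q)

theorem re_sq_exp_mul (θ y : ℝ) :
    ((Complex.exp (θ * Complex.I) * y) ^ 2).re = Real.cos (2 * θ) * y ^ 2 := by
  have h : (Complex.exp (θ * Complex.I) * y) ^ 2 =
      Complex.exp ((2 * θ : ℝ) * Complex.I) * ((y ^ 2 : ℝ) : ℂ) := by
    rw [mul_pow, ← Complex.exp_nat_mul]; push_cast; ring_nf
  rw [h, Complex.re_mul_ofReal, Complex.exp_ofReal_mul_I_re]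

/-- The weight `e^{iθ} exp(-ε z²) F(z)` at the point `z = e^{iθ} y` of a rotated line. -/
def rayWeight (θ ε : ℝ) (F : ℂ → ℂ) (y : ℝ) : ℂ :=
  Complex.exp (θ * Complex.I) * damped ε F (Complex.exp (θ * Complex.I) * y)

theorem norm_rayWeight (θ ε : ℝ) (F : ℂ → ℂ) (y : ℝ) :
    ‖rayWeight θ ε F y‖ = ‖damped ε F (Complex.exp (θ * Complex.I) * y)‖ := by
  rw [rayWeight, norm_mul, Complex.norm_exp_ofReal_mul_I, one_mul]

theorem continuous_rayWeight {F : ℂ → ℂ} (hF : Differentiable ℂ F) (θ ε : ℝ) :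
    Continuous (rayWeight θ ε F) :=
  continuous_const.mul ((differentiable_damped hF ε).continuous.comp (by fun_prop))

/-- For `θ ≤ π/4` the damping is at most one and is discarded, which makes the bound independent of
`ε`. On the real line, by contrast, `HasExpGrowth.isWeight_real` keeps it as the only source of
decay. -/
theorem HasExpGrowth.isWeight_ray {q C D : ℝ} {F : ℂ → ℂ} (hF : HasExpGrowth q C D F) {θ ε : ℝ}
    (hθ0 : 0 ≤ θ) (hθ : θ ≤ Real.pi / 4) (hε : 0 ≤ ε) :
    IsWeight q C D 0 (rayWeight θ ε F) where
  continuous := continuous_rayWeight hF.differentiable θ ε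
  const_nonneg := hF.const_nonneg
  rate_nonneg := hF.rate_nonneg
  gauss_nonneg := le_rfl
  bound y := by
    rw [norm_rayWeight]
    refine (norm_damped_le hε F ?_).trans ((hF.bound _).trans ?_)
    · rw [re_sq_exp_mul]
      have : 0 ≤ Real.cos (2 * θ) :=
        Real.cos_nonneg_of_mem_Icc ⟨by linarith [Real.pi_pos], by linarith⟩
      positivity
    · rw [norm_exp_mul_I_mul]; simp

theorem HasExpGrowth.isWeight_real {q C D : ℝ} {F : ℂ → ℂ} (hF : HasExpGrowth q C D F) {ε : ℝ}
    (hε : 0 ≤ ε) : IsWeight q C D ε (rayWeight 0 ε F) where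
  continuous := continuous_rayWeight hF.differentiable 0 ε
  const_nonneg := hF.const_nonneg
  rate_nonneg := hF.rate_nonneg
  gauss_nonneg := hε
  bound y := by
    rw [norm_rayWeight, norm_damped, re_sq_exp_mul]
    have h2 := hF.bound (Complex.exp ((0 : ℝ) * Complex.I) * y)
    rw [norm_exp_mul_I_mul] at h2
    simp only [mul_zero, Real.cos_zero, one_mul]
    calc _ ≤ Real.exp (-(ε * y ^ 2)) * (C * Real.exp (D * |y| ^ q)) :=
          mul_le_mul_of_nonneg_left h2 (Real.exp_pos _).le
      _ = _ := by rw [mul_left_comm, ← Real.exp_add]; congr 2; ring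

section Contour

variable {T : EReal} {β : ℝ} {G : ℝ → ℝ → ℂ → ℂ} {a : ℝ → ℝ} {p : ℝ} {A B : Fin 3 → ℝ → ℝ → ℝ}
  {q C D : ℝ} {F : ℂ → ℂ} {t x : ℝ}

/-- The sign `σ = ±1` treats the two half lines together: the double sector is symmetric under `z ↦
-z`, and the modulus of the phase feels `σ` only through `σ x`. -/
theorem sign_mul_add_exp_mem (hβ : β < Real.pi / 2) {σ x₀ : ℝ} (hσ : σ = 1 ∨ σ = -1) (hx₀ : 0 ≤ x₀)
    {w : ℂ} (hw : w.im ∈ Icc 0 β) : (σ : ℂ) * (x₀ + Complex.exp w) ∈ doubleSector β := by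
  rcases hσ with rfl | rfl
  · simpa using (add_exp_mem_doubleSector hβ hx₀ hw).1
  · have := (add_exp_mem_doubleSector hβ hx₀ hw).2
    push_cast; rwa [neg_one_mul]

theorem sign_mul_add_exp_mem_interior (hβ : β < Real.pi / 2) {σ x₀ : ℝ} (hσ : σ = 1 ∨ σ = -1)
    (hx₀ : 0 ≤ x₀) {w : ℂ} (hw : w.im ∈ Ioo 0 β) :
    (σ : ℂ) * (x₀ + Complex.exp w) ∈ interior (doubleSector β) := by
  rcases hσ with rfl | rfl
  · simpa using (add_exp_mem_interior_doubleSector hβ hx₀ hw).1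
  · have := (add_exp_mem_interior_doubleSector hβ hx₀ hw).2
    push_cast; rwa [neg_one_mul]

theorem norm_sign_mul_add_exp_le {σ x₀ : ℝ} (hσ : σ = 1 ∨ σ = -1) (hx₀ : 0 ≤ x₀) (w : ℂ) :
    ‖(σ : ℂ) * (x₀ + Complex.exp w)‖ ≤ x₀ + Real.exp w.re := by
  have h1 : ‖(σ : ℂ)‖ = 1 := by rcases hσ with rfl | rfl <;> simp
  rw [norm_mul, h1, one_mul]
  refine (norm_add_le _ _).trans ?_
  rw [Complex.norm_exp, Complex.norm_real, Real.norm_of_nonneg hx₀]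

theorem phase_exponent_sign_mul {σ x₀ : ℝ} (hσ : σ = 1 ∨ σ = -1) (u : ℂ) :
    (((σ : ℂ) * (x₀ + u)).re - x) * ((σ : ℂ) * (x₀ + u)).im = (x₀ + u.re - σ * x) * u.im := by
  rcases hσ with rfl | rfl
  · simp
  · simp; ring

theorem re_sq_sign_mul {σ x₀ : ℝ} (hσ : σ = 1 ∨ σ = -1) (u : ℂ) :
    (((σ : ℂ) * (x₀ + u)) ^ 2).re = (x₀ + u.re) ^ 2 - u.im ^ 2 := by
  have : ((σ : ℂ) * (x₀ + u)) ^ 2 = (x₀ + u) ^ 2 := by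
    rcases hσ with rfl | rfl
    · simp
    · push_cast; ring
  rw [this]; simp [pow_two]

/-- With `u = R + i J`, the phase contributes `2 a R J` and the damping `ε (R² - J²)`. Since `2 R J
+ R² - J² ≥ R² + J²` for `0 ≤ J ≤ R`, together they give `m r²` with `m ≤ min(a, ε)`. At `J = 0` the
decay comes from the damping, at `J = R` from the phase. Here `b` stands for `σ x` and `c` for
`|x|`. -/
theorem gaussian_exponent_le {m a ε x₀ b R J r c : ℝ} (hma : m ≤ a) (hmε : m ≤ ε) (hm : 0 ≤ m)
    (hx₀ : 0 ≤ x₀) (hJ : 0 ≤ J) (hJR : J ≤ R) (hr : R ^ 2 + J ^ 2 = r ^ 2) (hb : b * J ≤ c * r) :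
    m * r ^ 2 - 2 * a * c * r ≤ a * (2 * ((x₀ + R - b) * J)) + ε * ((x₀ + R) ^ 2 - J ^ 2) := by
  have hR : 0 ≤ R := hJ.trans hJR
  have ha : 0 ≤ a := hm.trans hma
  have hε : 0 ≤ ε := hm.trans hmε
  have hsq : 0 ≤ R ^ 2 - J ^ 2 := sub_nonneg.2 (pow_le_pow_left₀ hJ hJR 2)
  have e1 : m * (2 * (R * J)) ≤ a * (2 * (R * J)) := mul_le_mul_of_nonneg_right hma (by positivity)
  have e2 : m * (R ^ 2 - J ^ 2) ≤ ε * (R ^ 2 - J ^ 2) := mul_le_mul_of_nonneg_right hmε hsq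
  have e3 : 0 ≤ m * (J * (R - J)) := mul_nonneg hm (mul_nonneg hJ (sub_nonneg.2 hJR))
  have e4 : a * (b * J) ≤ a * (c * r) := mul_le_mul_of_nonneg_left hb ha
  have e5 : 0 ≤ a * (x₀ * J) := by positivity
  have e6 : 0 ≤ ε * (x₀ ^ 2 + 2 * (x₀ * R)) := by positivity
  rw [← hr]
  linarith

/-- Decay in the whole closed sector, as needed to rotate the contour. The constant may depend on
`ε`, because it only justifies an identity. -/
theorem IsSectorKernel.norm_mul_damped_le (hG : IsSectorKernel T β G a p A B) (hq0 : 0 < q)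
    (hq2 : q < 2) (hF : HasExpGrowth q C D F) (ht : t ∈ timeInterval T) (hx : x ≠ 0)
    {σ x₀ ε : ℝ} (hσ : σ = 1 ∨ σ = -1) (hx₀ : 0 ≤ x₀) (hε : 0 < ε) :
    ∃ K : ℝ, ∀ w : ℂ, w.im ∈ Icc 0 β →
      ‖G t x (σ * (x₀ + Complex.exp w)) * damped ε F (σ * (x₀ + Complex.exp w))‖ ≤
        K * Real.exp (-Real.exp w.re) := by
  have hat := hG.a_pos t ht
  have hnn := hG.nonneg 0 t ht x hx
  set m := min (a t) ε with hm
  have hmpos : 0 < m := lt_min hat hε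
  obtain ⟨K, hK⟩ := exists_exponent_le (X := x₀) hG.p_pos hG.p_lt hq0 hq2 (2 * a t * |x|)
    hnn.2 hF.rate_nonneg hmpos
  refine ⟨A 0 t x * C * Real.exp K, fun w hw => ?_⟩
  set u := Complex.exp w with hu
  set z := (σ : ℂ) * (x₀ + u) with hz
  have hzm : z ∈ doubleSector β := sign_mul_add_exp_mem hG.angle_lt hσ hx₀ hw
  have hρ : ‖z‖ ≤ x₀ + Real.exp w.re := norm_sign_mul_add_exp_le hσ hx₀ w
  have hure : u.re = Real.exp w.re * Real.cos w.im := (exp_re_im w).1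
  have huim : u.im = Real.exp w.re * Real.sin w.im := (exp_re_im w).2
  set r := Real.exp w.re with hr
  have hrpos : 0 < r := Real.exp_pos _
  have hw2 : w.im ≤ Real.pi / 4 := hw.2.trans hG.angle_le
  have hs0 : 0 ≤ Real.sin w.im :=
    Real.sin_nonneg_of_nonneg_of_le_pi hw.1 (by linarith [Real.pi_pos])
  have hcs : Real.sin w.im ≤ Real.cos w.im := by
    rw [← Real.cos_pi_div_two_sub]
    exact Real.cos_le_cos_of_nonneg_of_le_pi hw.1 (by linarith [Real.pi_pos, hw.1])
      (by linarith)
  have hi0 : 0 ≤ u.im := by rw [huim]; positivity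
  have hir : u.im ≤ u.re := by
    rw [hure, huim]; exact mul_le_mul_of_nonneg_left hcs hrpos.le
  have hr2 : u.re ^ 2 + u.im ^ 2 = r ^ 2 := by
    rw [hure, huim]
    have := Real.sin_sq_add_cos_sq w.im
    calc _ = r ^ 2 * (Real.sin w.im ^ 2 + Real.cos w.im ^ 2) := by ring
      _ = _ := by rw [this, mul_one]
  have hir' : u.im ≤ r := by
    rw [huim]; exact mul_le_of_le_one_right hrpos.le (Real.sin_le_one _)
  have h1 := hG.norm_le ht hx hzm le_rfl le_rfl
  have h2 := hF.bound z
  rw [norm_mul, norm_damped]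
  have hph : ‖phase (a t) x z‖ = Real.exp (-(a t * (2 * ((x₀ + u.re - σ * x) * u.im)))) := by
    rw [norm_phase, ← phase_exponent_sign_mul hσ u, mul_assoc]
  have hsq : (z ^ 2).re = (x₀ + u.re) ^ 2 - u.im ^ 2 := re_sq_sign_mul hσ u
  rw [hph] at h1
  rw [hsq]
  have hxu : σ * x * u.im ≤ |x| * r := by
    have hσx : σ * x ≤ |x| := by
      rcases hσ with rfl | rfl
      · simpa using le_abs_self x
      · simpa using neg_le_abs x
    exact mul_le_mul hσx hir' hi0 (abs_nonneg x)
  have hexp : A 0 t x * (Real.exp (B 0 t x * ‖z‖ ^ p) *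
      Real.exp (-(a t * (2 * ((x₀ + u.re - σ * x) * u.im))))) *
      (Real.exp (-(ε * ((x₀ + u.re) ^ 2 - u.im ^ 2))) * (C * Real.exp (D * ‖z‖ ^ q))) =
      A 0 t x * C * Real.exp (B 0 t x * ‖z‖ ^ p + D * ‖z‖ ^ q -
        a t * (2 * ((x₀ + u.re - σ * x) * u.im)) - ε * ((x₀ + u.re) ^ 2 - u.im ^ 2)) := by
    rw [show B 0 t x * ‖z‖ ^ p + D * ‖z‖ ^ q -
        a t * (2 * ((x₀ + u.re - σ * x) * u.im)) - ε * ((x₀ + u.re) ^ 2 - u.im ^ 2) =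
        B 0 t x * ‖z‖ ^ p + -(a t * (2 * ((x₀ + u.re - σ * x) * u.im))) +
        -(ε * ((x₀ + u.re) ^ 2 - u.im ^ 2)) + D * ‖z‖ ^ q by ring, Real.exp_add, Real.exp_add,
        Real.exp_add]
    ring
  have hk := hK r ‖z‖ hrpos.le (norm_nonneg z) hρ
  have hquad := gaussian_exponent_le (min_le_left (a t) ε) (min_le_right (a t) ε) hmpos.le hx₀ hi0
    hir hr2 hxu
  have hfin : B 0 t x * ‖z‖ ^ p + D * ‖z‖ ^ q -
        a t * (2 * ((x₀ + u.re - σ * x) * u.im)) - ε * ((x₀ + u.re) ^ 2 - u.im ^ 2) ≤ K - r := by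
    linarith
  calc _ ≤ A 0 t x * (Real.exp (B 0 t x * ‖z‖ ^ p) *
      Real.exp (-(a t * (2 * ((x₀ + u.re - σ * x) * u.im))))) *
      (Real.exp (-(ε * ((x₀ + u.re) ^ 2 - u.im ^ 2))) * (C * Real.exp (D * ‖z‖ ^ q))) := by
        refine mul_le_mul h1 (mul_le_mul_of_nonneg_left h2 (Real.exp_pos _).le) (by positivity) ?_
        have := hnn.1
        positivity
    _ ≤ A 0 t x * C * Real.exp (K - r) := by
        rw [hexp]
        exact mul_le_mul_of_nonneg_left (Real.exp_le_exp.2 hfin) (mul_nonneg hnn.1 hF.const_nonneg)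
    _ = _ := by rw [sub_eq_add_neg, Real.exp_add]; ring

/-- The integrals over the half lines `±(x₀, ∞)` may be taken over rays rotated about `±x₀`. -/
theorem IsSectorKernel.integral_Ioi_rotated (hG : IsSectorKernel T β G a p A B) (hq0 : 0 < q)
    (hq2 : q < 2) (hF : HasExpGrowth q C D F) (ht : t ∈ timeInterval T) (hx : x ≠ 0)
    {σ x₀ ε : ℝ} (hσ : σ = 1 ∨ σ = -1) (hx₀ : 0 ≤ x₀) (hε : 0 < ε) :
    ∫ y in Ioi (0 : ℝ), G t x (σ * (x₀ + y)) * damped ε F (σ * (x₀ + y)) =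
      Complex.exp (β * Complex.I) * ∫ s in Ioi (0 : ℝ),
        G t x (σ * (x₀ + Complex.exp (β * Complex.I) * s)) *
          damped ε F (σ * (x₀ + Complex.exp (β * Complex.I) * s)) := by
  obtain ⟨K, hK⟩ := hG.norm_mul_damped_le hq0 hq2 hF ht hx hσ hx₀ hε
  have hd := differentiable_damped hF.differentiable ε
  refine integral_Ioi_eq_integral_rotated hG.angle_pos
    (f := fun u => G t x (σ * (x₀ + u)) * damped ε F (σ * (x₀ + u))) ?_ ?_ hK
  · refine ContinuousOn.mul ((hG.cont t ht x hx).comp (by fun_prop) fun w hw =>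
      sign_mul_add_exp_mem hG.angle_lt hσ hx₀ hw) ?_
    exact (hd.continuous.comp (by fun_prop)).continuousOn
  · refine DifferentiableOn.mul ((hG.holo t ht x hx).comp (t := interior (doubleSector β)) ?_ fun w hw =>
      sign_mul_add_exp_mem_interior hG.angle_lt hσ hx₀ hw) ?_
    · exact (((Complex.differentiable_exp.const_add _)).const_mul _).differentiableOn
    · exact (hd.comp ((Complex.differentiable_exp.const_add _).const_mul _)).differentiableOn

end Contour

end

/-! ### The integral along the rotated line and the limit of vanishing damping -/

noncomputable section

theorem setIntegral_Ioi_comp_add_left (f : ℝ → ℂ) (x₀ : ℝ) :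
    ∫ y in Ioi (0 : ℝ), f (x₀ + y) = ∫ y in Ioi x₀, f y := by
  have h := (measurePreserving_add_left (volume : Measure ℝ) x₀).setIntegral_preimage_emb
    (MeasurableEquiv.addLeft x₀).measurableEmbedding f (Ioi x₀)
  have hpre : (fun y => x₀ + y) ⁻¹' Ioi x₀ = Ioi 0 := by ext y; simp
  rwa [hpre] at h

theorem integral_eq_intervalIntegral_add_tails {f : ℝ → ℂ} (hf : Integrable f) (x₀ : ℝ) :
    ∫ y, f y = (∫ y in (-x₀)..x₀, f y) + (∫ y in Ioi (0 : ℝ), f (x₀ + y)) +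
      ∫ y in Ioi (0 : ℝ), f (-(x₀ + y)) := by
  rw [setIntegral_Ioi_comp_add_left f x₀, setIntegral_Ioi_comp_add_left (fun y => f (-y)) x₀,
    integral_comp_neg_Ioi,
    intervalIntegral.integral_interval_add_Ioi hf.integrableOn hf.integrableOn, add_comm,
    intervalIntegral.integral_Iic_add_Ioi hf.integrableOn hf.integrableOn]

/-- The integral `∫ G(t,x,z) exp(-ε z²) F(z) dz` along the rotated line `z = e^{iθ} y`. -/
def rayWave (T : EReal) (θ : ℝ) (G : ℝ → ℝ → ℂ → ℂ) (F : ℂ → ℂ) (ε t x : ℝ) : ℂ :=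
  ∫ y, weightedKernel T θ G (rayWeight θ ε F) t x y

/-- The mass removed by the damping factor `exp(-ε z²)` on the rotated line. -/
def dampingError (β ε : ℝ) : ℝ :=
  ∫ y : ℝ, ‖Complex.exp (-(ε * (Complex.exp (β * Complex.I) * y) ^ 2)) - 1‖ * Real.exp (-|y|)

theorem norm_damping_sub_one_le {β ε : ℝ} (hβ0 : 0 ≤ β) (hβ : β ≤ Real.pi / 4) (hε : 0 ≤ ε) (y : ℝ) :
    ‖Complex.exp (-(ε * (Complex.exp (β * Complex.I) * y) ^ 2)) - 1‖ ≤ 2 := by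
  refine (norm_sub_le _ _).trans ?_
  rw [Complex.norm_exp, norm_one, Complex.neg_re, Complex.re_ofReal_mul, re_sq_exp_mul]
  have h1 : 0 ≤ Real.cos (2 * β) :=
    Real.cos_nonneg_of_mem_Icc ⟨by linarith [Real.pi_pos], by linarith⟩
  have h2 : Real.exp (-(ε * (Real.cos (2 * β) * y ^ 2))) ≤ 1 :=
    Real.exp_le_one_iff.2 (by
      have : 0 ≤ ε * (Real.cos (2 * β) * y ^ 2) := by positivity
      linarith)
  linarith

theorem integrable_dampingError {β ε : ℝ} (hβ0 : 0 ≤ β) (hβ : β ≤ Real.pi / 4) (hε : 0 ≤ ε) :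
    Integrable fun y : ℝ =>
      ‖Complex.exp (-(ε * (Complex.exp (β * Complex.I) * y) ^ 2)) - 1‖ * Real.exp (-|y|) := by
  refine (integrable_exp_neg_abs.const_mul 2).mono' ?_ (Eventually.of_forall fun y => ?_)
  · exact Continuous.aestronglyMeasurable (by fun_prop)
  · rw [norm_mul, norm_norm, Real.norm_of_nonneg (Real.exp_pos _).le]
    exact mul_le_mul_of_nonneg_right (norm_damping_sub_one_le hβ0 hβ hε y) (Real.exp_pos _).le

theorem tendsto_dampingError {β : ℝ} (hβ0 : 0 ≤ β) (hβ : β ≤ Real.pi / 4) :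
    Tendsto (dampingError β) (𝓝[>] 0) (𝓝 0) := by
  suffices h : Tendsto (dampingError β) (𝓝[>] 0) (𝓝 (∫ _ : ℝ, (0 : ℝ))) by simpa using h
  refine tendsto_integral_filter_of_dominated_convergence (fun y => 2 * Real.exp (-|y|)) ?_ ?_
    (integrable_exp_neg_abs.const_mul 2) (Eventually.of_forall fun y => ?_)
  · exact Eventually.of_forall fun ε => Continuous.aestronglyMeasurable (by fun_prop)
  · filter_upwards [self_mem_nhdsWithin] with ε hε
    refine Eventually.of_forall fun y => ?_
    rw [norm_mul, norm_norm, Real.norm_of_nonneg (Real.exp_pos _).le]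
    exact mul_le_mul_of_nonneg_right (norm_damping_sub_one_le hβ0 hβ (le_of_lt hε) y)
      (Real.exp_pos _).le
  · have h : Continuous fun ε : ℝ =>
        ‖Complex.exp (-(ε * (Complex.exp (β * Complex.I) * y) ^ 2)) - 1‖ * Real.exp (-|y|) := by
      fun_prop
    have := h.tendsto 0
    simp only [Complex.ofReal_zero, zero_mul, neg_zero, Complex.exp_zero, sub_self, norm_zero] at this
    exact this.mono_left nhdsWithin_le_nhds

/-- The damped integrand differs from the undamped one by the factor `exp(-ε z²) - 1`. The kernel
enters the estimate only through `K`, so the limit `ε → 0` is uniform wherever `K` is. -/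
theorem norm_integral_damped_sub_le {β ε K : ℝ} (hβ0 : 0 ≤ β) (hβ : β ≤ Real.pi / 4) (hε : 0 ≤ ε)
    {F : ℂ → ℂ} {k : ℝ → ℂ}
    (hi : Integrable fun y => k y * rayWeight β ε F y) (hi0 : Integrable fun y => k y * rayWeight β 0 F y)
    (hK : ∀ᵐ y : ℝ, ‖k y * rayWeight β 0 F y‖ ≤ K * Real.exp (-|y|)) :
    ‖(∫ y, k y * rayWeight β ε F y) - ∫ y, k y * rayWeight β 0 F y‖ ≤ K * dampingError β ε := by
  rw [← integral_sub hi hi0, dampingError, ← integral_const_mul]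
  refine norm_integral_le_of_norm_le ((integrable_dampingError hβ0 hβ hε).const_mul K) ?_
  filter_upwards [hK] with y hy
  have h : k y * rayWeight β ε F y - k y * rayWeight β 0 F y =
      (Complex.exp (-(ε * (Complex.exp (β * Complex.I) * y) ^ 2)) - 1) * (k y * rayWeight β 0 F y) := by
    simp only [rayWeight, damped_zero]; rw [damped]; ring
  rw [h, norm_mul]
  calc _ ≤ ‖Complex.exp (-(ε * (Complex.exp (β * Complex.I) * y) ^ 2)) - 1‖ * (K * Real.exp (-|y|)) :=
        mul_le_mul_of_nonneg_left hy (norm_nonneg _)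
    _ = _ := by ring

theorem rayWeight_zero_angle (ε : ℝ) (F : ℂ → ℂ) (y : ℝ) : rayWeight 0 ε F y = damped ε F y := by
  simp [rayWeight]

namespace IsSectorKernel

variable {T : EReal} {β : ℝ} {G : ℝ → ℝ → ℂ → ℂ} {a : ℝ → ℝ} {p : ℝ} {A B : Fin 3 → ℝ → ℝ → ℝ}
  {q C D : ℝ} {F : ℂ → ℂ} {t x ε : ℝ}

theorem sin_two_mul_angle_pos (hG : IsSectorKernel T β G a p A B) : 0 < Real.sin (2 * β) :=
  Real.sin_pos_of_pos_of_lt_pi (by linarith [hG.angle_pos]) (by linarith [hG.angle_le, Real.pi_pos])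

theorem isDominatedFamily_ray (hG : IsSectorKernel T β G a p A B) (hq0 : 0 < q) (hq2 : q < 2)
    (hF : HasExpGrowth q C D F) (hε : 0 ≤ ε) :
    IsDominatedFamily T (weightedKernel T β G (rayWeight β ε F)) :=
  hG.isDominatedFamily hq0 hq2 (hF.isWeight_ray hG.angle_pos.le hG.angle_le hε)
    ⟨hG.angle_pos.le, le_rfl⟩ (by linarith [hG.sin_two_mul_angle_pos])

theorem isDominatedFamily_real (hG : IsSectorKernel T β G a p A B) (hq0 : 0 < q) (hq2 : q < 2)
    (hF : HasExpGrowth q C D F) (hε : 0 < ε) :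
    IsDominatedFamily T (weightedKernel T 0 G (rayWeight 0 ε F)) :=
  hG.isDominatedFamily hq0 hq2 (hF.isWeight_real hε.le) ⟨le_rfl, hG.angle_pos.le⟩ (by simpa using hε)

/-- The integral of `G(t,x,z) exp(-ε z²) F(z)` along the ray `z = σ (x₀ + e^{iβ} s)`, `s > 0`. -/
def _root_.Supershift.tailIntegral (β : ℝ) (G : ℝ → ℝ → ℂ → ℂ) (F : ℂ → ℂ) (σ x₀ ε t x : ℝ) : ℂ :=
  Complex.exp (β * Complex.I) * ∫ s in Ioi (0 : ℝ),
    G t x (σ * (x₀ + Complex.exp (β * Complex.I) * s)) *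
      damped ε F (σ * (x₀ + Complex.exp (β * Complex.I) * s))

/-- The segment `[-x₀, x₀]` stays real and only the tails are rotated, about `±x₀`. With `x₀ = 0`
this is the rotation of the whole line; with `x₀ > |x|` it serves the initial condition. -/
theorem rayWave_zero_angle_eq (hG : IsSectorKernel T β G a p A B) (hq0 : 0 < q) (hq2 : q < 2)
    (hF : HasExpGrowth q C D F) (ht : t ∈ timeInterval T) (hx : x ≠ 0) (hε : 0 < ε)
    {x₀ : ℝ} (hx₀ : 0 ≤ x₀) :
    rayWave T 0 G F ε t x = (∫ y in (-x₀)..x₀, G t x y * damped ε F y) +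
      tailIntegral β G F 1 x₀ ε t x + tailIntegral β G F (-1) x₀ ε t x := by
  have hk : ∀ y : ℝ, y ≠ 0 → weightedKernel T 0 G (rayWeight 0 ε F) t x y =
      G t x y * damped ε F y := by
    intro y hy
    rw [weightedKernel_apply ht hx hy, rayWeight_zero_angle]; simp
  rw [rayWave, integral_eq_intervalIntegral_add_tails
    ((hG.isDominatedFamily_real hq0 hq2 hF hε).integrable t ht x hx) x₀]
  congr 1
  · congr 1
    · refine intervalIntegral.integral_congr_ae ?_
      filter_upwards [compl_mem_ae_iff.2 (measure_singleton (0 : ℝ))] with y hy _ using hk y hy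
    · rw [tailIntegral, ← hG.integral_Ioi_rotated hq0 hq2 hF ht hx (Or.inl rfl) hx₀ hε]
      refine setIntegral_congr_fun measurableSet_Ioi fun y hy => ?_
      rw [hk _ (by have : (0 : ℝ) < y := hy; positivity)]
      push_cast; simp
  · rw [tailIntegral, ← hG.integral_Ioi_rotated hq0 hq2 hF ht hx (Or.inr rfl) hx₀ hε]
    refine setIntegral_congr_fun measurableSet_Ioi fun y hy => ?_
    rw [hk _ (neg_ne_zero.2 (by have : (0 : ℝ) < y := hy; positivity))]
    push_cast; simp

theorem rayWave_eq_tailIntegral (hG : IsSectorKernel T β G a p A B) (hq0 : 0 < q) (hq2 : q < 2)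
    (hF : HasExpGrowth q C D F) (ht : t ∈ timeInterval T) (hx : x ≠ 0) (hε : 0 ≤ ε) :
    rayWave T β G F ε t x = tailIntegral β G F 1 0 ε t x + tailIntegral β G F (-1) 0 ε t x := by
  rw [rayWave, integral_eq_intervalIntegral_add_tails
    ((hG.isDominatedFamily_ray hq0 hq2 hF hε).integrable t ht x hx) 0, neg_zero,
    intervalIntegral.integral_same, zero_add]
  congr 1
  · rw [tailIntegral, ← integral_const_mul]
    refine setIntegral_congr_fun measurableSet_Ioi fun y hy => ?_
    rw [weightedKernel_apply ht hx (by have : (0 : ℝ) < y := hy; positivity), rayWeight]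
    push_cast; simp only [zero_add, one_mul]; ring
  · rw [tailIntegral, ← integral_const_mul]
    refine setIntegral_congr_fun measurableSet_Ioi fun y hy => ?_
    rw [weightedKernel_apply ht hx (neg_ne_zero.2 (by have : (0 : ℝ) < y := hy; positivity)), rayWeight]
    push_cast; simp only [zero_add, neg_one_mul, mul_neg]; ring

theorem rayWave_zero_angle_eq_rayWave (hG : IsSectorKernel T β G a p A B) (hq0 : 0 < q) (hq2 : q < 2)
    (hF : HasExpGrowth q C D F) (ht : t ∈ timeInterval T) (hx : x ≠ 0) (hε : 0 < ε) :
    rayWave T 0 G F ε t x = rayWave T β G F ε t x := by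
  rw [hG.rayWave_zero_angle_eq hq0 hq2 hF ht hx hε le_rfl,
    hG.rayWave_eq_tailIntegral hq0 hq2 hF ht hx hε.le, neg_zero, intervalIntegral.integral_same,
    zero_add]

theorem rayWave_eq_integral (ht : t ∈ timeInterval T) (hx : x ≠ 0) (θ : ℝ) :
    rayWave T θ G F ε t x =
      ∫ y : ℝ, G t x (Complex.exp (θ * Complex.I) * y) * rayWeight θ ε F y := by
  refine integral_congr_ae ?_
  filter_upwards [compl_mem_ae_iff.2 (measure_singleton (0 : ℝ))] with y hy
    using weightedKernel_apply ht hx hy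

theorem integrable_ray (hG : IsSectorKernel T β G a p A B) (hq0 : 0 < q) (hq2 : q < 2)
    (hF : HasExpGrowth q C D F) (ht : t ∈ timeInterval T) (hx : x ≠ 0) (hε : 0 ≤ ε) :
    Integrable fun y : ℝ => G t x (Complex.exp (β * Complex.I) * y) * rayWeight β ε F y := by
  refine ((hG.isDominatedFamily_ray hq0 hq2 hF hε).integrable t ht x hx).congr ?_
  filter_upwards [compl_mem_ae_iff.2 (measure_singleton (0 : ℝ))] with y hy
    using weightedKernel_apply ht hx hy

theorem norm_rayWave_sub_le (hG : IsSectorKernel T β G a p A B) (hq0 : 0 < q) (hq2 : q < 2)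
    (hF : HasExpGrowth q C D F) (ht : t ∈ timeInterval T) (hx : x ≠ 0) (hε : 0 ≤ ε) {K : ℝ}
    (hK : ∀ y : ℝ, y ≠ 0 →
      ‖G t x (Complex.exp (β * Complex.I) * y) * rayWeight β 0 F y‖ ≤ K * Real.exp (-|y|)) :
    ‖rayWave T β G F ε t x - rayWave T β G F 0 t x‖ ≤ K * dampingError β ε := by
  rw [rayWave_eq_integral ht hx, rayWave_eq_integral ht hx]
  refine norm_integral_damped_sub_le hG.angle_pos.le hG.angle_le hε
    (hG.integrable_ray hq0 hq2 hF ht hx hε) (hG.integrable_ray hq0 hq2 hF ht hx le_rfl) ?_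
  filter_upwards [compl_mem_ae_iff.2 (measure_singleton (0 : ℝ))] with y hy using hK y hy

theorem exists_ray_bound {w : ℝ → ℂ} (hG : IsSectorKernel T β G a p A B) (hq0 : 0 < q) (hq2 : q < 2)
    (hw : IsWeight q C D 0 w) (ht : t ∈ timeInterval T) {S : Set ℝ} (hS : IsCompact S)
    (hS0 : S ⊆ {0}ᶜ) :
    ∃ K : ℝ, 0 ≤ K ∧ ∀ x ∈ S, ∀ y : ℝ, y ≠ 0 →
      ‖G t x (Complex.exp (β * Complex.I) * y) * w y‖ ≤ K * Real.exp (-|y|) := by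
  obtain ⟨A', a₀, hA', ha₀, hb⟩ := hG.exists_bounds_on_compact (Q := {t} ×ˢ S)
    (isCompact_singleton.prod hS) (prod_mono (by simpa using ht) hS0)
  obtain ⟨K, hK0, hK⟩ := hG.exists_weighted_bounds hq0 hq2 hw ⟨hG.angle_pos.le, le_rfl⟩
    (by linarith [hG.sin_two_mul_angle_pos]) A' A' hA' hA' ha₀ hA'
  refine ⟨K, hK0, fun x hx y hy => ?_⟩
  obtain ⟨h1, h2, h3, h4⟩ := hb t x ⟨rfl, hx⟩
  exact (hK t ht x (hS0 hx) h3 h4 h2 (h1 0).1 (h1 0).2 y hy).1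

theorem tendsto_rayWave (hG : IsSectorKernel T β G a p A B) (hq0 : 0 < q) (hq2 : q < 2)
    (hF : HasExpGrowth q C D F) (ht : t ∈ timeInterval T) (hx : x ≠ 0) :
    Tendsto (fun ε => rayWave T β G F ε t x) (𝓝[>] 0) (𝓝 (rayWave T β G F 0 t x)) := by
  obtain ⟨K, hK0, hK⟩ := hG.exists_ray_bound hq0 hq2
    (hF.isWeight_ray (ε := 0) hG.angle_pos.le hG.angle_le le_rfl) ht (S := {x}) isCompact_singleton
    (by simpa using hx.symm)
  rw [tendsto_iff_norm_sub_tendsto_zero]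
  have h := (tendsto_dampingError hG.angle_pos.le hG.angle_le).const_mul K
  rw [mul_zero] at h
  refine squeeze_zero' (Eventually.of_forall fun _ => norm_nonneg _) ?_ h
  filter_upwards [self_mem_nhdsWithin] with ε hε
  exact hG.norm_rayWave_sub_le hq0 hq2 hF ht hx (le_of_lt hε) (hK x rfl)

variable {G₀ : ℝ → ℝ → ℝ → ℂ}

theorem regularizedIntegrand_ae_eq (ht : t ∈ timeInterval T) (hx : x ≠ 0)
    (hr : ∀ y : ℝ, y ≠ 0 → G t x (y : ℂ) = G₀ t x y) :
    regularizedIntegrand G₀ F t x ε =ᵐ[volume] weightedKernel T 0 G (rayWeight 0 ε F) t x := by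
  filter_upwards [compl_mem_ae_iff.2 (measure_singleton (0 : ℝ))] with y hy
  rw [weightedKernel_apply ht hx hy, rayWeight_zero_angle, regularizedIntegrand, damped,
    ← hr y hy]
  simp only [Complex.ofReal_zero, zero_mul, Complex.exp_zero, one_mul]
  push_cast; ring

theorem integrable_regularizedIntegrand (hG : IsSectorKernel T β G a p A B) (hq0 : 0 < q)
    (hq2 : q < 2) (hF : HasExpGrowth q C D F) (ht : t ∈ timeInterval T) (hx : x ≠ 0)
    (hr : ∀ y : ℝ, y ≠ 0 → G t x (y : ℂ) = G₀ t x y) (hε : 0 < ε) :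
    Integrable (regularizedIntegrand G₀ F t x ε) :=
  ((hG.isDominatedFamily_real hq0 hq2 hF hε).integrable t ht x hx).congr
    (regularizedIntegrand_ae_eq ht hx hr).symm

theorem tendsto_regularized (hG : IsSectorKernel T β G a p A B) (hq0 : 0 < q)
    (hq2 : q < 2) (hF : HasExpGrowth q C D F) (ht : t ∈ timeInterval T) (hx : x ≠ 0)
    (hr : ∀ y : ℝ, y ≠ 0 → G t x (y : ℂ) = G₀ t x y) :
    Tendsto (fun ε => ∫ y, regularizedIntegrand G₀ F t x ε y) (𝓝[>] 0)
      (𝓝 (rayWave T β G F 0 t x)) := by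
  refine (hG.tendsto_rayWave hq0 hq2 hF ht hx).congr' ?_
  filter_upwards [self_mem_nhdsWithin] with ε hε
  rw [← hG.rayWave_zero_angle_eq_rayWave hq0 hq2 hF ht hx hε, rayWave]
  exact (integral_congr_ae (regularizedIntegrand_ae_eq ht hx hr)).symm

/-- The limit in the definition is replaced by one absolutely convergent integral, from which
everything else is derived. -/
theorem waveFunction_eq (hG : IsSectorKernel T β G a p A B) (hq0 : 0 < q)
    (hq2 : q < 2) (hF : HasExpGrowth q C D F) (ht : t ∈ timeInterval T) (hx : x ≠ 0)
    (hr : ∀ y : ℝ, y ≠ 0 → G t x (y : ℂ) = G₀ t x y) :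
    waveFunction G₀ F t x = rayWave T β G F 0 t x :=
  (hG.tendsto_regularized hq0 hq2 hF ht hx hr).limUnder_eq

end IsSectorKernel

end

/-! ### The transmission condition -/

noncomputable section

/-- Exchange of limits in the manner of Moore and Osgood: the uniform error gives `dist (L n) (L m)
≤ η n + η m`, so `L` is Cauchy, and its limit is also the limit of `g`. -/
theorem exists_tendsto_of_uniform_approx {l : Filter ℝ} [l.NeBot] {f : ℕ → ℝ → ℂ} {L : ℕ → ℂ}
    {g : ℝ → ℂ} {η : ℕ → ℝ} (hf : ∀ n, Tendsto (f n) l (𝓝 (L n)))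
    (hη : Tendsto η atTop (𝓝 0)) (hu : ∀ᶠ x in l, ∀ n, ‖f n x - g x‖ ≤ η n) :
    ∃ L₀, Tendsto L atTop (𝓝 L₀) ∧ Tendsto g l (𝓝 L₀) := by
  have hLL : ∀ n m, dist (L n) (L m) ≤ η n + η m := by
    intro n m
    rw [dist_eq_norm]
    refine le_of_tendsto ((hf n).sub (hf m)).norm ?_
    filter_upwards [hu] with x hx
    calc ‖f n x - f m x‖ = ‖(f n x - g x) - (f m x - g x)‖ := by congr 1; ring
      _ ≤ ‖f n x - g x‖ + ‖f m x - g x‖ := norm_sub_le _ _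
      _ ≤ _ := add_le_add (hx n) (hx m)
  have hC : CauchySeq L := by
    rw [Metric.cauchySeq_iff]
    intro e he
    obtain ⟨N, hN⟩ := eventually_atTop.1 (hη.eventually (gt_mem_nhds (half_pos he)))
    exact ⟨N, fun m hm n hn => (hLL m n).trans_lt (by linarith [hN m hm, hN n hn])⟩
  obtain ⟨L₀, hL₀⟩ := cauchySeq_tendsto_of_complete hC
  refine ⟨L₀, hL₀, ?_⟩
  refine TendstoUniformlyOnFilter.tendsto_of_eventually_tendsto (F := f) (p := atTop) ?_
    (Eventually.of_forall hf) hL₀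
  rw [Metric.tendstoUniformlyOnFilter_iff]
  intro e he
  refine (((hη.eventually (gt_mem_nhds he))).prod_mk hu).mono fun r hr => ?_
  rw [dist_comm, dist_eq_norm]
  exact (hr.2 r.1).trans_lt hr.1

theorem integrable_and_tendsto_integral_of_dominated {l : Filter ℝ} [l.NeBot]
    [l.IsCountablyGenerated] {k : ℝ → ℝ → ℂ} {u : ℝ → ℂ} {K : ℝ}
    (hm : ∀ᶠ x in l, AEStronglyMeasurable (k x) volume)
    (hb : ∀ᶠ x in l, ∀ y, y ≠ 0 → ‖k x y‖ ≤ K * Real.exp (-|y|))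
    (hl : ∀ y, y ≠ 0 → Tendsto (fun x => k x y) l (𝓝 (u y))) :
    Integrable u ∧ Tendsto (fun x => ∫ y, k x y) l (𝓝 (∫ y, u y)) := by
  have h0 : ∀ᵐ y : ℝ, y ≠ 0 := compl_mem_ae_iff.2 (measure_singleton (0 : ℝ))
  have hintg := integrable_exp_neg_abs.const_mul K
  -- The limit function `u` comes without measurability; it is obtained as a pointwise limit along a
  -- sequence.
  have hmu : AEStronglyMeasurable u volume := by
    obtain ⟨s, hs⟩ := exists_seq_tendsto l
    obtain ⟨N, hN⟩ := eventually_atTop.1 (hs.eventually hm)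
    refine aestronglyMeasurable_of_tendsto_ae (u := atTop) (f := fun n => k (s (n + N)))
      (fun n => hN _ (Nat.le_add_left _ _)) ?_
    filter_upwards [h0] with y hy
    exact (hl y hy).comp (hs.comp (tendsto_add_atTop_nat N))
  refine ⟨hintg.mono' hmu ?_, ?_⟩
  · filter_upwards [h0] with y hy
    exact le_of_tendsto (hl y hy).norm (hb.mono fun x hx => hx y hy)
  · refine tendsto_integral_filter_of_dominated_convergence _ hm ?_ hintg ?_
    · filter_upwards [hb] with x hx
      filter_upwards [h0] with y hy using hx y hy
    · filter_upwards [h0] with y hy using hl y hy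

theorem mulVec_integral_eq (M N : Matrix (Fin 2) (Fin 2) ℂ) {u₁ u₂ v₁ v₂ : ℝ → ℂ}
    (h₁ : Integrable u₁) (h₂ : Integrable u₂) (h₃ : Integrable v₁) (h₄ : Integrable v₂)
    (h : ∀ᵐ y, M *ᵥ ![u₁ y, u₂ y] = N *ᵥ ![v₁ y, -v₂ y]) :
    M *ᵥ ![∫ y, u₁ y, ∫ y, u₂ y] = N *ᵥ ![∫ y, v₁ y, -∫ y, v₂ y] := by
  funext i
  have h₅ : Integrable fun y => -v₂ y := h₄.neg
  simp only [Matrix.mulVec, dotProduct, Fin.sum_univ_two, Matrix.cons_val_zero, Matrix.cons_val_one]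
  rw [← integral_neg, ← integral_const_mul, ← integral_const_mul, ← integral_const_mul,
    ← integral_const_mul, ← integral_add (h₁.const_mul _) (h₂.const_mul _),
    ← integral_add (h₃.const_mul _) (h₅.const_mul _)]
  refine integral_congr_ae ?_
  filter_upwards [h] with y hy
  have := congrFun hy i
  simpa [Matrix.mulVec, dotProduct, Fin.sum_univ_two] using this

theorem tendsto_mulVec_pair (M : Matrix (Fin 2) (Fin 2) ℂ) {u v : ℕ → ℂ} {u₀ v₀ : ℂ}
    (hu : Tendsto u atTop (𝓝 u₀)) (hv : Tendsto v atTop (𝓝 v₀)) :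
    Tendsto (fun n => M *ᵥ ![u n, v n]) atTop (𝓝 (M *ᵥ ![u₀, v₀])) := by
  rw [tendsto_pi_nhds]
  intro i
  simp only [Matrix.mulVec, dotProduct, Fin.sum_univ_two, Matrix.cons_val_zero, Matrix.cons_val_one]
  exact (hu.const_mul _).add (hv.const_mul _)

theorem mulVec_pair_mul (M : Matrix (Fin 2) (Fin 2) ℂ) (u v c : ℂ) :
    M *ᵥ ![u * c, v * c] = c • (M *ᵥ ![u, v]) := by
  rw [← Matrix.mulVec_smul]
  congr 1
  funext i
  fin_cases i <;> simp [mul_comm]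

namespace IsSectorKernel

variable {T : EReal} {β : ℝ} {G : ℝ → ℝ → ℂ → ℂ} {a : ℝ → ℝ} {p : ℝ} {A B : Fin 3 → ℝ → ℝ → ℝ}
  {q C D : ℝ} {F : ℂ → ℂ} {t x ε θ : ℝ}

theorem exists_bound_near_zero {w : ℝ → ℂ} {C D ε : ℝ} (hG : IsSectorKernel T β G a p A B)
    (hq0 : 0 < q) (hq2 : q < 2) (hw : IsWeight q C D ε w) (hθ : θ ∈ Icc 0 β)
    (hε : 0 < ε + Real.sin (2 * θ)) (ht : t ∈ timeInterval T) {K₀ : ℝ}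
    (hK₀ : ∀ᶠ x in 𝓝[≠] (0 : ℝ), A 0 t x ≤ K₀ ∧ B 0 t x ≤ K₀) :
    ∃ K, ∀ᶠ x in 𝓝[≠] (0 : ℝ), ∀ y : ℝ, y ≠ 0 →
      ‖G t x (Complex.exp (θ * Complex.I) * y) * w y‖ ≤ K * Real.exp (-|y|) := by
  obtain ⟨K, -, hK⟩ := hG.exists_weighted_bounds hq0 hq2 hw hθ hε (A' := |K₀|) (B' := |K₀|)
    (a₀ := a t) (a t) 1 (abs_nonneg _) (abs_nonneg _) (hG.a_pos t ht) (hG.a_pos t ht).le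
  have h1 : ∀ᶠ x in 𝓝[≠] (0 : ℝ), |x| ≤ 1 :=
    nhdsWithin_le_nhds (by simpa [Metric.closedBall, Real.dist_eq] using
      Metric.closedBall_mem_nhds (0 : ℝ) one_pos)
  refine ⟨K, ?_⟩
  filter_upwards [hK₀, h1, self_mem_nhdsWithin] with x hx hx1 hx0 y hy
  exact (hK t ht x hx0 le_rfl le_rfl hx1 (hx.1.trans (le_abs_self _))
    (hx.2.trans (le_abs_self _)) y hy).1

theorem exists_deriv_bound_near_zero {w : ℝ → ℂ} {C D ε : ℝ} (hG : IsSectorKernel T β G a p A B)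
    (hq0 : 0 < q) (hq2 : q < 2) (hw : IsWeight q C D ε w) (hθ : θ ∈ Icc 0 β)
    (hε : 0 < ε + Real.sin (2 * θ)) (ht : t ∈ timeInterval T) {K₀ : ℝ}
    (hK₀ : ∀ᶠ x in 𝓝[≠] (0 : ℝ), A 0 t x ≤ K₀ ∧ A 1 t x ≤ K₀ ∧ B 0 t x ≤ K₀ ∧ B 1 t x ≤ K₀) :
    ∃ K, ∀ᶠ x in 𝓝[≠] (0 : ℝ), ∀ y : ℝ, y ≠ 0 →
      ‖deriv (fun x => G t x (Complex.exp (θ * Complex.I) * y)) x * w y‖ ≤ K * Real.exp (-|y|) := by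
  obtain ⟨K, -, hK⟩ := hG.exists_weighted_bounds hq0 hq2 hw hθ hε (A' := |K₀|) (B' := |K₀|)
    (a₀ := a t) (a t) 1 (abs_nonneg _) (abs_nonneg _) (hG.a_pos t ht) (hG.a_pos t ht).le
  have h1 : ∀ᶠ x in 𝓝[≠] (0 : ℝ), |x| ≤ 1 :=
    nhdsWithin_le_nhds (by simpa [Metric.closedBall, Real.dist_eq] using
      Metric.closedBall_mem_nhds (0 : ℝ) one_pos)
  refine ⟨K, ?_⟩
  filter_upwards [hK₀, h1, self_mem_nhdsWithin] with x hx hx1 hx0 y hy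
  exact (hK t ht x hx0 le_rfl le_rfl hx1 (hx.1.trans (le_abs_self _))
    (hx.2.2.1.trans (le_abs_self _)) y hy).2.1 (hx.2.1.trans (le_abs_self _))
    (hx.2.2.2.trans (le_abs_self _))

theorem deriv_rayWave_zero_angle_eq (hG : IsSectorKernel T β G a p A B) (hq0 : 0 < q) (hq2 : q < 2)
    (hF : HasExpGrowth q C D F) (ht : t ∈ timeInterval T) (hx : x ≠ 0) (hε : 0 < ε) :
    deriv (rayWave T 0 G F ε t) x = deriv (rayWave T β G F ε t) x := by
  refine EventuallyEq.deriv_eq ?_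
  filter_upwards [isOpen_ne.mem_nhds hx] with x' hx'
    using hG.rayWave_zero_angle_eq_rayWave hq0 hq2 hF ht hx' hε

theorem norm_deriv_rayWave_sub_le (hG : IsSectorKernel T β G a p A B) (hq0 : 0 < q) (hq2 : q < 2)
    (hF : HasExpGrowth q C D F) (ht : t ∈ timeInterval T) (hx : x ≠ 0) (hε : 0 ≤ ε) {K : ℝ}
    (hK : ∀ y : ℝ, y ≠ 0 → ‖deriv (fun x => G t x (Complex.exp (β * Complex.I) * y)) x *
      rayWeight β 0 F y‖ ≤ K * Real.exp (-|y|)) :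
    ‖deriv (rayWave T β G F ε t) x - deriv (rayWave T β G F 0 t) x‖ ≤ K * dampingError β ε := by
  have h0 : ∀ᵐ y : ℝ, y ≠ 0 := compl_mem_ae_iff.2 (measure_singleton (0 : ℝ))
  have key : ∀ ε, 0 ≤ ε → Integrable (fun y : ℝ =>
        deriv (fun x => G t x (Complex.exp (β * Complex.I) * y)) x * rayWeight β ε F y) ∧
      deriv (rayWave T β G F ε t) x =
        ∫ y : ℝ, deriv (fun x => G t x (Complex.exp (β * Complex.I) * y)) x * rayWeight β ε F y := by
    intro ε hε
    have hdom := hG.isDominatedFamily_ray hq0 hq2 hF hε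
    have hae : (fun y => deriv (fun x => weightedKernel T β G (rayWeight β ε F) t x y) x) =ᵐ[volume]
        fun y : ℝ => deriv (fun x => G t x (Complex.exp (β * Complex.I) * y)) x *
          rayWeight β ε F y := by
      filter_upwards [h0] with y hy using deriv_weightedKernel_space ht hx hy
    refine ⟨?_, ((hdom.space_regularity ht).1 x hx).deriv.trans (integral_congr_ae hae)⟩
    obtain ⟨g, hg, hbg⟩ := hdom.bound_space t ht x x le_rfl (fun h => hx (le_antisymm h.2 h.1).symm)
    refine Integrable.congr (hg.mono' ?_ (Eventually.of_forall fun y =>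
      (hbg x ⟨le_rfl, le_rfl⟩ y).1)) hae
    exact ((hdom.measurable_deriv_space hx).comp
      (measurable_id.prodMk (measurable_const (a := t)))).aestronglyMeasurable
  rw [(key ε hε).2, (key 0 le_rfl).2]
  refine norm_integral_damped_sub_le hG.angle_pos.le hG.angle_le hε (key ε hε).1 (key 0 le_rfl).1 ?_
  filter_upwards [h0] with y hy using hK y hy

/-- The limits of `G` as `x → 0±` are given for real arguments only. Therefore dominated convergence
is applied on the damped real line, whose integral agrees with the rotated one for `x ≠ 0`. -/
theorem rayWave_one_sided_limit (hG : IsSectorKernel T β G a p A B) (hq0 : 0 < q) (hq2 : q < 2)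
    (hF : HasExpGrowth q C D F) (ht : t ∈ timeInterval T) {K₀ : ℝ}
    (hK₀ : ∀ᶠ x in 𝓝[≠] (0 : ℝ), A 0 t x ≤ K₀ ∧ B 0 t x ≤ K₀)
    {l : Filter ℝ} [l.NeBot] [l.IsCountablyGenerated] (hl : l ≤ 𝓝[≠] 0) {u : ℝ → ℂ}
    (hu : ∀ y : ℝ, y ≠ 0 → Tendsto (fun x => G t x y) l (𝓝 (u y))) (hε : 0 < ε) :
    Integrable (fun y => u y * rayWeight 0 ε F y) ∧
      Tendsto (rayWave T β G F ε t) l (𝓝 (∫ y, u y * rayWeight 0 ε F y)) := by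
  obtain ⟨K, hK⟩ := hG.exists_bound_near_zero hq0 hq2 (hF.isWeight_real hε.le)
    ⟨le_rfl, hG.angle_pos.le⟩ (by simpa using hε) ht hK₀
  have hne : ∀ᶠ x in l, x ≠ 0 := hl self_mem_nhdsWithin
  have hdom := hG.isDominatedFamily_real hq0 hq2 hF hε
  have h := integrable_and_tendsto_integral_of_dominated (l := l) (K := K)
    (k := fun x => weightedKernel T 0 G (rayWeight 0 ε F) t x) (u := fun y => u y * rayWeight 0 ε F y)
    (Eventually.of_forall fun x => (hdom.measurable_param t x).aestronglyMeasurable)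
    (by
      filter_upwards [hl hK, hne] with x hx hx0 y hy
      rw [weightedKernel_apply ht hx0 hy]
      exact hx y hy)
    (fun y hy => by
      refine ((hu y hy).mul_const (rayWeight 0 ε F y)).congr' ?_
      filter_upwards [hne] with x hx0
      rw [weightedKernel_apply ht hx0 hy]; simp)
  refine ⟨h.1, h.2.congr' ?_⟩
  filter_upwards [hne] with x hx0
  exact hG.rayWave_zero_angle_eq_rayWave hq0 hq2 hF ht hx0 hε

theorem deriv_rayWave_one_sided_limit (hG : IsSectorKernel T β G a p A B) (hq0 : 0 < q) (hq2 : q < 2)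
    (hF : HasExpGrowth q C D F) (ht : t ∈ timeInterval T) {K₀ : ℝ}
    (hK₀ : ∀ᶠ x in 𝓝[≠] (0 : ℝ), A 0 t x ≤ K₀ ∧ A 1 t x ≤ K₀ ∧ B 0 t x ≤ K₀ ∧ B 1 t x ≤ K₀)
    {l : Filter ℝ} [l.NeBot] [l.IsCountablyGenerated] (hl : l ≤ 𝓝[≠] 0) {u : ℝ → ℂ}
    (hu : ∀ y : ℝ, y ≠ 0 → Tendsto (deriv fun x => G t x y) l (𝓝 (u y))) (hε : 0 < ε) :
    Integrable (fun y => u y * rayWeight 0 ε F y) ∧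
      Tendsto (deriv (rayWave T β G F ε t)) l (𝓝 (∫ y, u y * rayWeight 0 ε F y)) := by
  obtain ⟨K, hK⟩ := hG.exists_deriv_bound_near_zero hq0 hq2 (hF.isWeight_real hε.le)
    ⟨le_rfl, hG.angle_pos.le⟩ (by simpa using hε) ht hK₀
  have hne : ∀ᶠ x in l, x ≠ 0 := hl self_mem_nhdsWithin
  have hdom := hG.isDominatedFamily_real hq0 hq2 hF hε
  have h := integrable_and_tendsto_integral_of_dominated (l := l) (K := K)
    (k := fun x y => deriv (fun x => weightedKernel T 0 G (rayWeight 0 ε F) t x y) x)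
    (u := fun y => u y * rayWeight 0 ε F y)
    (by
      filter_upwards [hne] with x hx0
      exact ((hdom.measurable_deriv_space hx0).comp
        (measurable_id.prodMk (measurable_const (a := t)))).aestronglyMeasurable)
    (by
      filter_upwards [hl hK, hne] with x hx hx0 y hy
      rw [deriv_weightedKernel_space ht hx0 hy]
      exact hx y hy)
    (fun y hy => by
      refine ((hu y hy).mul_const (rayWeight 0 ε F y)).congr' ?_
      filter_upwards [hne] with x hx0
      rw [deriv_weightedKernel_space ht hx0 hy]; simp)
  refine ⟨h.1, h.2.congr' ?_⟩
  filter_upwards [hne] with x hx0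
  rw [← hG.deriv_rayWave_zero_angle_eq hq0 hq2 hF ht hx0 hε]
  exact ((hdom.space_regularity ht).1 x hx0).deriv.symm

theorem _root_.Supershift.tendsto_dampingError_seq (hβ0 : 0 ≤ β) (hβ : β ≤ Real.pi / 4) (K : ℝ) :
    Tendsto (fun n : ℕ => K * dampingError β (1 / ((n : ℝ) + 1))) atTop (𝓝 0) := by
  have h : Tendsto (fun n : ℕ => 1 / ((n : ℝ) + 1)) atTop (𝓝[>] 0) :=
    tendsto_nhdsWithin_iff.2 ⟨tendsto_one_div_add_atTop_nhds_zero_nat,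
      Eventually.of_forall fun n => by simp only [mem_Ioi]; positivity⟩
  simpa using ((tendsto_dampingError hβ0 hβ).comp h).const_mul K

/-- The one-sided limits of the integral along the rotated line exist, and are the limits of those of
the damped integrals over the real line. -/
theorem exists_rayWave_limit (hG : IsSectorKernel T β G a p A B) (hq0 : 0 < q) (hq2 : q < 2)
    (hF : HasExpGrowth q C D F) (ht : t ∈ timeInterval T) {K₀ : ℝ}
    (hK₀ : ∀ᶠ x in 𝓝[≠] (0 : ℝ), A 0 t x ≤ K₀ ∧ B 0 t x ≤ K₀)
    {l : Filter ℝ} [l.NeBot] [l.IsCountablyGenerated] (hl : l ≤ 𝓝[≠] 0) {u : ℝ → ℂ}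
    (hu : ∀ y : ℝ, y ≠ 0 → Tendsto (fun x => G t x y) l (𝓝 (u y))) :
    ∃ L₀, Tendsto (fun n : ℕ => ∫ y, u y * rayWeight 0 (1 / ((n : ℝ) + 1)) F y) atTop (𝓝 L₀) ∧
      Tendsto (rayWave T β G F 0 t) l (𝓝 L₀) := by
  obtain ⟨K, hK⟩ := hG.exists_bound_near_zero hq0 hq2
    (hF.isWeight_ray (ε := 0) hG.angle_pos.le hG.angle_le le_rfl) ⟨hG.angle_pos.le, le_rfl⟩
    (by linarith [hG.sin_two_mul_angle_pos]) ht hK₀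
  -- Damping parameters `1 / (n + 1)`; the bound `K` near zero does not depend on `x`, so the
  -- damping error is uniform there.
  refine exists_tendsto_of_uniform_approx (f := fun n => rayWave T β G F (1 / ((n : ℝ) + 1)) t)
    (fun n => (hG.rayWave_one_sided_limit hq0 hq2 hF ht hK₀ hl hu (by positivity)).2)
    (tendsto_dampingError_seq hG.angle_pos.le hG.angle_le K) ?_
  filter_upwards [hl hK, hl self_mem_nhdsWithin] with x hx hx0 n
  exact hG.norm_rayWave_sub_le hq0 hq2 hF ht hx0 (by positivity) hx

theorem exists_deriv_rayWave_limit (hG : IsSectorKernel T β G a p A B) (hq0 : 0 < q) (hq2 : q < 2)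
    (hF : HasExpGrowth q C D F) (ht : t ∈ timeInterval T) {K₀ : ℝ}
    (hK₀ : ∀ᶠ x in 𝓝[≠] (0 : ℝ), A 0 t x ≤ K₀ ∧ A 1 t x ≤ K₀ ∧ B 0 t x ≤ K₀ ∧ B 1 t x ≤ K₀)
    {l : Filter ℝ} [l.NeBot] [l.IsCountablyGenerated] (hl : l ≤ 𝓝[≠] 0) {u : ℝ → ℂ}
    (hu : ∀ y : ℝ, y ≠ 0 → Tendsto (deriv fun x => G t x y) l (𝓝 (u y))) :
    ∃ L₀, Tendsto (fun n : ℕ => ∫ y, u y * rayWeight 0 (1 / ((n : ℝ) + 1)) F y) atTop (𝓝 L₀) ∧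
      Tendsto (deriv (rayWave T β G F 0 t)) l (𝓝 L₀) := by
  obtain ⟨K, hK⟩ := hG.exists_deriv_bound_near_zero hq0 hq2
    (hF.isWeight_ray (ε := 0) hG.angle_pos.le hG.angle_le le_rfl) ⟨hG.angle_pos.le, le_rfl⟩
    (by linarith [hG.sin_two_mul_angle_pos]) ht hK₀
  refine exists_tendsto_of_uniform_approx
    (f := fun n => deriv (rayWave T β G F (1 / ((n : ℝ) + 1)) t))
    (fun n => (hG.deriv_rayWave_one_sided_limit hq0 hq2 hF ht hK₀ hl hu (by positivity)).2)
    (tendsto_dampingError_seq hG.angle_pos.le hG.angle_le K) ?_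
  filter_upwards [hl hK, hl self_mem_nhdsWithin] with x hx hx0 n
  exact hG.norm_deriv_rayWave_sub_le hq0 hq2 hF ht hx0 (by positivity) hx

/-- For each damping parameter the condition for `G(t,·,y)` is linear and can be integrated over
real `y`. Letting the damping vanish preserves it, since the one-sided limits of the rotated
integral are the limits of the damped ones. -/
theorem satisfiesTransmission_rayWave (hG : IsSectorKernel T β G a p A B) (hq0 : 0 < q) (hq2 : q < 2)
    (hF : HasExpGrowth q C D F) (ht : t ∈ timeInterval T) {M N : Matrix (Fin 2) (Fin 2) ℂ}
    (hM : M ≠ 0 → N = 0 → ∃ K : ℝ, ∀ᶠ x in 𝓝[≠] (0 : ℝ), A 0 t x ≤ K ∧ B 0 t x ≤ K)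
    (hN : N ≠ 0 → ∃ K : ℝ, ∀ᶠ x in 𝓝[≠] (0 : ℝ),
      A 0 t x ≤ K ∧ A 1 t x ≤ K ∧ B 0 t x ≤ K ∧ B 1 t x ≤ K)
    (htr : ∀ y : ℝ, y ≠ 0 → SatisfiesTransmission M N fun x => G t x y) :
    SatisfiesTransmission M N (rayWave T β G F 0 t) := by
  have h0 : ∀ᵐ y : ℝ, y ≠ 0 := compl_mem_ae_iff.2 (measure_singleton (0 : ℝ))
  have hgt : 𝓝[>] (0 : ℝ) ≤ 𝓝[≠] 0 := nhdsWithin_mono _ fun x hx => ne_of_gt hx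
  have hlt : 𝓝[<] (0 : ℝ) ≤ 𝓝[≠] 0 := nhdsWithin_mono _ fun x hx => ne_of_lt hx
  constructor
  · intro hN0 hM0
    obtain ⟨K₀, hK₀⟩ := hM hM0 hN0
    have hch : ∀ y : ℝ, ∃ up um : ℂ, y ≠ 0 → Tendsto (fun x => G t x y) (𝓝[>] 0) (𝓝 up) ∧
        Tendsto (fun x => G t x y) (𝓝[<] 0) (𝓝 um) ∧ M *ᵥ ![up, um] = 0 := by
      intro y
      by_cases hy : y = 0
      · exact ⟨0, 0, fun h => absurd hy h⟩
      · obtain ⟨up, um, h⟩ := (htr y hy).1 hN0 hM0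
        exact ⟨up, um, fun _ => h⟩
    choose up um h using hch
    obtain ⟨Lp, hp1, hp2⟩ := hG.exists_rayWave_limit hq0 hq2 hF ht hK₀ hgt fun y hy => (h y hy).1
    obtain ⟨Lm, hm1, hm2⟩ := hG.exists_rayWave_limit hq0 hq2 hF ht hK₀ hlt fun y hy => (h y hy).2.1
    refine ⟨Lp, Lm, hp2, hm2, tendsto_nhds_unique (tendsto_mulVec_pair M hp1 hm1) ?_⟩
    refine tendsto_const_nhds.congr fun n => ?_
    have hε : (0 : ℝ) < 1 / ((n : ℝ) + 1) := by positivity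
    have := mulVec_integral_eq M 0
      (hG.rayWave_one_sided_limit hq0 hq2 hF ht hK₀ hgt (fun y hy => (h y hy).1) hε).1
      (hG.rayWave_one_sided_limit hq0 hq2 hF ht hK₀ hlt (fun y hy => (h y hy).2.1) hε).1
      (integrable_zero ℝ ℂ volume) (integrable_zero ℝ ℂ volume) (by
        filter_upwards [h0] with y hy
        rw [mulVec_pair_mul, (h y hy).2.2, smul_zero, Matrix.zero_mulVec])
    rw [this, Matrix.zero_mulVec]
  · intro hN0
    obtain ⟨K₀, hK₀⟩ := hN hN0
    have hK₀' : ∀ᶠ x in 𝓝[≠] (0 : ℝ), A 0 t x ≤ K₀ ∧ B 0 t x ≤ K₀ :=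
      hK₀.mono fun x hx => ⟨hx.1, hx.2.2.1⟩
    have hch : ∀ y : ℝ, ∃ up um dp dm : ℂ, y ≠ 0 → Tendsto (fun x => G t x y) (𝓝[>] 0) (𝓝 up) ∧
        Tendsto (fun x => G t x y) (𝓝[<] 0) (𝓝 um) ∧
        Tendsto (deriv fun x => G t x y) (𝓝[>] 0) (𝓝 dp) ∧
        Tendsto (deriv fun x => G t x y) (𝓝[<] 0) (𝓝 dm) ∧
        M *ᵥ ![up, um] = N *ᵥ ![dp, -dm] := by
      intro y
      by_cases hy : y = 0
      · exact ⟨0, 0, 0, 0, fun h => absurd hy h⟩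
      · obtain ⟨up, um, dp, dm, h⟩ := (htr y hy).2 hN0
        exact ⟨up, um, dp, dm, fun _ => h⟩
    choose up um dp dm h using hch
    obtain ⟨Lp, hp1, hp2⟩ := hG.exists_rayWave_limit hq0 hq2 hF ht hK₀' hgt fun y hy => (h y hy).1
    obtain ⟨Lm, hm1, hm2⟩ := hG.exists_rayWave_limit hq0 hq2 hF ht hK₀' hlt fun y hy => (h y hy).2.1
    obtain ⟨Dp, hdp1, hdp2⟩ :=
      hG.exists_deriv_rayWave_limit hq0 hq2 hF ht hK₀ hgt fun y hy => (h y hy).2.2.1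
    obtain ⟨Dm, hdm1, hdm2⟩ :=
      hG.exists_deriv_rayWave_limit hq0 hq2 hF ht hK₀ hlt fun y hy => (h y hy).2.2.2.1
    refine ⟨Lp, Lm, Dp, Dm, hp2, hm2, hdp2, hdm2,
      tendsto_nhds_unique (tendsto_mulVec_pair M hp1 hm1) ?_⟩
    refine (tendsto_mulVec_pair N hdp1 hdm1.neg).congr fun n => ?_
    have hε : (0 : ℝ) < 1 / ((n : ℝ) + 1) := by positivity
    refine (mulVec_integral_eq M N
      (hG.rayWave_one_sided_limit hq0 hq2 hF ht hK₀' hgt (fun y hy => (h y hy).1) hε).1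
      (hG.rayWave_one_sided_limit hq0 hq2 hF ht hK₀' hlt (fun y hy => (h y hy).2.1) hε).1
      (hG.deriv_rayWave_one_sided_limit hq0 hq2 hF ht hK₀ hgt (fun y hy => (h y hy).2.2.1) hε).1
      (hG.deriv_rayWave_one_sided_limit hq0 hq2 hF ht hK₀ hlt (fun y hy => (h y hy).2.2.2.1) hε).1
      ?_).symm
    filter_upwards [h0] with y hy
    rw [mulVec_pair_mul, (h y hy).2.2.2.2, ← neg_mul, mulVec_pair_mul]

end IsSectorKernel

end

/-! ### The initial condition -/

noncomputable section

namespace IsSectorKernel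

variable {T : EReal} {β : ℝ} {G : ℝ → ℝ → ℂ → ℂ} {a : ℝ → ℝ} {p : ℝ} {A B : Fin 3 → ℝ → ℝ → ℝ}
  {q C D : ℝ} {F : ℂ → ℂ} {t x σ x₀ : ℝ}

theorem _root_.Supershift.exp_log_add_angle (β : ℝ) {s : ℝ} (hs : 0 < s) :
    Complex.exp (Real.log s + β * Complex.I) = Complex.exp (β * Complex.I) * s := by
  rw [Complex.exp_add, ← Complex.ofReal_exp, Real.exp_log hs, mul_comm]

theorem tail_mem_doubleSector (hG : IsSectorKernel T β G a p A B) (hσ : σ = 1 ∨ σ = -1)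
    (hx₀ : 0 ≤ x₀) {s : ℝ} (hs : 0 < s) :
    (σ : ℂ) * (x₀ + Complex.exp (β * Complex.I) * s) ∈ doubleSector β := by
  have h := sign_mul_add_exp_mem hG.angle_lt hσ hx₀ (w := Real.log s + β * Complex.I)
    (by simpa using hG.angle_pos.le)
  rwa [exp_log_add_angle β hs] at h

/-- On the rays that start at `±x₀`, the integrand decays like `exp(-2 a (x₀ ∓ x) s sin β)`. -/
theorem exists_tail_bound (hG : IsSectorKernel T β G a p A B) (hq0 : 0 < q) (hq2 : q < 2)
    (hF : HasExpGrowth q C D F) (hσ : σ = 1 ∨ σ = -1) (hx₀ : 0 ≤ x₀) {B' a₀ : ℝ} (hB' : 0 ≤ B')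
    (ha₀ : 0 < a₀) :
    ∃ K : ℝ, 0 ≤ K ∧ ∀ t ∈ timeInterval T, ∀ x : ℝ, x ≠ 0 → a₀ ≤ a t → B 0 t x ≤ B' →
      ∀ ε s : ℝ, 0 ≤ ε → 0 < s →
      ‖G t x (σ * (x₀ + Complex.exp (β * Complex.I) * s)) *
        damped ε F (σ * (x₀ + Complex.exp (β * Complex.I) * s))‖ ≤
      A 0 t x * K * (Real.exp (-s) * Real.exp (-(2 * a t * (x₀ - σ * x) * Real.sin β) * s)) := by
  obtain ⟨K, hK⟩ := exists_exponent_le (X := x₀) hG.p_pos hG.p_lt hq0 hq2 0 hB' hF.rate_nonneg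
    (mul_pos ha₀ hG.sin_two_mul_angle_pos)
  refine ⟨C * Real.exp K, mul_nonneg hF.const_nonneg (Real.exp_pos _).le,
    fun t ht x hx ha hB ε s hε hs => ?_⟩
  have hzm := hG.tail_mem_doubleSector hσ hx₀ hs
  have hρ := norm_sign_mul_add_exp_le hσ hx₀ (Real.log s + β * Complex.I)
  rw [exp_log_add_angle β hs] at hρ
  simp only [Complex.add_re, Complex.ofReal_re, Complex.mul_re, Complex.I_re, mul_zero,
    Complex.ofReal_im, Complex.I_im, mul_one, sub_self, add_zero, Real.exp_log hs] at hρ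
  set u : ℂ := Complex.exp (β * Complex.I) * s with hu
  set z : ℂ := (σ : ℂ) * (x₀ + u) with hz
  have hure : u.re = Real.cos β * s := by simp [hu, Complex.exp_ofReal_mul_I_re]
  have huim : u.im = Real.sin β * s := by simp [hu, Complex.exp_ofReal_mul_I_im]
  have h1 := hG.norm_le ht hx hzm le_rfl hB
  have h2 := (norm_damped_le hε F (re_sq_nonneg_of_mem_doubleSector hG.angle_le hzm)).trans (hF.bound z)
  -- The modulus splits into a Gaussian and an exponential linear in `s`. The Gaussian alone, with
  -- `a` replaced by its lower bound `a₀`, absorbs the growth; the linear factor is kept whole,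
  -- because its integral supplies the gain `1 / a`.
  have hph : ‖phase (a t) x z‖ =
      Real.exp (-(a t * Real.sin (2 * β) * s ^ 2)) *
        Real.exp (-(2 * a t * (x₀ - σ * x) * Real.sin β) * s) := by
    rw [norm_phase, mul_assoc 2, phase_exponent_sign_mul hσ u, hure, huim, Real.sin_two_mul,
      ← Real.exp_add]
    congr 1; ring
  rw [hph] at h1
  have hk := hK s ‖z‖ hs.le (norm_nonneg z) hρ
  have hA := (hG.nonneg 0 t ht x hx).1
  set E := Real.exp (-(2 * a t * (x₀ - σ * x) * Real.sin β) * s) with hE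
  have hEp : 0 < E := Real.exp_pos _
  have hexp : Real.exp (B' * ‖z‖ ^ p) * Real.exp (-(a t * Real.sin (2 * β) * s ^ 2)) *
      Real.exp (D * ‖z‖ ^ q) ≤ Real.exp K * Real.exp (-s) := by
    rw [← Real.exp_add, ← Real.exp_add, ← Real.exp_add]
    refine Real.exp_le_exp.2 ?_
    have : a₀ * (Real.sin (2 * β) * s ^ 2) ≤ a t * (Real.sin (2 * β) * s ^ 2) :=
      mul_le_mul_of_nonneg_right ha (mul_nonneg hG.sin_two_mul_angle_pos.le (sq_nonneg s))
    linarith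
  rw [norm_mul]
  calc _ ≤ A 0 t x * (Real.exp (B' * ‖z‖ ^ p) *
        (Real.exp (-(a t * Real.sin (2 * β) * s ^ 2)) * E)) * (C * Real.exp (D * ‖z‖ ^ q)) :=
        mul_le_mul h1 h2 (norm_nonneg _) (by positivity)
    _ = A 0 t x * C * E * (Real.exp (B' * ‖z‖ ^ p) * Real.exp (-(a t * Real.sin (2 * β) * s ^ 2)) *
        Real.exp (D * ‖z‖ ^ q)) := by ring
    _ ≤ A 0 t x * C * E * (Real.exp K * Real.exp (-s)) := by
        refine mul_le_mul_of_nonneg_left hexp ?_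
        have := hF.const_nonneg
        positivity
    _ = _ := by ring

theorem continuousOn_tail (hG : IsSectorKernel T β G a p A B) (hF : HasExpGrowth q C D F)
    (ht : t ∈ timeInterval T) (hx : x ≠ 0) (hσ : σ = 1 ∨ σ = -1) (hx₀ : 0 ≤ x₀) (ε : ℝ) :
    ContinuousOn (fun s : ℝ => G t x (σ * (x₀ + Complex.exp (β * Complex.I) * s)) *
      damped ε F (σ * (x₀ + Complex.exp (β * Complex.I) * s))) (Ioi 0) := by
  refine ContinuousOn.mul ((hG.cont t ht x hx).comp (by fun_prop) fun s hs =>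
    hG.tail_mem_doubleSector hσ hx₀ hs) ?_
  exact ((differentiable_damped hF.differentiable ε).continuous.comp (by fun_prop)).continuousOn

theorem sin_angle_pos (hG : IsSectorKernel T β G a p A B) : 0 < Real.sin β :=
  Real.sin_pos_of_pos_of_lt_pi hG.angle_pos (by linarith [hG.angle_le, Real.pi_pos])

theorem sub_sign_mul_pos (hσ : σ = 1 ∨ σ = -1) (hxx₀ : |x| < x₀) : 0 < x₀ - σ * x := by
  rcases hσ with rfl | rfl
  · linarith [le_abs_self x]
  · linarith [neg_le_abs x]

theorem tendsto_tailIntegral (hG : IsSectorKernel T β G a p A B) (hq0 : 0 < q) (hq2 : q < 2)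
    (hF : HasExpGrowth q C D F) (ht : t ∈ timeInterval T) (hx : x ≠ 0) (hσ : σ = 1 ∨ σ = -1)
    (hxx₀ : |x| < x₀) :
    Tendsto (fun ε => tailIntegral β G F σ x₀ ε t x) (𝓝[>] 0) (𝓝 (tailIntegral β G F σ x₀ 0 t x)) := by
  have hx₀ : 0 ≤ x₀ := (abs_nonneg x).trans hxx₀.le
  obtain ⟨K, hK0, hK⟩ := hG.exists_tail_bound hq0 hq2 hF hσ hx₀ (hG.nonneg 0 t ht x hx).2
    (hG.a_pos t ht)
  have hδ := sub_sign_mul_pos hσ hxx₀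
  have hat := hG.a_pos t ht
  have hA := (hG.nonneg 0 t ht x hx).1
  refine Tendsto.const_mul _ (tendsto_integral_filter_of_dominated_convergence
    (fun s => A 0 t x * K * Real.exp (-s)) ?_ ?_ ?_ ?_)
  · exact Eventually.of_forall fun ε =>
      (hG.continuousOn_tail hF ht hx hσ hx₀ ε).aestronglyMeasurable measurableSet_Ioi
  · filter_upwards [self_mem_nhdsWithin] with ε hε
    rw [ae_restrict_iff' measurableSet_Ioi]
    refine Eventually.of_forall fun s hs => (hK t ht x hx le_rfl le_rfl ε s (le_of_lt hε) hs).trans ?_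
    refine mul_le_mul_of_nonneg_left (mul_le_of_le_one_right (Real.exp_pos _).le
      (Real.exp_le_one_iff.2 ?_)) (by positivity)
    have h1 : 0 ≤ 2 * a t * (x₀ - σ * x) * Real.sin β :=
      mul_nonneg (by positivity) hG.sin_angle_pos.le
    have h2 : 0 ≤ 2 * a t * (x₀ - σ * x) * Real.sin β * s := mul_nonneg h1 (le_of_lt hs)
    linarith
  · exact (integrableOn_exp_neg_Ioi 0).const_mul _
  · refine Eventually.of_forall fun s => ?_
    rw [damped_zero]
    exact (tendsto_damped F _).const_mul _

theorem tendsto_intervalIntegral_damped (hG : IsSectorKernel T β G a p A B) (hp : 0 < q)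
    (hF : HasExpGrowth q C D F) (ht : t ∈ timeInterval T) (hx : x ≠ 0) (x₀ : ℝ) :
    Tendsto (fun ε : ℝ => ∫ y in (-x₀)..x₀, G t x y * damped ε F y) (𝓝[>] 0)
      (𝓝 (∫ y in (-x₀)..x₀, G t x y * F y)) := by
  have hreal : ∀ y : ℝ, y ≠ 0 → (y : ℂ) ∈ doubleSector β := fun y hy =>
    real_mem_doubleSector hG.angle_pos.le hG.angle_lt hy
  have hcont : ∀ ε : ℝ, ContinuousOn (fun y : ℝ => G t x y * damped ε F y) {0}ᶜ := fun ε =>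
    ((hG.cont t ht x hx).comp (by fun_prop) fun y hy => hreal y hy).mul
      ((differentiable_damped hF.differentiable ε).continuous.comp
        Complex.continuous_ofReal).continuousOn
  refine intervalIntegral.tendsto_integral_filter_of_dominated_convergence
    (fun y => A 0 t x * Real.exp (B 0 t x * |y| ^ p) * (C * Real.exp (D * |y| ^ q))) ?_ ?_ ?_ ?_
  · exact Eventually.of_forall fun ε =>
      (measurable_of_continuousOn_compl_singleton 0 (hcont ε)).aestronglyMeasurable
  · filter_upwards [self_mem_nhdsWithin] with ε hε
    filter_upwards [compl_mem_ae_iff.2 (measure_singleton (0 : ℝ))] with y hy _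
    have h1 := hG.norm_le ht hx (hreal y hy) le_rfl le_rfl
    have h3 : ‖phase (a t) x y‖ = 1 := by rw [norm_phase]; simp
    have h2 := (norm_damped_le (le_of_lt hε) F
      (re_sq_nonneg_of_mem_doubleSector hG.angle_le (hreal y hy))).trans (hF.bound y)
    rw [h3, mul_one, Complex.norm_real, Real.norm_eq_abs] at h1
    rw [Complex.norm_real, Real.norm_eq_abs] at h2
    rw [norm_mul]
    have hA := (hG.nonneg 0 t ht x hx).1
    exact mul_le_mul h1 h2 (norm_nonneg _) (by positivity)
  · have hp' : Continuous fun y : ℝ => |y| ^ p :=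
      continuous_abs.rpow_const fun y => Or.inr hG.p_pos.le
    have hq' : Continuous fun y : ℝ => |y| ^ q :=
      continuous_abs.rpow_const fun y => Or.inr hp.le
    exact Continuous.intervalIntegrable (by fun_prop) _ _
  · exact Eventually.of_forall fun y _ => (tendsto_damped F y).const_mul _

/-- The damping is removed from each piece separately. For `|x| < x₀` the linear exponent on the
tails is nonpositive, which gives a majorant uniform in `ε`. -/
theorem rayWave_eq_intervalIntegral_add (hG : IsSectorKernel T β G a p A B) (hq0 : 0 < q)
    (hq2 : q < 2) (hF : HasExpGrowth q C D F) (ht : t ∈ timeInterval T) (hx : x ≠ 0)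
    (hxx₀ : |x| < x₀) :
    rayWave T β G F 0 t x = (∫ y in (-x₀)..x₀, G t x y * F y) +
      tailIntegral β G F 1 x₀ 0 t x + tailIntegral β G F (-1) x₀ 0 t x := by
  refine tendsto_nhds_unique (hG.tendsto_rayWave hq0 hq2 hF ht hx) ?_
  refine (((hG.tendsto_intervalIntegral_damped hq0 hF ht hx x₀).add
    (hG.tendsto_tailIntegral hq0 hq2 hF ht hx (Or.inl rfl) hxx₀)).add
    (hG.tendsto_tailIntegral hq0 hq2 hF ht hx (Or.inr rfl) hxx₀)).congr' ?_
  filter_upwards [self_mem_nhdsWithin] with ε hε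
  rw [← hG.rayWave_zero_angle_eq_rayWave hq0 hq2 hF ht hx hε]
  exact (hG.rayWave_zero_angle_eq hq0 hq2 hF ht hx hε ((abs_nonneg x).trans hxx₀.le)).symm

theorem _root_.Supershift.eventually_mem_timeInterval (hT : 0 < T) :
    ∀ᶠ t in 𝓝[>] (0 : ℝ), t ∈ timeInterval T := by
  have h : ∀ᶠ t : ℝ in 𝓝 0, (t : EReal) < T :=
    (continuous_coe_real_ereal.tendsto (0 : ℝ)).eventually (gt_mem_nhds (by simpa using hT))
  filter_upwards [self_mem_nhdsWithin, nhdsWithin_le_nhds h] with t h1 h2 using ⟨h1, h2⟩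

/-- The tail is at most `A₀ K ∫ exp(-c a s) ds = A₀ K / (c a)`. With `A₀ = O(√a)` this is `O(1 /
√a)`, which vanishes because `a → ∞`. -/
theorem tendsto_tailIntegral_time (hG : IsSectorKernel T β G a p A B) (hT : 0 < T) (hq0 : 0 < q)
    (hq2 : q < 2) (hF : HasExpGrowth q C D F) (hx : x ≠ 0) (hσ : σ = 1 ∨ σ = -1) (hxx₀ : |x| < x₀)
    (ha : Tendsto a (𝓝[>] 0) atTop)
    (hK : ∃ K : ℝ, ∀ᶠ t in 𝓝[>] (0 : ℝ), A 0 t x / √(a t) ≤ K ∧ B 0 t x ≤ K) :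
    Tendsto (fun t => tailIntegral β G F σ x₀ 0 t x) (𝓝[>] 0) (𝓝 0) := by
  obtain ⟨K₀, hK₀⟩ := hK
  have hx₀ : 0 ≤ x₀ := (abs_nonneg x).trans hxx₀.le
  -- Since `a t ≥ 1` for small `t`, the lower bound `1` gives a constant independent of `t`.
  obtain ⟨K, hK0, hK⟩ := hG.exists_tail_bound hq0 hq2 hF hσ hx₀ (abs_nonneg K₀) one_pos
  have hδ := sub_sign_mul_pos hσ hxx₀
  set c := 2 * (x₀ - σ * x) * Real.sin β with hc
  have hcpos : 0 < c := mul_pos (by positivity) hG.sin_angle_pos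
  have hlim : Tendsto (fun t => |K₀| * K / c * (√(a t))⁻¹) (𝓝[>] 0) (𝓝 0) := by
    have := (tendsto_inv_atTop_zero.comp (Real.tendsto_sqrt_atTop.comp ha)).const_mul (|K₀| * K / c)
    simpa using this
  refine squeeze_zero_norm' ?_ hlim
  filter_upwards [hK₀, eventually_mem_timeInterval hT, ha.eventually_ge_atTop 1] with t hKt ht hat
  have hapos : 0 < a t := hG.a_pos t ht
  have hsq : 0 < √(a t) := Real.sqrt_pos.2 hapos
  have hA : A 0 t x ≤ |K₀| * √(a t) := by
    have := (div_le_iff₀ hsq).1 hKt.1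
    exact this.trans (mul_le_mul_of_nonneg_right (le_abs_self _) hsq.le)
  have hA0 := (hG.nonneg 0 t ht x hx).1
  rw [tailIntegral, norm_mul, Complex.norm_exp_ofReal_mul_I, one_mul]
  have hneg : -(c * a t) < 0 := by
    have := mul_pos hcpos hapos; linarith
  have hintg : IntegrableOn (fun s : ℝ => |K₀| * √(a t) * K * Real.exp (-(c * a t) * s)) (Ioi 0) :=
    (integrableOn_exp_mul_Ioi hneg 0).const_mul _
  have hle := norm_integral_le_of_norm_le hintg (f := fun s : ℝ =>
    G t x (σ * (x₀ + Complex.exp (β * Complex.I) * s)) *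
      damped 0 F (σ * (x₀ + Complex.exp (β * Complex.I) * s))) (by
    rw [ae_restrict_iff' measurableSet_Ioi]
    refine Eventually.of_forall fun s hs =>
      (hK t ht x hx hat (hKt.2.trans (le_abs_self _)) 0 s le_rfl hs).trans ?_
    have h1 : Real.exp (-s) ≤ 1 := Real.exp_le_one_iff.2 (by linarith [show (0 : ℝ) < s from hs])
    have h2 : -(2 * a t * (x₀ - σ * x) * Real.sin β) * s = -(c * a t) * s := by rw [hc]; ring
    rw [h2]
    exact mul_le_mul (mul_le_mul_of_nonneg_right hA hK0)
      (mul_le_of_le_one_left (Real.exp_pos _).le h1) (by positivity) (by positivity))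
  refine hle.trans (le_of_eq ?_)
  rw [integral_const_mul, integral_exp_mul_Ioi hneg]
  simp only [mul_zero, Real.exp_zero]
  have hs2 : √(a t) * √(a t) = a t := Real.mul_self_sqrt hapos.le
  field_simp
  rw [pow_two, hs2]; ring

theorem tendsto_rayWave_time (hG : IsSectorKernel T β G a p A B) (hT : 0 < T) (hq0 : 0 < q)
    (hq2 : q < 2) (hF : HasExpGrowth q C D F) (hx : x ≠ 0)
    (ha : Tendsto a (𝓝[>] 0) atTop)
    (hK : ∃ K : ℝ, ∀ᶠ t in 𝓝[>] (0 : ℝ), A 0 t x / √(a t) ≤ K ∧ B 0 t x ≤ K)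
    (hxx₀ : |x| < x₀)
    (hi : Tendsto (fun t => ∫ y in (-x₀)..x₀, G t x y * F y) (𝓝[>] 0) (𝓝 (F x))) :
    Tendsto (fun t => rayWave T β G F 0 t x) (𝓝[>] 0) (𝓝 (F x)) := by
  have h := (hi.add (hG.tendsto_tailIntegral_time hT hq0 hq2 hF hx (Or.inl rfl) hxx₀ ha hK)).add
    (hG.tendsto_tailIntegral_time hT hq0 hq2 hF hx (Or.inr rfl) hxx₀ ha hK)
  rw [add_zero, add_zero] at h
  refine h.congr' ?_
  filter_upwards [eventually_mem_timeInterval hT] with t ht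
  exact (hG.rayWave_eq_intervalIntegral_add hq0 hq2 hF ht hx hxx₀).symm

end IsSectorKernel

end

/-! ### Independence of values outside the domain -/

section Congruence

variable {T : EReal} {Ψ₁ Ψ₂ : ℝ → ℝ → ℂ}

theorem deriv_eq_of_eq_off_zero {f g : ℝ → ℂ} (h : ∀ x, x ≠ 0 → f x = g x) {x : ℝ} (hx : x ≠ 0) :
    deriv f x = deriv g x := by
  refine EventuallyEq.deriv_eq ?_
  filter_upwards [isOpen_ne.mem_nhds hx] with s hs using h s hs

theorem IsAC12.congr (h₁ : IsAC12 T Ψ₁)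
    (h : ∀ t ∈ timeInterval T, ∀ x, x ≠ 0 → Ψ₁ t x = Ψ₂ t x) : IsAC12 T Ψ₂ := by
  refine ⟨fun x hx => (h₁.1 x hx).congr fun t ht => h t ht x hx, fun t ht => ?_⟩
  obtain ⟨h2, h3, h4⟩ := h₁.2 t ht
  refine ⟨h2.congr_mul 1 fun x hx => by rw [mul_one, h t ht x hx], fun x hx => ?_,
    h4.congr_mul 1 fun x hx => by rw [mul_one, deriv_eq_of_eq_off_zero (h t ht) hx]⟩
  refine (h3 x hx).congr_of_eventuallyEq ?_
  filter_upwards [isOpen_ne.mem_nhds hx] with s hs using (h t ht s hs).symm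

theorem SolvesSchroedinger.congr {V : ℝ → ℝ → ℂ} (h₁ : SolvesSchroedinger T V Ψ₁)
    (h : ∀ t ∈ timeInterval T, ∀ x, x ≠ 0 → Ψ₁ t x = Ψ₂ t x) : SolvesSchroedinger T V Ψ₂ := by
  unfold SolvesSchroedinger at h₁ ⊢
  filter_upwards [h₁] with r hr ht hx
  have e1 : deriv (fun t => Ψ₂ t r.2) r.1 = deriv (fun t => Ψ₁ t r.2) r.1 := by
    refine EventuallyEq.deriv_eq ?_
    filter_upwards [(isOpen_timeInterval T).mem_nhds ht] with s hs using (h s hs r.2 hx).symm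
  have e2 : deriv (deriv (Ψ₂ r.1)) r.2 = deriv (deriv (Ψ₁ r.1)) r.2 :=
    deriv_eq_of_eq_off_zero (fun x hx => (deriv_eq_of_eq_off_zero (h r.1 ht) hx).symm) hx
  rw [e1, e2, ← h r.1 ht r.2 hx]
  exact hr ht hx

theorem SatisfiesTransmission.congr {M N : Matrix (Fin 2) (Fin 2) ℂ} {f g : ℝ → ℂ}
    (hf : SatisfiesTransmission M N f) (h : ∀ x, x ≠ 0 → f x = g x) :
    SatisfiesTransmission M N g := by
  have hp : f =ᶠ[𝓝[>] 0] g := by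
    filter_upwards [self_mem_nhdsWithin] with x hx using h x (ne_of_gt hx)
  have hm : f =ᶠ[𝓝[<] 0] g := by
    filter_upwards [self_mem_nhdsWithin] with x hx using h x (ne_of_lt hx)
  have hp' : deriv f =ᶠ[𝓝[>] 0] deriv g := by
    filter_upwards [self_mem_nhdsWithin] with x hx using deriv_eq_of_eq_off_zero h (ne_of_gt hx)
  have hm' : deriv f =ᶠ[𝓝[<] 0] deriv g := by
    filter_upwards [self_mem_nhdsWithin] with x hx using deriv_eq_of_eq_off_zero h (ne_of_lt hx)
  refine ⟨fun hN hM => ?_, fun hN => ?_⟩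
  · obtain ⟨up, um, h1, h2, h3⟩ := hf.1 hN hM
    exact ⟨up, um, h1.congr' hp, h2.congr' hm, h3⟩
  · obtain ⟨up, um, dp, dm, h1, h2, h3, h4, h5⟩ := hf.2 hN
    exact ⟨up, um, dp, dm, h1.congr' hp, h2.congr' hm, h3.congr' hp', h4.congr' hm', h5⟩

end Congruence

theorem exists_hasExpGrowth {q : ℝ} {F : ℂ → ℂ} (hF : F ∈ expGrowth q) :
    ∃ C D, HasExpGrowth q C D F := by
  obtain ⟨hd, C, D, hC, hD, hb⟩ := hF
  exact ⟨C, D, hd, hC, hD, hb⟩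

theorem contDiff_comp_ofReal {F : ℂ → ℂ} (hF : Differentiable ℂ F) :
    ContDiff ℝ ∞ fun y : ℝ => F y :=
  (hF.contDiff.restrict_scalars ℝ).comp Complex.ofRealCLM.contDiff

/-! ### Wave functions of a Green's function: solutions, linearity, continuity -/

section Green

variable {T : EReal} {V : ℝ → ℝ → ℂ} {M N : Matrix (Fin 2) (Fin 2) ℂ} {G : ℝ → ℝ → ℝ → ℂ}

/-- The continuation of a Green's function, restricted to a double sector of opening at most
`π / 4`. -/
theorem IsGreensFunction.exists_isSectorKernel (hG : IsGreensFunction T V M N G) :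
    ∃ (β : ℝ) (Gc : ℝ → ℝ → ℂ → ℂ) (a : ℝ → ℝ) (p : ℝ) (A B : Fin 3 → ℝ → ℝ → ℝ),
      IsSectorKernel T β Gc a p A B ∧
      (∀ t ∈ timeInterval T, ∀ x : ℝ, x ≠ 0 → ∀ y : ℝ, y ≠ 0 → Gc t x (y : ℂ) = G t x y) ∧
      (∀ z ∈ doubleSector β, SolvesSchroedinger T V fun t x => Gc t x z) ∧
      Tendsto a (𝓝[>] 0) atTop ∧
      (∀ x : ℝ, x ≠ 0 → ∃ K : ℝ, ∀ᶠ t in 𝓝[>] (0 : ℝ), A 0 t x / √(a t) ≤ K ∧ B 0 t x ≤ K) ∧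
      (∀ t ∈ timeInterval T,
        (M ≠ 0 → N = 0 → ∃ K : ℝ, ∀ᶠ x in 𝓝[≠] (0 : ℝ), A 0 t x ≤ K ∧ B 0 t x ≤ K) ∧
        (N ≠ 0 → ∃ K : ℝ, ∀ᶠ x in 𝓝[≠] (0 : ℝ),
          A 0 t x ≤ K ∧ A 1 t x ≤ K ∧ B 0 t x ≤ K ∧ B 1 t x ≤ K)) := by
  obtain ⟨α, hα0, hα, Gc, h1, h2, -, -, a, ha, hapos, hat, p, hp0, hp2, A, B, hA, hB, hnn, hb, hb0,
    hbx⟩ := hG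
  -- The opening is reduced to at most `π/4`, so that `Re z² ≥ 0` on the sector; all assumptions
  -- restrict to the smaller sector.
  have hsub : doubleSector (min α (Real.pi / 4)) ⊆ doubleSector α := doubleSector_mono (min_le_left _ _)
  refine ⟨min α (Real.pi / 4), Gc, a, p, A, B, ?_, fun t ht x hx => (h1 t ht x hx).1,
    fun z hz => (h2 z (hsub hz)).2, hat, hb0, hbx⟩
  exact
    { angle_pos := lt_min hα0 (by linarith [Real.pi_pos])
      angle_le := min_le_right _ _
      cont := fun t ht x hx => (h1 t ht x hx).2.1.mono hsub
      holo := fun t ht x hx => (h1 t ht x hx).2.2.mono (interior_mono hsub)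
      ac12 := fun z hz => (h2 z (hsub hz)).1
      a_ac := ha
      a_pos := hapos
      p_pos := hp0
      p_lt := hp2
      A_cont := hA
      B_cont := hB
      nonneg := hnn
      bound := fun t ht x hx z hz => hb t ht x hx z (hsub hz) }

theorem IsGreensFunction.waveFunctionSolves (hT : 0 < T) (hG : IsGreensFunction T V M N G) {q : ℝ}
    (hq0 : 0 < q) (hq2 : q < 2) {F : ℂ → ℂ} (hF : F ∈ expGrowth q) :
    WaveFunctionSolves T V M N G F := by
  obtain ⟨β, Gc, a, p, A, B, hK, hr, hV, ha, hb0, hbx⟩ := hG.exists_isSectorKernel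
  obtain ⟨-, -, -, -, -, -, htr, hdelta, -⟩ := hG
  obtain ⟨C, D, hF'⟩ := exists_hasExpGrowth hF
  have hw : ∀ t ∈ timeInterval T, ∀ x, x ≠ 0 → rayWave T β Gc F 0 t x = waveFunction G F t x :=
    fun t ht x hx => (hK.waveFunction_eq hq0 hq2 hF' ht hx (hr t ht x hx)).symm
  have hdom := hK.isDominatedFamily_ray (ε := 0) hq0 hq2 hF' le_rfl
  refine ⟨fun t ht x hx => ⟨fun ε hε =>
    hK.integrable_regularizedIntegrand hq0 hq2 hF' ht hx (hr t ht x hx) hε, ?_⟩, ?_, ?_, ?_, ?_⟩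
  · rw [← hw t ht x hx]
    exact hK.tendsto_regularized hq0 hq2 hF' ht hx (hr t ht x hx)
  · exact hdom.isAC12_integral.congr hw
  · exact (hdom.solvesSchroedinger_integral
      (hK.solvesSchroedinger_weightedKernel ⟨hK.angle_pos.le, le_rfl⟩ hV)).congr hw
  · intro t ht
    refine SatisfiesTransmission.congr (hK.satisfiesTransmission_rayWave hq0 hq2 hF' ht (hbx t ht).1
      (hbx t ht).2 fun y hy => ?_) (hw t ht)
    exact (htr y hy t ht).congr fun x hx => (hr t ht x hx y hy).symm
  · intro x hx
    obtain ⟨x₀, hxx₀, hδ⟩ := hdelta x hx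
    have hi := hδ (fun y => F y) (contDiff_comp_ofReal hF'.differentiable).contDiffOn
    have hi' : Tendsto (fun t => ∫ y in (-x₀)..x₀, Gc t x y * F y) (𝓝[>] 0) (𝓝 (F x)) := by
      refine hi.congr' ?_
      filter_upwards [eventually_mem_timeInterval hT] with t ht
      refine intervalIntegral.integral_congr_ae ?_
      filter_upwards [compl_mem_ae_iff.2 (measure_singleton (0 : ℝ))] with y hy _
      rw [hr t ht x hx y hy]
    refine (hK.tendsto_rayWave_time hT hq0 hq2 hF' hx ha (hb0 x hx) hxx₀ hi').congr' ?_
    filter_upwards [eventually_mem_timeInterval hT] with t ht using hw t ht x hx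

theorem IsGreensFunction.waveFunction_sum (hG : IsGreensFunction T V M N G) {q : ℝ}
    (hq0 : 0 < q) (hq2 : q < 2) {ι : Type*} {s : Finset ι} {c : ι → ℂ} {f : ι → ℂ → ℂ} {F : ℂ → ℂ}
    (hf : ∀ i ∈ s, f i ∈ expGrowth q) (hF : F ∈ expGrowth q) (hsum : ∀ z, F z = ∑ i ∈ s, c i * f i z)
    {t x : ℝ} (ht : t ∈ timeInterval T) (hx : x ≠ 0) :
    waveFunction G F t x = ∑ i ∈ s, c i * waveFunction G (f i) t x := by
  obtain ⟨β, Gc, a, p, A, B, hK, hr, -⟩ := hG.exists_isSectorKernel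
  have hw : ∀ F ∈ expGrowth q, Integrable (fun y : ℝ =>
        Gc t x (Complex.exp (β * Complex.I) * y) * rayWeight β 0 F y) ∧ waveFunction G F t x =
      ∫ y : ℝ, Gc t x (Complex.exp (β * Complex.I) * y) * rayWeight β 0 F y := by
    intro F hF
    obtain ⟨C, D, hF'⟩ := exists_hasExpGrowth hF
    refine ⟨hK.integrable_ray hq0 hq2 hF' ht hx le_rfl, ?_⟩
    rw [hK.waveFunction_eq hq0 hq2 hF' ht hx (hr t ht x hx), IsSectorKernel.rayWave_eq_integral ht hx]
  rw [(hw F hF).2, Finset.sum_congr rfl fun i hi => by rw [(hw (f i) (hf i hi)).2, ← integral_const_mul],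
    ← integral_finsetSum s fun i hi => (hw (f i) (hf i hi)).1.const_mul _]
  refine integral_congr_ae (Eventually.of_forall fun y => ?_)
  simp only [rayWeight, damped_zero, hsum, Finset.mul_sum]
  exact Finset.sum_congr rfl fun i _ => by ring

theorem eventually_norm_sub_le_of_tendstoExpGrowth {q : ℝ} {F : ℕ → ℂ → ℂ} {F₀ : ℂ → ℂ}
    (h : TendstoExpGrowth q F F₀) :
    ∃ B : ℝ, 0 ≤ B ∧ ∀ δ : ℝ, 0 < δ → ∀ᶠ n in atTop, ∀ z,
      ‖F n z - F₀ z‖ ≤ δ * Real.exp (B * ‖z‖ ^ q) := by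
  obtain ⟨-, -, B, hB, hlim⟩ := h
  refine ⟨B, hB, fun δ hδ => ?_⟩
  filter_upwards [hlim.eventually (gt_mem_nhds (ENNReal.ofReal_pos.2 hδ))] with n hn z
  have h1 := (le_iSup (fun z : ℂ =>
    ENNReal.ofReal (‖F n z - F₀ z‖ * Real.exp (-(B * ‖z‖ ^ q)))) z).trans hn.le
  have h2 := (ENNReal.ofReal_le_ofReal_iff hδ.le).1 h1
  rw [Real.exp_neg, ← div_eq_mul_inv, div_le_iff₀ (Real.exp_pos _)] at h2
  exact h2

/-- On the rotated line the kernel times `exp(B' |y|^q)` is bounded by `K exp(-|y|)`, uniformly for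
`x` in the compact set. A difference of initial values bounded by `δ exp(B' ‖z‖^q)` therefore
changes the integral by at most `δ K ∫ exp(-|y|) dy`. -/
theorem IsGreensFunction.tendstoUniformlyOn_waveFunction (hG : IsGreensFunction T V M N G) {q : ℝ}
    (hq0 : 0 < q) (hq2 : q < 2) {F : ℕ → ℂ → ℂ} {F₀ : ℂ → ℂ} (hF : TendstoExpGrowth q F F₀)
    {t : ℝ} (ht : t ∈ timeInterval T) {S : Set ℝ} (hS : IsCompact S) (hS0 : S ⊆ {0}ᶜ) :
    TendstoUniformlyOn (fun n x => waveFunction G (F n) t x) (fun x => waveFunction G F₀ t x)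
      atTop S := by
  obtain ⟨β, Gc, a, p, A, B, hK, hr, -⟩ := hG.exists_isSectorKernel
  obtain ⟨B', hB', hδ⟩ := eventually_norm_sub_le_of_tendstoExpGrowth hF
  have hw : ∀ F ∈ expGrowth q, ∀ x ∈ S, Integrable (fun y : ℝ =>
        Gc t x (Complex.exp (β * Complex.I) * y) * rayWeight β 0 F y) ∧ waveFunction G F t x =
      ∫ y : ℝ, Gc t x (Complex.exp (β * Complex.I) * y) * rayWeight β 0 F y := by
    intro F hF x hxS
    obtain ⟨C, D, hF'⟩ := exists_hasExpGrowth hF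
    have hx : x ≠ 0 := hS0 hxS
    refine ⟨hK.integrable_ray hq0 hq2 hF' ht hx le_rfl, ?_⟩
    rw [hK.waveFunction_eq hq0 hq2 hF' ht hx (hr t ht x hx), IsSectorKernel.rayWave_eq_integral ht hx]
  -- The comparison function itself is used as a weight, so the constant `K` is common to all `n`.
  have hweight : IsWeight q 1 B' 0 fun y : ℝ => ((Real.exp (B' * |y| ^ q) : ℝ) : ℂ) :=
    { continuous := by
        have : Continuous fun y : ℝ => |y| ^ q := continuous_abs.rpow_const fun y => Or.inr hq0.le
        fun_prop
      const_nonneg := zero_le_one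
      rate_nonneg := hB'
      gauss_nonneg := le_rfl
      bound := fun y => by
        rw [Complex.norm_real, Real.norm_of_nonneg (Real.exp_pos _).le]; simp }
  obtain ⟨K, hK0, hKb⟩ := hK.exists_ray_bound hq0 hq2 hweight ht hS hS0
  set J : ℝ := ∫ y : ℝ, Real.exp (-|y|) with hJ
  have hJ0 : 0 ≤ J := integral_nonneg fun y => (Real.exp_pos _).le
  rw [Metric.tendstoUniformlyOn_iff]
  intro e he
  -- With this `δ` the error `δ K J` is strictly below `e`; the summand `1` also covers `K J = 0`.
  filter_upwards [hδ (e / (K * J + 1)) (by positivity)] with n hn x hx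
  rw [dist_comm, dist_eq_norm, (hw _ (hF.1 n) x hx).2, (hw _ hF.2.1 x hx).2,
    ← integral_sub (hw _ (hF.1 n) x hx).1 (hw _ hF.2.1 x hx).1]
  have hle := norm_integral_le_of_norm_le
    (integrable_exp_neg_abs.const_mul (e / (K * J + 1) * K))
    (f := fun y : ℝ => Gc t x (Complex.exp (β * Complex.I) * y) * rayWeight β 0 (F n) y -
      Gc t x (Complex.exp (β * Complex.I) * y) * rayWeight β 0 F₀ y) (by
    filter_upwards [compl_mem_ae_iff.2 (measure_singleton (0 : ℝ))] with y hy
    have h1 := hKb x hx y hy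
    rw [norm_mul, Complex.norm_real, Real.norm_of_nonneg (Real.exp_pos _).le] at h1
    have h2 := hn (Complex.exp (β * Complex.I) * y)
    rw [norm_exp_mul_I_mul] at h2
    have h3 : rayWeight β 0 (F n) y - rayWeight β 0 F₀ y = Complex.exp (β * Complex.I) *
        (F n (Complex.exp (β * Complex.I) * y) - F₀ (Complex.exp (β * Complex.I) * y)) := by
      simp only [rayWeight, damped_zero]; ring
    rw [← mul_sub, h3, norm_mul, norm_mul, Complex.norm_exp_ofReal_mul_I, one_mul]
    calc _ ≤ ‖Gc t x (Complex.exp (β * Complex.I) * y)‖ *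
          (e / (K * J + 1) * Real.exp (B' * |y| ^ q)) :=
          mul_le_mul_of_nonneg_left h2 (norm_nonneg _)
      _ = e / (K * J + 1) *
          (‖Gc t x (Complex.exp (β * Complex.I) * y)‖ * Real.exp (B' * |y| ^ q)) := by ring
      _ ≤ e / (K * J + 1) * (K * Real.exp (-|y|)) := mul_le_mul_of_nonneg_left h1 (by positivity)
      _ = _ := by ring)
  refine hle.trans_lt ?_
  rw [integral_const_mul, ← hJ, div_mul_eq_mul_div, div_mul_eq_mul_div, div_lt_iff₀ (by positivity)]
  have : 0 ≤ K * J := by positivity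
  nlinarith

end Green

end Supershift

theorem theorem4p3
    (T : EReal) (hT : 0 < T) (V : ℝ → ℝ → ℂ) (M N : Matrix (Fin 2) (Fin 2) ℂ)
    (G : ℝ → ℝ → ℝ → ℂ) (hG : Supershift.IsGreensFunction T V M N G)
    (O U : Set ℂ) (hUO : U ⊂ O) (q : ℝ) (hq0 : 0 < q) (hq2 : q < 2)
    (φ : ℂ → ℂ → ℂ) (hφ : ∀ κ ∈ O, φ κ ∈ Supershift.expGrowth q)
    (C : ℕ → ℕ → ℂ) (k : ℕ → ℕ → ℂ) (hk : ∀ n, ∀ l ≤ n, k n l ∈ U)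
    (F : ℕ → ℂ → ℂ)
    (hF : ∀ n z, F n z = ∑ l ∈ Finset.range (n + 1), C n l * φ (k n l) z)
    (κ : ℂ) (hκ : κ ∈ O \ U) (hconv : Supershift.TendstoExpGrowth q F (φ κ)) :
    (∀ κ' ∈ O, Supershift.WaveFunctionSolves T V M N G (φ κ')) ∧
    (∀ n, Supershift.WaveFunctionSolves T V M N G (F n)) ∧
    (∀ t ∈ Supershift.timeInterval T,
      (∀ x : ℝ, x ≠ 0 → ∀ n, Supershift.waveFunction G (F n) t x =
        ∑ l ∈ Finset.range (n + 1), C n l * Supershift.waveFunction G (φ (k n l)) t x) ∧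
      (∀ K : Set ℝ, IsCompact K → K ⊆ {0}ᶜ →
        TendstoUniformlyOn (fun n x => Supershift.waveFunction G (F n) t x)
          (fun x => Supershift.waveFunction G (φ κ) t x) atTop K ∧
        TendstoUniformlyOn
          (fun n x => ∑ l ∈ Finset.range (n + 1),
            C n l * Supershift.waveFunction G (φ (k n l)) t x)
          (fun x => Supershift.waveFunction G (φ κ) t x) atTop K) ∧
      Supershift.AdmitsSupershift (X := {x : ℝ // x ≠ 0}) O U
        (fun κ' x => Supershift.waveFunction G (φ κ') t x)
        (fun n x => Supershift.waveFunction G (F n) t x)) := by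
  have hFg : ∀ n, F n ∈ Supershift.expGrowth q := hconv.1
  have hsum : ∀ t ∈ Supershift.timeInterval T, ∀ x : ℝ, x ≠ 0 → ∀ n,
      Supershift.waveFunction G (F n) t x =
        ∑ l ∈ Finset.range (n + 1), C n l * Supershift.waveFunction G (φ (k n l)) t x :=
    fun t ht x hx n => hG.waveFunction_sum hq0 hq2
      (fun l hl => hφ _ (hUO.1 (hk n l (Nat.lt_succ_iff.1 (Finset.mem_range.1 hl))))) (hFg n) (hF n)
      ht hx
  have hunif : ∀ t ∈ Supershift.timeInterval T, ∀ K : Set ℝ, IsCompact K → K ⊆ {0}ᶜ →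
      TendstoUniformlyOn (fun n x => Supershift.waveFunction G (F n) t x)
        (fun x => Supershift.waveFunction G (φ κ) t x) atTop K :=
    fun t ht K hK hK0 => hG.tendstoUniformlyOn_waveFunction hq0 hq2 hconv ht hK hK0
  refine ⟨fun κ' hκ' => hG.waveFunctionSolves hT hq0 hq2 (hφ κ' hκ'),
    fun n => hG.waveFunctionSolves hT hq0 hq2 (hFg n), fun t ht => ⟨hsum t ht,
    fun K hK hK0 => ⟨hunif t ht K hK hK0, (hunif t ht K hK hK0).congr (Eventually.of_forall
      fun n x hx => hsum t ht x (hK0 hx) n)⟩, hUO, ⟨C, k, hk, fun n s => hsum t ht s s.2 n⟩,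
    κ, hκ, fun K hK => ?_⟩⟩
  -- A compact set of the punctured line has a compact image in `ℝ` that avoids `0`.
  have h := hunif t ht (Subtype.val '' K) (hK.image continuous_subtype_val) (by
    rintro _ ⟨s, -, rfl⟩; exact s.2)
  exact (h.comp Subtype.val).mono (subset_preimage_image _ _)
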